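/- A \emph{prederivator} is a 2-functor $D\colon \mathrm{Cat}^{op}\to\mathrm{CAT}$ from small categories to (not necessarily small) categories, contravariant on functors and covariant on natural transformations (pseudofunctors are allowed). Write $u^*=D(u)\colon D(B)\to D(A)$ for a functor $u\colon A\to B$, and let $\mathbb 1$ be the terminal category. Prederivators form a 2-category with pseudonatural transformations as morphisms and modifications as 2-cells; adjunctions between morphisms of prederivators are adjunctions in this 2-category. A prederivator $D$ is a \emph{derivator} if (Der1) for every small family $(A_i)_{i\in I}$ of small categories the canonical functor $D(\coprod_i A_i)\to\prod_i D(A_i)$ is an equivalence; (Der2) a morphism $f$ of $D(A)$ is an isomorphism as soon as $a^*f$ is an isomorphism in $D(\mathbb 1)$ for every object $a\colon\mathbb 1\to A$; (Der3) every $u^*$ has a left adjoint $u_!$ and a right adjoint $u_*$; (Der4) for every $u\colon A\to B$ and every object $b$ of $B$, with slice categories $p\colon (u/b)\to A$, $q\colon (b/u)\to A$ and the functors $\pi$ from them to $\mathbb 1$, the canonical mates $\pi_!p^*\to b^*u_!$ and $b^*u_*\to\pi_*q^*$ are isomorphisms. A derivator $D$ is \emph{pointed} if $D(\mathbb 1)$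 has a zero object. For a small category $A$ let $D^A$ be the prederivator $C\mapsto D(A\times C)$. For $u\colon A\to B$, the morphism $u^*\colon D^B\to D^A$ has components $(u\times \mathrm{id}_C)^*$, and $u_!,u_*\colon D^A\to D^B$ denote the left and the right adjoint morphism of $u^*$ (with $D^{\mathbb 1}$ identified with $D$). A \emph{cosieve} is a fully faithful functor $u\colon A\to B$, injective on objects, such that for every morphism $u(a)\to b$ in $B$ the object $b$ lies in the image of $u$; a \emph{sieve} is defined dually, by morphisms $b\to u(a)$. Let $[1]=(0<1)$, let $0,1\colon\mathbb 1\to[1]$ classify its objects, and let $\emptyset\colon\emptyset\to\mathbb 1$ be the empty functor. \textbf{Proposition.} The following are equivalent for a derivator $D$. (i) The derivator $D$ is pointed. (ii) The morphism $\emptyset_!\colon D^\emptyset\to D$ is a right adjoint. (iii) The left Kan extension morphism $1_!\colon D\to D^{[1]}$ is a right adjoint. (iv) For every cosieve $u\colon A\to B$ between small categories, the left Kan extension morphism $u_!\colon D^A\to D^B$ is a right adjoint. (v) The morphism $\emptyset_*\colon D^\emptyset\to D$ is a left adjoint. (vi) The right Kan extension morphism $0_*\colon D\to D^{[1]}$ is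 a left adjoint. (vii) For every sieve $u\colon A\to B$ between small categories, the right Kan extension morphism $u_*\colon D^A\to D^B$ is a left adjoint. Here "is a right (left) adjoint" means that the morphism has a left (right) adjoint in the 2-category of prederivators; each of (ii)-(vii) includes that the Kan extension morphism in question exists as a morphism of prederivators (this holds in every derivator). -/

import Mathlib

open CategoryTheory Bicategory Opposite Bicategory.Opposite
open scoped Pseudofunctor.StrongTrans

/-! ## Generalities on pseudofunctors -/

namespace DerivatorAux

universe w₁ w₂ w₃ v₁ v₂ v₃ u₁ u₂ u₃

section
variable {C : Type u₁} [Category.{v₁} C]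
lemma id_eq_id_comp_id (x : C) : 𝟙 x = 𝟙 x ≫ 𝟙 x := by simp
lemma eq_id_comp_comp_id {x y : C} (f : x ⟶ y) : f = 𝟙 x ≫ f ≫ 𝟙 y := by simp
end
section
variable {C : Type u₂} [Bicategory.{w₂, v₂} C] {E : Type u₃} [Bicategory.{w₃, v₃} E]
  (D : Pseudofunctor C E)

/-- The image under a pseudofunctor of a square commuting up to an invertible 2-cell. -/
def mapSq {a b c d : C} {f : a ⟶ b} {s : b ⟶ d} {t : a ⟶ c} {h : c ⟶ d} (n : f ≫ s ≅ t ≫ h) :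
    D.map f ≫ D.map s ≅ D.map t ≫ D.map h :=
  (D.mapComp f s).symm ≪≫ D.map₂Iso n ≪≫ D.mapComp t h

lemma mapSq_naturality {a b c d : C} {f f' : a ⟶ b} {s : b ⟶ d} {t : a ⟶ c} {h h' : c ⟶ d}
    (n : f ≫ s ≅ t ≫ h) (n' : f' ≫ s ≅ t ≫ h') (η : f ⟶ f') (θ : h ⟶ h')
    (H : η ▷ s ≫ n'.hom = n.hom ≫ t ◁ θ) :
    D.map₂ η ▷ D.map s ≫ (mapSq D n').hom = (mapSq D n).hom ≫ D.map t ◁ D.map₂ θ := by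
  have h := congrArg D.map₂ H
  simp only [PrelaxFunctor.map₂_comp, Pseudofunctor.map₂_whisker_left,
    Pseudofunctor.map₂_whisker_right] at h
  have h' := (D.mapComp f s).inv ≫= h =≫ (D.mapComp t h').hom
  simpa [mapSq] using h'

lemma mapSq_id {a b : C} {f : a ⟶ a} {s : a ⟶ b} {h : b ⟶ b}
    (n : f ≫ s ≅ s ≫ h) (i : f ≅ 𝟙 a) (j : h ≅ 𝟙 b)
    (H : n.hom ≫ s ◁ j.hom = i.hom ▷ s ≫ (λ_ s).hom ≫ (ρ_ s).inv) :
    (mapSq D n).hom ≫ D.map s ◁ (D.map₂Iso j ≪≫ D.mapId b).hom =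
      (D.map₂Iso i ≪≫ D.mapId a).hom ▷ D.map s ≫ (λ_ (D.map s)).hom ≫ (ρ_ (D.map s)).inv := by
  have e : n.hom = i.hom ▷ s ≫ (λ_ s).hom ≫ (ρ_ s).inv ≫ s ◁ j.inv := by
    simp [← Category.assoc, ← H]
    simp only [Category.assoc, ← Bicategory.whiskerLeft_comp]
    simp
  have e' : D.map₂ (ρ_ s).inv = (ρ_ _).inv ≫ D.map s ◁ (D.mapId b).inv ≫ (D.mapComp s (𝟙 b)).inv := by
    rw [← cancel_mono (D.map₂ (ρ_ s).hom), ← D.map₂_comp]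
    simp
  have c : D.map₂ j.inv ≫ D.map₂ j.hom = 𝟙 _ := by
    rw [← D.map₂_comp, j.inv_hom_id, D.map₂_id]
  have c' : D.map s ◁ D.map₂ j.inv ≫ D.map s ◁ D.map₂ j.hom ≫ D.map s ◁ (D.mapId b).hom =
      D.map s ◁ (D.mapId b).hom := by
    rw [← Bicategory.whiskerLeft_comp_assoc, c, Bicategory.whiskerLeft_id, Category.id_comp]
  simp [mapSq, e, e', c']

lemma mapSq_comp {a b c a' b' c' : C} {f : a ⟶ b} {g : b ⟶ c} {f' : a' ⟶ b'} {g' : b' ⟶ c'}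
    {k : a ⟶ c} {k' : a' ⟶ c'} (i : k ≅ f ≫ g) (i' : k' ≅ f' ≫ g')
    {s : a ⟶ a'} {t : b ⟶ b'} {r : c ⟶ c'}
    (n : f ≫ t ≅ s ≫ f') (m : g ≫ r ≅ t ≫ g') (l : k ≫ r ≅ s ≫ k')
    (H : l.hom ≫ s ◁ i'.hom = i.hom ▷ r ≫ (α_ _ _ _).hom ≫ f ◁ m.hom ≫
        (α_ _ _ _).inv ≫ n.hom ▷ g' ≫ (α_ _ _ _).hom) :
    (mapSq D l).hom ≫ D.map s ◁ (D.map₂Iso i' ≪≫ D.mapComp f' g').hom =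
      (D.map₂Iso i ≪≫ D.mapComp f g).hom ▷ D.map r ≫ (α_ _ _ _).hom ≫
        D.map f ◁ (mapSq D m).hom ≫ (α_ _ _ _).inv ≫ (mapSq D n).hom ▷ D.map g' ≫
          (α_ _ _ _).hom := by
  have h := congrArg D.map₂ H
  have e : D.map₂ (α_ f t g').inv = (D.mapComp f (t ≫ g')).hom ≫ D.map f ◁ (D.mapComp t g').hom ≫
      (α_ _ _ _).inv ≫ (D.mapComp f t).inv ▷ D.map g' ≫ (D.mapComp (f ≫ t) g').inv := by
    rw [← cancel_mono (D.map₂ (α_ f t g').hom), ← D.map₂_comp]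
    simp
  simp only [PrelaxFunctor.map₂_comp, Pseudofunctor.map₂_whisker_left,
    Pseudofunctor.map₂_whisker_right, e, Pseudofunctor.map₂_associator] at h
  have h' := (D.mapComp k r).inv ≫= h =≫
    ((D.mapComp s (f' ≫ g')).hom ≫ D.map s ◁ (D.mapComp f' g').hom)
  simpa [mapSq] using h'
end
section
variable {B : Type u₁} [Bicategory.{w₁, v₁} B] {C : Type u₂} [Bicategory.{w₂, v₂} C]
variable {E : Type u₃} [Bicategory.{w₃, v₃} E]

/-- Whiskering a strong transformation `P ⟶ Q` with a pseudofunctor `D`: its components are the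
1-morphisms `D.map (σ.app X)`. -/
def whisker {P Q : Pseudofunctor B C} (σ : P ⟶ Q) (D : Pseudofunctor C E) :
    P.comp D ⟶ Q.comp D where
  app X := D.map (σ.app X)
  naturality f := mapSq D (σ.naturality f)
  naturality_naturality η := mapSq_naturality D _ _ _ _ (σ.naturality_naturality η)
  naturality_id X := mapSq_id D _ _ _ (σ.naturality_id X)
  naturality_comp f g := mapSq_comp D _ _ _ _ _ (σ.naturality_comp f g)

/-- A strong transformation into `id ⋙ D`, regarded as one into `D`. -/
def toTarget {R D : Pseudofunctor B C} (τ : R ⟶ (Pseudofunctor.id B).comp D) : R ⟶ D where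
  app X := τ.app X
  naturality f := τ.naturality f
  naturality_naturality η := τ.naturality_naturality η
  naturality_id X :=
    (congrArg (fun z => (τ.naturality (𝟙 X)).hom ≫ τ.app X ◁ z)
      (show D.map₂ (𝟙 (𝟙 X)) ≫ (D.mapId X).hom = (D.mapId X).hom by simp)).symm.trans
      (τ.naturality_id X)
  naturality_comp {X Y Z} f g :=
    (congrArg (fun z => (τ.naturality (f ≫ g)).hom ≫ τ.app X ◁ z)
      (show D.map₂ (𝟙 (f ≫ g)) ≫ (D.mapComp f g).hom = (D.mapComp f g).hom by simp)).symm.trans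
      (τ.naturality_comp f g)

/-- A strong transformation out of `id ⋙ D`, regarded as one out of `D`. -/
def ofSource {R D : Pseudofunctor B C} (τ : (Pseudofunctor.id B).comp D ⟶ R) : D ⟶ R where
  app X := τ.app X
  naturality f := τ.naturality f
  naturality_naturality η := τ.naturality_naturality η
  naturality_id X :=
    (τ.naturality_id X).trans
      (congrArg (fun z => z ▷ τ.app X ≫ (λ_ (τ.app X)).hom ≫ (ρ_ (τ.app X)).inv)
        (show D.map₂ (𝟙 (𝟙 X)) ≫ (D.mapId X).hom = (D.mapId X).hom by simp))
  naturality_comp {X Y Z} f g :=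
    (τ.naturality_comp f g).trans
      (congrArg (fun z => z ▷ τ.app Z ≫ (α_ _ _ _).hom ≫ D.map f ◁ (τ.naturality g).hom ≫
          (α_ _ _ _).inv ≫ (τ.naturality f).hom ▷ R.map g ≫ (α_ _ _ _).hom)
        (show D.map₂ (𝟙 (f ≫ g)) ≫ (D.mapComp f g).hom = (D.mapComp f g).hom by simp))
end
end DerivatorAux

universe w v u

/-! ## Prederivators and their shifts -/

/-- A prederivator: a (pseudo)functor of 2-categories from small categories to categories,
contravariant on functors and covariant on natural transformations. The 1-morphisms of the
bicategory `Prederivator` are the pseudonatural transformations, its 2-morphisms are the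
modifications. -/
abbrev Prederivator : Type (max (w + 1) (u + 1) (v + 1)) :=
  Pseudofunctor Cat.{w, w}ᵒᵖ Cat.{v, u}

namespace Prederivator

/-- The 2-functor `C ↦ A × C`, on `Catᵒᵖ`. -/
def timesFunctor (A : Cat.{w, w}) : Pseudofunctor Cat.{w, w}ᵒᵖ Cat.{w, w}ᵒᵖ where
  obj C := op (Cat.of (A × C.unop))
  map f := (Functor.prod (𝟭 A) f.unop.toFunctor).toCatHom.op
  map₂ η := op2 (NatTrans.toCatHom₂ (NatTrans.prod (𝟙 (𝟭 A)) η.unop2.toNatTrans))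
  mapId C := Iso.op2 (Cat.Hom.isoMk (NatIso.ofComponents fun _ => Iso.refl _))
  mapComp f g := Iso.op2 (Cat.Hom.isoMk (NatIso.ofComponents fun _ => Iso.refl _))
  map₂_id f := rfl
  map₂_comp η θ := congrArg op2 <| Cat.Hom₂.ext <| NatTrans.ext <| funext fun x =>
    Prod.ext (DerivatorAux.id_eq_id_comp_id x.1) rfl
  map₂_whisker_left f g h η := congrArg op2 <| Cat.Hom₂.ext <| NatTrans.ext <| funext fun x =>
    Prod.ext (DerivatorAux.eq_id_comp_comp_id (𝟙 x.1))
      (DerivatorAux.eq_id_comp_comp_id (f.unop.toFunctor.map (η.unop2.toNatTrans.app x.2)))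
  map₂_whisker_right η h := congrArg op2 <| Cat.Hom₂.ext <| NatTrans.ext <| funext fun x =>
    Prod.ext (DerivatorAux.eq_id_comp_comp_id (𝟙 x.1))
      (DerivatorAux.eq_id_comp_comp_id (η.unop2.toNatTrans.app (h.unop.toFunctor.obj x.2)))
  map₂_associator f g h := congrArg op2 <| Cat.Hom₂.ext <| NatTrans.ext <|
   funext fun x => by
    refine Prod.ext ?_ ?_
    · change 𝟙 x.1 = 𝟙 x.1 ≫ 𝟙 x.1 ≫ 𝟙 x.1 ≫ 𝟙 x.1 ≫ 𝟙 x.1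
      simp
    · change 𝟙 (f.unop.toFunctor.obj (g.unop.toFunctor.obj (h.unop.toFunctor.obj x.2))) =
        𝟙 _ ≫ 𝟙 _ ≫ 𝟙 _ ≫ f.unop.toFunctor.map (𝟙 (g.unop.toFunctor.obj (h.unop.toFunctor.obj x.2))) ≫ 𝟙 _
      simp
  map₂_left_unitor f := congrArg op2 <| Cat.Hom₂.ext <| NatTrans.ext <| funext fun x => by
    refine Prod.ext ?_ ?_
    · change 𝟙 x.1 = 𝟙 x.1 ≫ 𝟙 x.1 ≫ 𝟙 x.1
      simp
    · change 𝟙 (f.unop.toFunctor.obj x.2) = 𝟙 _ ≫ 𝟙 _ ≫ 𝟙 _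
      simp
  map₂_right_unitor f := congrArg op2 <| Cat.Hom₂.ext <| NatTrans.ext <| funext fun x => by
    refine Prod.ext ?_ ?_
    · change 𝟙 x.1 = 𝟙 x.1 ≫ 𝟙 x.1 ≫ 𝟙 x.1
      simp
    · change 𝟙 (f.unop.toFunctor.obj x.2) = 𝟙 _ ≫ f.unop.toFunctor.map (𝟙 x.2) ≫ 𝟙 _
      simp

/-- `k × C : A × C ⥤ B × C`, as a transformation on `Catᵒᵖ`. -/
def timesMap {A B : Cat.{w, w}} (k : A ⟶ B) : timesFunctor B ⟶ timesFunctor A where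
  app C := (Functor.prod k.toFunctor (𝟭 C.unop)).toCatHom.op
  naturality {C C'} f := Iso.op2 (Cat.Hom.isoMk
    (show k.toFunctor.prod (𝟭 C'.unop) ⋙ (𝟭 B).prod f.unop.toFunctor ≅
        (𝟭 A).prod f.unop.toFunctor ⋙ k.toFunctor.prod (𝟭 C.unop) from
      NatIso.ofComponents fun _ => Iso.refl _))
  naturality_naturality {C C' f g} η := congrArg op2 <| Cat.Hom₂.ext <| NatTrans.ext <|
    funext fun x => by
      refine Prod.ext ?_ ?_
      · change 𝟙 (k.toFunctor.obj x.1) ≫ 𝟙 _ = 𝟙 _ ≫ k.toFunctor.map (𝟙 x.1)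
        simp
      · change η.unop2.toNatTrans.app x.2 ≫ 𝟙 _ = 𝟙 _ ≫ η.unop2.toNatTrans.app x.2
        simp
  naturality_id C := congrArg op2 <| Cat.Hom₂.ext <| NatTrans.ext <| funext fun x => by
    refine Prod.ext ?_ ?_
    · change 𝟙 _ ≫ k.toFunctor.map (𝟙 x.1) = 𝟙 (k.toFunctor.obj x.1) ≫ 𝟙 _ ≫ 𝟙 _
      simp
    · change 𝟙 x.2 ≫ 𝟙 _ = 𝟙 x.2 ≫ 𝟙 _ ≫ 𝟙 _
      simp
  naturality_comp f g := congrArg op2 <| Cat.Hom₂.ext <| NatTrans.ext <| funext fun x => by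
    refine Prod.ext ?_ ?_
    · change 𝟙 _ ≫ k.toFunctor.map (𝟙 x.1) =
        𝟙 (k.toFunctor.obj x.1) ≫ 𝟙 _ ≫ 𝟙 _ ≫ 𝟙 _ ≫ 𝟙 _ ≫ 𝟙 _
      simp
    · change 𝟙 (f.unop.toFunctor.obj (g.unop.toFunctor.obj x.2)) ≫ 𝟙 _ =
        𝟙 _ ≫ 𝟙 _ ≫ f.unop.toFunctor.map (𝟙 (g.unop.toFunctor.obj x.2)) ≫ 𝟙 _ ≫ 𝟙 _ ≫ 𝟙 _
      simp

/-- `c ↦ (a, c) : C ⥤ A × C`, as a transformation on `Catᵒᵖ`. -/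
def timesIncl {A : Cat.{w, w}} (a : A) : timesFunctor A ⟶ Pseudofunctor.id Cat.{w, w}ᵒᵖ where
  app C := (CategoryTheory.Prod.sectR a C.unop).toCatHom.op
  naturality {C C'} f := Iso.op2 (Cat.Hom.isoMk
    (show CategoryTheory.Prod.sectR a C'.unop ⋙ (𝟭 A).prod f.unop.toFunctor ≅
        f.unop.toFunctor ⋙ CategoryTheory.Prod.sectR a C.unop from
      NatIso.ofComponents (fun _ => Iso.refl _) fun {x y} g => Prod.ext
        (show 𝟙 a ≫ 𝟙 a = 𝟙 a ≫ 𝟙 a from rfl)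
        (show f.unop.toFunctor.map g ≫ 𝟙 _ = 𝟙 _ ≫ f.unop.toFunctor.map g by simp)))
  naturality_naturality {C C' f g} η := congrArg op2 <| Cat.Hom₂.ext <| NatTrans.ext <|
    funext fun x => by
      refine Prod.ext ?_ ?_
      · change 𝟙 a ≫ 𝟙 _ = 𝟙 _ ≫ 𝟙 a
        simp
      · change η.unop2.toNatTrans.app x ≫ 𝟙 _ = 𝟙 _ ≫ η.unop2.toNatTrans.app x
        simp
  naturality_id C := congrArg op2 <| Cat.Hom₂.ext <| NatTrans.ext <| funext fun x => by
    refine Prod.ext ?_ ?_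
    · change 𝟙 a ≫ 𝟙 _ = 𝟙 a ≫ 𝟙 _ ≫ 𝟙 _
      simp
    · change 𝟙 x ≫ 𝟙 _ = 𝟙 x ≫ 𝟙 _ ≫ 𝟙 _
      simp
  naturality_comp f g := congrArg op2 <| Cat.Hom₂.ext <| NatTrans.ext <| funext fun x => by
    refine Prod.ext ?_ ?_
    · change 𝟙 a ≫ 𝟙 a = 𝟙 _ ≫ 𝟙 _ ≫ 𝟙 _ ≫ 𝟙 _ ≫ 𝟙 _ ≫ 𝟙 _
      simp
    · change 𝟙 (f.unop.toFunctor.obj (g.unop.toFunctor.obj x)) ≫ 𝟙 _ =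
        𝟙 _ ≫ 𝟙 _ ≫ f.unop.toFunctor.map (𝟙 (g.unop.toFunctor.obj x)) ≫ 𝟙 _ ≫ 𝟙 _ ≫ 𝟙 _
      simp

/-- The projection `A × C ⥤ C`, as a transformation on `Catᵒᵖ`. -/
def timesProj (A : Cat.{w, w}) : Pseudofunctor.id Cat.{w, w}ᵒᵖ ⟶ timesFunctor A where
  app C := (CategoryTheory.Prod.snd A C.unop).toCatHom.op
  naturality {C C'} f := Iso.op2 (Cat.Hom.isoMk
    (show CategoryTheory.Prod.snd A C'.unop ⋙ f.unop.toFunctor ≅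
        (𝟭 A).prod f.unop.toFunctor ⋙ CategoryTheory.Prod.snd A C.unop from
      NatIso.ofComponents fun _ => Iso.refl _))
  naturality_naturality {C C' f g} η := congrArg op2 <| Cat.Hom₂.ext <| NatTrans.ext <|
    funext fun x => by
      change η.unop2.toNatTrans.app x.2 ≫ 𝟙 _ = 𝟙 _ ≫ η.unop2.toNatTrans.app x.2
      simp
  naturality_id C := congrArg op2 <| Cat.Hom₂.ext <| NatTrans.ext <| funext fun x => by
    change 𝟙 x.2 ≫ 𝟙 _ = 𝟙 x.2 ≫ 𝟙 _ ≫ 𝟙 _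
    simp
  naturality_comp f g := congrArg op2 <| Cat.Hom₂.ext <| NatTrans.ext <| funext fun x => by
    change 𝟙 (f.unop.toFunctor.obj (g.unop.toFunctor.obj x.2)) ≫ 𝟙 _ =
      𝟙 _ ≫ 𝟙 _ ≫ f.unop.toFunctor.map (𝟙 (g.unop.toFunctor.obj x.2)) ≫ 𝟙 _ ≫ 𝟙 _ ≫ 𝟙 _
    simp

variable (D : Prederivator.{w, v, u})

/-- The restriction functor `k^* : D(B) ⥤ D(A)` along a functor `k : A ⥤ B`. -/
abbrev pull {A B : Cat.{w, w}} (k : A ⟶ B) : D.obj (op B) ⥤ D.obj (op A) :=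
  (D.map k.op).toFunctor

/-- The shifted prederivator `D^A : C ↦ D(A × C)`. -/
def shift (A : Cat.{w, w}) : Prederivator.{w, v, u} :=
  (timesFunctor A).comp D

/-- The morphism of prederivators `k^* : D^B ⟶ D^A`, with components
`(k × C)^* : D(B × C) ⥤ D(A × C)`. -/
def restrict {A B : Cat.{w, w}} (k : A ⟶ B) : D.shift B ⟶ D.shift A :=
  DerivatorAux.whisker (timesMap k) D

/-- The morphism of prederivators `a^* : D^A ⟶ D` for an object `a` of `A`, with components
`D(A × C) ⥤ D(C)` the restriction along `c ↦ (a, c)`. -/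
def evalAt {A : Cat.{w, w}} (a : A) : D.shift A ⟶ D :=
  DerivatorAux.toTarget (DerivatorAux.whisker (timesIncl a) D)

/-- The morphism of prederivators `π_A^* : D ⟶ D^A`, with components `D(C) ⥤ D(A × C)` the
restriction along the projection `A × C ⥤ C`. -/
def const (A : Cat.{w, w}) : D ⟶ D.shift A :=
  DerivatorAux.ofSource (DerivatorAux.whisker (timesProj A) D)

/-! ## Derivators -/

/-- The terminal category `𝟙`. -/
abbrev pt : Cat.{w, w} := Cat.of (Discrete PUnit.{w + 1})

/-- The empty category `∅`. -/
abbrev emptyCat : Cat.{w, w} := Cat.of (Discrete PEmpty.{w + 1})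

/-- The category `[1] = (0 < 1)`. -/
abbrev arrowCat : Cat.{w, w} :=
  @Cat.of (ULift.{w} (Fin 2)) (Preorder.smallCategory _)

/-- The functor `𝟙 ⥤ A` classifying an object `a`. -/
abbrev objFunctor {A : Cat.{w, w}} (a : A) : pt.{w} ⟶ A := (Functor.fromPUnit a).toCatHom

/-- A 2-cell `p ≫ k ⟶ q ≫ l` of small categories induces `p^* k^* ⟶ q^* l^*`. -/
def pullSquare {A B C E : Cat.{w, w}} {p : E ⟶ A} {k : A ⟶ B} {q : E ⟶ C} {l : C ⟶ B}
    (α : p ≫ k ⟶ q ≫ l) : TwoSquare (D.pull k) (D.pull l) (D.pull p) (D.pull q) :=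
  TwoSquare.mk _ _ _ _
    ((D.mapComp k.op p.op).inv ≫ D.map₂ (op2 α) ≫ (D.mapComp l.op q.op).hom).toNatTrans

/-- The slice category `(k/b)`. -/
abbrev slice {A B : Cat.{w, w}} (k : A ⟶ B) (b : B) : Cat.{w, w} :=
  Cat.of (CostructuredArrow k.toFunctor b)

/-- The slice category `(b/k)`. -/
abbrev coslice {A B : Cat.{w, w}} (k : A ⟶ B) (b : B) : Cat.{w, w} :=
  Cat.of (StructuredArrow b k.toFunctor)

/-- The projection `(k/b) ⥤ A`. -/
abbrev sliceProj {A B : Cat.{w, w}} (k : A ⟶ B) (b : B) : slice k b ⟶ A :=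
  (CostructuredArrow.proj k.toFunctor b).toCatHom

/-- The projection `(b/k) ⥤ A`. -/
abbrev cosliceProj {A B : Cat.{w, w}} (k : A ⟶ B) (b : B) : coslice k b ⟶ A :=
  (StructuredArrow.proj b k.toFunctor).toCatHom

/-- The unique functor `A ⥤ 𝟙`. -/
abbrev toPt (A : Cat.{w, w}) : A ⟶ pt.{w} := (Functor.star A).toCatHom

/-- The tautological transformation of the slice square, `(a, f : k a ⟶ b) ↦ f`. -/
def sliceCell {A B : Cat.{w, w}} (k : A ⟶ B) (b : B) :
    sliceProj k b ≫ k ⟶ toPt (slice k b) ≫ objFunctor b where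
  toNatTrans :=
    { app := fun x => x.hom
      naturality := fun _ _ f => (CostructuredArrow.w f).trans (Category.comp_id _).symm }

/-- The tautological transformation of the coslice square, `(a, f : b ⟶ k a) ↦ f`. -/
def cosliceCell {A B : Cat.{w, w}} (k : A ⟶ B) (b : B) :
    toPt (coslice k b) ≫ objFunctor b ⟶ cosliceProj k b ≫ k where
  toNatTrans :=
    { app := fun x => x.hom
      naturality := fun _ _ f => (Category.id_comp _).trans (StructuredArrow.w f).symm }

/-- The axioms of a derivator. -/
structure IsDerivator : Prop where
  /-- (Der1) `D` sends coproducts to products. -/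
  coprod : ∀ (I : Type w) (A : I → Cat.{w, w}),
    (Functor.pi' fun i => D.pull (B := Cat.of (Σ i, A i))
      (Sigma.incl (C := fun i => A i) i).toCatHom).IsEquivalence
  /-- (Der2) Isomorphisms in `D(A)` are detected at the objects of `A`. -/
  conservative : ∀ (A : Cat.{w, w}) {X Y : D.obj (op A)} (f : X ⟶ Y),
    (∀ a : A, IsIso ((D.pull (objFunctor a)).map f)) → IsIso f
  /-- (Der3) Every `k^*` has a left adjoint `k_!`. -/
  hasLeftKan : ∀ {A B : Cat.{w, w}} (k : A ⟶ B), (D.pull k).IsRightAdjoint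
  /-- (Der3) Every `k^*` has a right adjoint `k_*`. -/
  hasRightKan : ∀ {A B : Cat.{w, w}} (k : A ⟶ B), (D.pull k).IsLeftAdjoint
  /-- (Der4) The canonical mate `π_! p^* ⟶ b^* k_!` is an isomorphism. -/
  leftKan_pointwise : ∀ {A B : Cat.{w, w}} (k : A ⟶ B) (b : B)
    (L : D.obj (op A) ⥤ D.obj (op B)) (adj : L ⊣ D.pull k)
    (L' : D.obj (op (slice k b)) ⥤ D.obj (op pt.{w})) (adj' : L' ⊣ D.pull (toPt (slice k b))),
    IsIso ((mateEquiv adj adj').symm (D.pullSquare (sliceCell k b))).natTrans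
  /-- (Der4) The canonical mate `b^* k_* ⟶ π_* p^*` is an isomorphism. -/
  rightKan_pointwise : ∀ {A B : Cat.{w, w}} (k : A ⟶ B) (b : B)
    (R : D.obj (op A) ⥤ D.obj (op B)) (adj : D.pull k ⊣ R)
    (R' : D.obj (op (coslice k b)) ⥤ D.obj (op pt.{w})) (adj' : D.pull (toPt (coslice k b)) ⊣ R'),
    IsIso (mateEquiv adj adj' (D.pullSquare (cosliceCell k b))).natTrans

/-- `D` is pointed if its underlying category `D(𝟙)` has a zero object. -/
def IsPointed : Prop := Limits.HasZeroObject (D.obj (op pt.{w}))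

/-- `F` is a left Kan extension morphism `k_!` for the restriction morphism `r = k^*`: it is left
adjoint to `r` in the 2-category of prederivators. This determines `F` up to unique invertible
modification. -/
def IsLeftKan {P Q : Prederivator.{w, v, u}} (F : P ⟶ Q) (r : Q ⟶ P) : Prop :=
  Nonempty (Bicategory.Adjunction F r)

/-- `F` is a right Kan extension morphism `k_*` for the restriction morphism `r = k^*`: it is
right adjoint to `r` in the 2-category of prederivators. -/
def IsRightKan {P Q : Prederivator.{w, v, u}} (F : P ⟶ Q) (r : Q ⟶ P) : Prop :=
  Nonempty (Bicategory.Adjunction r F)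

end Prederivator

/-- A cosieve: a fully faithful functor, injective on objects, such that every object receiving a
morphism from the image lies in the image. -/
structure IsCosieveFunctor {A B : Cat.{w, w}} (k : A ⟶ B) : Prop where
  full : k.toFunctor.Full
  faithful : k.toFunctor.Faithful
  injective : Function.Injective k.toFunctor.obj
  mem_range : ∀ (a : A) (b : B), (k.toFunctor.obj a ⟶ b) → b ∈ Set.range k.toFunctor.obj

/-- A sieve: a fully faithful functor, injective on objects, such that every object admitting a
morphism to the image lies in the image. -/
structure IsSieveFunctor {A B : Cat.{w, w}} (k : A ⟶ B) : Prop where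
  full : k.toFunctor.Full
  faithful : k.toFunctor.Faithful
  injective : Function.Injective k.toFunctor.obj
  mem_range : ∀ (a : A) (b : B), (b ⟶ k.toFunctor.obj a) → b ∈ Set.range k.toFunctor.obj

/-! ## Universal arrows -/

/-! The 2-categorical adjoints are built from universal arrows. A morphism `F` of prederivators has
a left adjoint as soon as every object `X` has a universal arrow `X ⟶ F Y` which every restriction
functor carries to a universal arrow (`HasStableUniv`, dually `HasStableCouniv`). Up to composition
and isomorphism, every adjoint constructed for the theorem comes from this criterion. Coherence is
thus settled once, and what remains is to find universal arrows and to prove them stable.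

By (Der4) and (Der2) an arrow `X ⟶ k^* Y` is universal exactly when its base change to every slice
`k/b` is (`isUniv_atSlice`, `isUniv_of_atSlice`). So universality survives base change along a
square that induces final functors on slices. The squares formed by `k × C` and `A × f` have this
property, because `k/b` sits in the slice of `k × C` over `(b, c)` as the inclusion of a reflective
subcategory. Hence `k_!`, and dually `k_*`, are morphisms of prederivators.

Let `D` be pointed and `k` a cosieve. Since `k` is fully faithful, `k_!` is too. Off the image of
`k` the slices are empty, so `k_!` is extension by zero, and its essential image consists of the
diagrams vanishing off `k`. A left adjoint of `k_!` therefore amounts to a stable reflection onto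
these diagrams. To reflect `X`, attach to `B` a second copy `(b, 1)` of each object `b` off the
image, with arrows from level 0 to level 1. Extend `X` by zero to the new objects by a right Kan
extension, then apply the left Kan extension along the projection to `B` (`exists_reflection`). The
reflection is stable because `(B × f)_*`, right adjoint to restriction, preserves vanishing
diagrams.

Conversely, suppose a left Kan extension functor is a right adjoint and some slice is empty. It
preserves terminal objects, and its values over the empty slice are initial. So a terminal diagram
yields an object of `D(𝟙)` that is both initial and terminal. This applies to `1_!` and to `∅_!`. If
`D` is pointed then `∅_!` takes zero values, and since `D(∅ × C)` is a trivial category every arrow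
to `∅_!` is universal. The conditions on right Kan extensions and sieves follow by the dual
arguments. -/

namespace DerivatorAux

universe w₁ w₂ w₃ v₁ v₂ v₃ u₁ u₂ u₃

section
variable {C : Type u₁} [Category.{v₁} C] {E : Type u₂} [Category.{v₂} E]

/-- `η : X ⟶ G Y` is a universal arrow from `X` to `G`. -/
def IsUniv (G : E ⥤ C) {X : C} {Y : E} (η : X ⟶ G.obj Y) : Prop :=
  ∀ Z, Function.Bijective fun g : Y ⟶ Z => η ≫ G.map g

/-- `κ : G Y ⟶ X` is a universal arrow from `G` to `X`. -/
def IsCouniv (G : E ⥤ C) {X : C} {Y : E} (κ : G.obj Y ⟶ X) : Prop :=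
  ∀ Z, Function.Bijective fun g : Z ⟶ Y => G.map g ≫ κ

namespace IsUniv
variable {G : E ⥤ C} {X : C} {Y : E} {η : X ⟶ G.obj Y} (h : IsUniv G η)
include h

/-- The morphism induced by a universal arrow. -/
noncomputable def desc {Z : E} (k : X ⟶ G.obj Z) : Y ⟶ Z := ((h Z).2 k).choose

@[simp]
lemma fac {Z : E} (k : X ⟶ G.obj Z) : η ≫ G.map (h.desc k) = k := ((h Z).2 k).choose_spec

omit h in
@[simp]
lemma fac_assoc :
    type_of% (reassoc_of% @fac) :=
  @(reassoc_of% @fac)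

lemma hom_ext {Z : E} {f g : Y ⟶ Z} (e : η ≫ G.map f = η ≫ G.map g) : f = g := (h Z).1 e

/-- Two universal arrows from the same object differ by an isomorphism. -/
noncomputable def iso {Y' : E} {η' : X ⟶ G.obj Y'} (h' : IsUniv G η') : Y ≅ Y' where
  hom := h.desc η'
  inv := h'.desc η
  hom_inv_id := h.hom_ext (by simp)
  inv_hom_id := h'.hom_ext (by simp)

lemma isIso_of_comp {Y' : E} {g : Y ⟶ Y'} (h' : IsUniv G (η ≫ G.map g)) : IsIso g := by
  have : g = (h.iso h').hom := h.hom_ext (by simp [iso])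
  rw [this]; infer_instance

lemma comp_map {Y' : E} (g : Y ⟶ Y') [IsIso g] : IsUniv G (η ≫ G.map g) := fun Z => by
  have : (fun k : Y' ⟶ Z => (η ≫ G.map g) ≫ G.map k) =
      (fun k => η ≫ G.map k) ∘ (fun k => g ≫ k) := by ext; simp
  rw [this]
  exact (h Z).comp ⟨fun a b e => (cancel_epi g).1 e, fun k => ⟨inv g ≫ k, by simp⟩⟩

lemma precomp {X' : C} (f : X' ⟶ X) [IsIso f] : IsUniv G (f ≫ η) := fun Z =>
  ⟨fun a b e => h.hom_ext ((cancel_epi f).1 (by simpa using e)),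
    fun k => ⟨h.desc (inv f ≫ k), by simp⟩⟩

lemma natIso {G' : E ⥤ C} (e : G ≅ G') : IsUniv G' (η ≫ e.hom.app Y) := fun Z =>
  ⟨fun a b k => h.hom_ext ((cancel_mono (e.hom.app Z)).1 (by
      simpa only [Category.assoc, e.hom.naturality] using k)),
    fun k => ⟨h.desc (k ≫ e.inv.app Z), by
      dsimp only
      rw [Category.assoc, ← e.hom.naturality, h.fac_assoc]; simp⟩⟩

end IsUniv

namespace IsCouniv
variable {G : E ⥤ C} {X : C} {Y : E} {κ : G.obj Y ⟶ X} (h : IsCouniv G κ)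
include h

/-- The morphism induced by a couniversal arrow. -/
noncomputable def lift {Z : E} (k : G.obj Z ⟶ X) : Z ⟶ Y := ((h Z).2 k).choose

@[simp]
lemma fac {Z : E} (k : G.obj Z ⟶ X) : G.map (h.lift k) ≫ κ = k := ((h Z).2 k).choose_spec

omit h in
@[simp]
lemma fac_assoc :
    type_of% (reassoc_of% @fac) :=
  @(reassoc_of% @fac)

lemma hom_ext {Z : E} {f g : Z ⟶ Y} (e : G.map f ≫ κ = G.map g ≫ κ) : f = g := (h Z).1 e

/-- Two couniversal arrows to the same object differ by an isomorphism. -/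
noncomputable def iso {Y' : E} {κ' : G.obj Y' ⟶ X} (h' : IsCouniv G κ') : Y ≅ Y' where
  hom := h'.lift κ
  inv := h.lift κ'
  hom_inv_id := h.hom_ext (by simp)
  inv_hom_id := h'.hom_ext (by simp)

lemma isIso_of_comp {Y' : E} {g : Y' ⟶ Y} (h' : IsCouniv G (G.map g ≫ κ)) : IsIso g := by
  have : g = (h'.iso h).hom := h.hom_ext (by simp [iso])
  rw [this]; infer_instance

lemma comp_map {Y' : E} (g : Y' ⟶ Y) [IsIso g] : IsCouniv G (G.map g ≫ κ) := fun Z =>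
  ⟨fun a b e => (cancel_mono g).1 (h.hom_ext (by simpa using e)),
    fun k => ⟨h.lift k ≫ inv g, by simp⟩⟩

lemma postcomp {X' : C} (f : X ⟶ X') [IsIso f] : IsCouniv G (κ ≫ f) := fun Z =>
  ⟨fun a b e => h.hom_ext ((cancel_mono f).1 (by simpa using e)),
    fun k => ⟨h.lift (k ≫ inv f), by simp⟩⟩

lemma natIso {G' : E ⥤ C} (e : G ≅ G') : IsCouniv G' (e.inv.app Y ≫ κ) := fun Z =>
  ⟨fun a b k => h.hom_ext (by simpa using e.hom.app Z ≫= k),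
    fun k => ⟨h.lift (e.hom.app Z ≫ k), by
      dsimp only
      rw [e.inv.naturality_assoc, h.fac]; simp⟩⟩

end IsCouniv

lemma isUniv_unit {L : C ⥤ E} {G : E ⥤ C} (adj : L ⊣ G) (X : C) :
    IsUniv G (adj.unit.app X) := fun Z => by
  have := (adj.homEquiv X Z).bijective
  rwa [show ⇑(adj.homEquiv X Z) = _ from funext fun g => adj.homEquiv_apply _ _ g] at this

lemma isCouniv_counit {R : C ⥤ E} {G : E ⥤ C} (adj : G ⊣ R) (X : C) :
    IsCouniv G (adj.counit.app X) := fun Z => by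
  have := (adj.homEquiv Z X).symm.bijective
  rwa [show ⇑(adj.homEquiv Z X).symm = _ from funext fun g => adj.homEquiv_symm_apply _ _ g] at this

lemma exists_isUniv (G : E ⥤ C) [G.IsRightAdjoint] (X : C) :
    ∃ (Y : E) (η : X ⟶ G.obj Y), IsUniv G η :=
  ⟨_, _, isUniv_unit (Adjunction.ofIsRightAdjoint G) X⟩

lemma exists_isCouniv (G : E ⥤ C) [G.IsLeftAdjoint] (X : C) :
    ∃ (Y : E) (κ : G.obj Y ⟶ X), IsCouniv G κ :=
  ⟨_, _, isCouniv_counit (Adjunction.ofIsLeftAdjoint G) X⟩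

lemma isUniv_of_isIso (G : E ⥤ C) [G.Full] [G.Faithful] {X : C} {Y : E} (η : X ⟶ G.obj Y)
    [IsIso η] : IsUniv G η := fun _ =>
  ⟨fun _ _ e => G.map_injective ((cancel_epi η).1 e), fun k => ⟨G.preimage (inv η ≫ k), by simp⟩⟩

lemma isCouniv_of_isIso (G : E ⥤ C) [G.Full] [G.Faithful] {X : C} {Y : E} (κ : G.obj Y ⟶ X)
    [IsIso κ] : IsCouniv G κ := fun _ =>
  ⟨fun _ _ e => G.map_injective ((cancel_mono κ).1 e), fun k => ⟨G.preimage (k ≫ inv κ), by simp⟩⟩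

/-! ### Bijections onto hom-sets, modulo composition with isomorphisms -/

lemma bijective_congr {S T : Type*} {f g : S → T} (h : Function.Bijective f)
    (e : ∀ x, f x = g x) : Function.Bijective g := by
  rwa [← funext e]

lemma bijective_of_comp {T : Type*} {X Y Z : C} (F : T → (X ⟶ Y)) (i : Y ⟶ Z) [IsIso i]
    (h : Function.Bijective fun t => F t ≫ i) : Function.Bijective F :=
  ⟨fun a b e => h.1 (congrArg (· ≫ i) e), fun k => by
    obtain ⟨t, ht⟩ := h.2 (k ≫ i)
    exact ⟨t, (cancel_mono i).1 ht⟩⟩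

lemma bijective_comp {T : Type*} {X Y Z : C} {F : T → (X ⟶ Y)} (h : Function.Bijective F)
    (i : Y ⟶ Z) [IsIso i] : Function.Bijective fun t => F t ≫ i :=
  ⟨fun a b e => h.1 ((cancel_mono i).1 e), fun k => by
    obtain ⟨t, ht⟩ := h.2 (k ≫ inv i)
    exact ⟨t, by simp [ht]⟩⟩

lemma bijective_of_precomp {T : Type*} {X Y Z : C} (F : T → (Y ⟶ Z)) (i : X ⟶ Y) [IsIso i]
    (h : Function.Bijective fun t => i ≫ F t) : Function.Bijective F :=
  ⟨fun a b e => h.1 (congrArg (i ≫ ·) e), fun k => by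
    obtain ⟨t, ht⟩ := h.2 (i ≫ k)
    exact ⟨t, (cancel_epi i).1 ht⟩⟩

lemma bijective_precomp {T : Type*} {X Y Z : C} {F : T → (Y ⟶ Z)} (h : Function.Bijective F)
    (i : X ⟶ Y) [IsIso i] : Function.Bijective fun t => i ≫ F t :=
  ⟨fun a b e => h.1 ((cancel_epi i).1 e), fun k => by
    obtain ⟨t, ht⟩ := h.2 (inv i ≫ k)
    exact ⟨t, by simp [ht]⟩⟩

end
end DerivatorAux

/-! ## Adjunctions of strong transformations -/

namespace DerivatorAux
universe w₁ v₁ u₁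

section
variable {B : Type u₁} [Bicategory.{w₁, v₁} B] {P Q : Pseudofunctor B Cat.{v, u}}

/-- A strong transformation of `Cat`-valued pseudofunctors from componentwise data. -/
def mkStrongTrans (G : ∀ c, Q.obj c ⥤ P.obj c)
    (θ : ∀ {c c' : B} (f : c ⟶ c'),
      (Q.map f).toFunctor ⋙ G c' ≅ G c ⋙ (P.map f).toFunctor)
    (hn : ∀ {c c' : B} {f g : c ⟶ c'} (η : f ⟶ g) (X : Q.obj c),
      (G c').map ((Q.map₂ η).toNatTrans.app X) ≫ (θ g).hom.app X =
        (θ f).hom.app X ≫ (P.map₂ η).toNatTrans.app ((G c).obj X))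
    (hi : ∀ (c : B) (X : Q.obj c),
      (θ (𝟙 c)).hom.app X ≫ (P.mapId c).hom.toNatTrans.app ((G c).obj X) =
        (G c).map ((Q.mapId c).hom.toNatTrans.app X))
    (hc : ∀ {c c' c'' : B} (f : c ⟶ c') (g : c' ⟶ c'') (X : Q.obj c),
      (θ (f ≫ g)).hom.app X ≫ (P.mapComp f g).hom.toNatTrans.app ((G c).obj X) =
        (G c'').map ((Q.mapComp f g).hom.toNatTrans.app X) ≫
          (θ g).hom.app ((Q.map f).toFunctor.obj X) ≫
            (P.map g).toFunctor.map ((θ f).hom.app X)) : Q ⟶ P where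
  app c := (G c).toCatHom
  naturality f := Cat.Hom.isoMk (θ f)
  naturality_naturality η := by ext X; exact hn η X
  naturality_id c := by
    ext X
    refine (hi c X).trans ?_
    -- Associators and unitors of `Cat` have identity components, so on objects the axioms are the
    -- hypotheses padded with identities.
    change _ = (G c).map _ ≫ 𝟙 _ ≫ 𝟙 _
    simp
  naturality_comp {c c' c''} f g := by
    ext X
    refine (hc f g X).trans ?_
    change _ = (G c'').map _ ≫ 𝟙 _ ≫ (θ g).hom.app ((Q.map f).toFunctor.obj X) ≫ 𝟙 _ ≫
      (P.map g).toFunctor.map ((θ f).hom.app X) ≫ 𝟙 _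
    simp

/-- The components of the naturality isomorphisms of a strong transformation. -/
def natIso (F : P ⟶ Q) {c c' : B} (f : c ⟶ c') (Y : P.obj c) :
    (F.app c').toFunctor.obj ((P.map f).toFunctor.obj Y) ≅
      (Q.map f).toFunctor.obj ((F.app c).toFunctor.obj Y) :=
  (Cat.Hom.toNatIso (F.naturality f)).app Y

lemma naturality_inv_naturality (F : P ⟶ Q) {c c' : B} (f : c ⟶ c') {Y Y' : P.obj c}
    (φ : Y ⟶ Y') :
    (Q.map f).toFunctor.map ((F.app c).toFunctor.map φ) ≫ (natIso F f Y').inv =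
      (natIso F f Y).inv ≫
        (F.app c').toFunctor.map ((P.map f).toFunctor.map φ) :=
  (F.naturality f).inv.toNatTrans.naturality φ

lemma naturality_hom_naturality (F : P ⟶ Q) {c c' : B} (f : c ⟶ c') {Y Y' : P.obj c}
    (φ : Y ⟶ Y') :
    (F.app c').toFunctor.map ((P.map f).toFunctor.map φ) ≫
        (natIso F f Y').hom =
      (natIso F f Y).hom ≫
        (Q.map f).toFunctor.map ((F.app c).toFunctor.map φ) :=
  (F.naturality f).hom.toNatTrans.naturality φ

lemma naturality_hom_naturality_assoc :
    type_of% (reassoc_of% @naturality_hom_naturality) :=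
  @(reassoc_of% @naturality_hom_naturality)

lemma naturality_hom_map₂ (F : P ⟶ Q) {c c' : B} {f g : c ⟶ c'} (η : f ⟶ g) (Y : P.obj c) :
    (F.app c').toFunctor.map ((P.map₂ η).toNatTrans.app Y) ≫
        (natIso F g Y).hom =
      (natIso F f Y).hom ≫
        (Q.map₂ η).toNatTrans.app ((F.app c).toFunctor.obj Y) := by
  exact congrArg (fun t => t.toNatTrans.app Y) (F.naturality_naturality η)

lemma naturality_hom_map₂_assoc :
    type_of% (reassoc_of% @naturality_hom_map₂) :=
  @(reassoc_of% @naturality_hom_map₂)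

lemma naturality_inv_map₂ (F : P ⟶ Q) {c c' : B} {f g : c ⟶ c'} (η : f ⟶ g) (Y : P.obj c) :
    (Q.map₂ η).toNatTrans.app ((F.app c).toFunctor.obj Y) ≫
        (natIso F g Y).inv =
      (natIso F f Y).inv ≫
        (F.app c').toFunctor.map ((P.map₂ η).toNatTrans.app Y) := by
  rw [Iso.eq_inv_comp, ← naturality_hom_map₂_assoc, Iso.hom_inv_id, Category.comp_id]

lemma natIso_id_inv (F : P ⟶ Q) (c : B) (Y : P.obj c) :
    (natIso F (𝟙 c) Y).inv = (Q.mapId c).hom.toNatTrans.app ((F.app c).toFunctor.obj Y) ≫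
      (F.app c).toFunctor.map ((P.mapId c).inv.toNatTrans.app Y) :=
  Pseudofunctor.StrongTrans.naturality_id_inv_app F c Y

lemma natIso_comp_inv (F : P ⟶ Q) {c c' c'' : B} (f : c ⟶ c') (g : c' ⟶ c'') (Y : P.obj c) :
    (natIso F (f ≫ g) Y).inv =
      (Q.mapComp f g).hom.toNatTrans.app ((F.app c).toFunctor.obj Y) ≫
        (Q.map g).toFunctor.map (natIso F f Y).inv ≫
          (natIso F g ((P.map f).toFunctor.obj Y)).inv ≫
            (F.app c'').toFunctor.map ((P.mapComp f g).inv.toNatTrans.app Y) :=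
  Pseudofunctor.StrongTrans.naturality_comp_inv_app F f g Y

lemma natIso_id_hom (F : P ⟶ Q) (c : B) (Y : P.obj c) :
    (natIso F (𝟙 c) Y).hom = (F.app c).toFunctor.map ((P.mapId c).hom.toNatTrans.app Y) ≫
      (Q.mapId c).inv.toNatTrans.app ((F.app c).toFunctor.obj Y) :=
  Pseudofunctor.StrongTrans.naturality_id_hom_app F c Y

lemma natIso_comp_hom (F : P ⟶ Q) {c c' c'' : B} (f : c ⟶ c') (g : c' ⟶ c'') (Y : P.obj c) :
    (natIso F (f ≫ g) Y).hom =
      (F.app c'').toFunctor.map ((P.mapComp f g).hom.toNatTrans.app Y) ≫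
        (natIso F g ((P.map f).toFunctor.obj Y)).hom ≫
          (Q.map g).toFunctor.map (natIso F f Y).hom ≫
            (Q.mapComp f g).inv.toNatTrans.app ((F.app c).toFunctor.obj Y) :=
  Pseudofunctor.StrongTrans.naturality_comp_hom_app F f g Y

/-- The image of `η : X ⟶ F Y` under `Q.map f`, as a morphism `f^* X ⟶ F (f^* Y)`. -/
abbrev transport (F : P ⟶ Q) {c c' : B} (f : c ⟶ c') {X : Q.obj c} {Y : P.obj c}
    (η : X ⟶ (F.app c).toFunctor.obj Y) :
    (Q.map f).toFunctor.obj X ⟶ (F.app c').toFunctor.obj ((P.map f).toFunctor.obj Y) :=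
  (Q.map f).toFunctor.map η ≫ (natIso F f Y).inv

/-- Every object admits a universal arrow to `F` which is stable under pullback. -/
def HasStableUniv (F : P ⟶ Q) : Prop :=
  ∀ (c : B) (X : Q.obj c), ∃ (Y : P.obj c) (η : X ⟶ (F.app c).toFunctor.obj Y),
    IsUniv (F.app c).toFunctor η ∧
      ∀ {c' : B} (f : c ⟶ c'), IsUniv (F.app c').toFunctor (transport F f η)

/-! ### The left adjoint assembled from stable universal arrows -/

namespace HasStableUniv
variable {F : P ⟶ Q} (h : HasStableUniv F)
include h

/-- The functors underlying the left adjoint. -/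
noncomputable def functor (c : B) : Q.obj c ⥤ P.obj c where
  obj X := (h c X).choose
  map {X Y} φ := (h c X).choose_spec.choose_spec.1.desc (φ ≫ (h c Y).choose_spec.choose)
  map_id X := (h c X).choose_spec.choose_spec.1.hom_ext (by simp)
  map_comp φ ψ := (h c _).choose_spec.choose_spec.1.hom_ext (by simp)

/-- The components of the unit. -/
noncomputable def unit (c : B) (X : Q.obj c) :
    X ⟶ (F.app c).toFunctor.obj ((h.functor c).obj X) :=
  (h c X).choose_spec.choose

lemma isUniv (c : B) (X : Q.obj c) : IsUniv (F.app c).toFunctor (h.unit c X) :=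
  (h c X).choose_spec.choose_spec.1

lemma isUniv_transport {c c' : B} (f : c ⟶ c') (X : Q.obj c) :
    IsUniv (F.app c').toFunctor (transport F f (h.unit c X)) :=
  (h c X).choose_spec.choose_spec.2 f

@[simp]
lemma unit_map (c : B) {X Y : Q.obj c} (φ : X ⟶ Y) :
    h.unit c X ≫ (F.app c).toFunctor.map ((h.functor c).map φ) = φ ≫ h.unit c Y :=
  (h.isUniv c X).fac _

omit h in
@[simp]
lemma unit_map_assoc :
    type_of% (reassoc_of% @unit_map) :=
  @(reassoc_of% @unit_map)

/-- The comparison isomorphism of the left adjoint. -/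
noncomputable def comparison {c c' : B} (f : c ⟶ c') (X : Q.obj c) :
    (h.functor c').obj ((Q.map f).toFunctor.obj X) ≅
      (P.map f).toFunctor.obj ((h.functor c).obj X) :=
  (h.isUniv c' _).iso (h.isUniv_transport f X)

@[simp]
lemma unit_comparison {c c' : B} (f : c ⟶ c') (X : Q.obj c) :
    h.unit c' ((Q.map f).toFunctor.obj X) ≫
        (F.app c').toFunctor.map (h.comparison f X).hom =
      (Q.map f).toFunctor.map (h.unit c X) ≫ (natIso F f _).inv :=
  (h.isUniv c' _).fac _

omit h in
@[simp]
lemma unit_comparison_assoc :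
    type_of% (reassoc_of% @unit_comparison) :=
  @(reassoc_of% @unit_comparison)

/-- Both sides start at an object carrying a universal arrow, so they may be compared after
precomposition with the unit, where the comparison becomes the transported unit. The next three
coherence laws reduce in the same way to the axioms for `F`. -/
lemma comparison_naturality {c c' : B} (f : c ⟶ c') {X Y : Q.obj c} (φ : X ⟶ Y) :
    (h.functor c').map ((Q.map f).toFunctor.map φ) ≫ (h.comparison f Y).hom =
      (h.comparison f X).hom ≫ (P.map f).toFunctor.map ((h.functor c).map φ) :=
  (h.isUniv c' _).hom_ext (by
    simp only [Functor.map_comp, unit_map_assoc, unit_comparison, unit_comparison_assoc,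
      ← naturality_inv_naturality]
    simp only [← Functor.map_comp_assoc, unit_map])

lemma comparison_map₂ {c c' : B} {f g : c ⟶ c'} (η : f ⟶ g) (X : Q.obj c) :
    (h.functor c').map ((Q.map₂ η).toNatTrans.app X) ≫ (h.comparison g X).hom =
      (h.comparison f X).hom ≫ (P.map₂ η).toNatTrans.app ((h.functor c).obj X) :=
  (h.isUniv c' _).hom_ext (by
    simp only [Functor.map_comp, unit_map_assoc, unit_comparison, unit_comparison_assoc,
      ← naturality_inv_map₂]
    rw [← NatTrans.naturality_assoc])

lemma comparison_id (c : B) (X : Q.obj c) :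
    (h.comparison (𝟙 c) X).hom ≫ (P.mapId c).hom.toNatTrans.app ((h.functor c).obj X) =
      (h.functor c).map ((Q.mapId c).hom.toNatTrans.app X) :=
  (h.isUniv c _).hom_ext (by
    rw [Functor.map_comp, unit_comparison_assoc, unit_map,
      natIso_id_inv, Category.assoc, ← Functor.map_comp]
    simp)

lemma comparison_comp {c c' c'' : B} (f : c ⟶ c') (g : c' ⟶ c'') (X : Q.obj c) :
    (h.comparison (f ≫ g) X).hom ≫ (P.mapComp f g).hom.toNatTrans.app ((h.functor c).obj X) =
      (h.functor c'').map ((Q.mapComp f g).hom.toNatTrans.app X) ≫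
        (h.comparison g ((Q.map f).toFunctor.obj X)).hom ≫
          (P.map g).toFunctor.map (h.comparison f X).hom :=
  (h.isUniv c'' _).hom_ext (by
    have e := (Q.mapComp f g).hom.toNatTrans.naturality (h.unit c X)
    have e' : (F.app c'').toFunctor.map
          ((P.mapComp f g).inv.toNatTrans.app ((h.functor c).obj X)) ≫
        (F.app c'').toFunctor.map ((P.mapComp f g).hom.toNatTrans.app ((h.functor c).obj X)) =
        𝟙 _ := by
      rw [← Functor.map_comp]; simp
    simp only [Functor.map_comp, unit_map_assoc, unit_comparison_assoc,
      Category.assoc, natIso_comp_inv, e']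
    change _ = _ ≫ h.unit c'' ((Q.map g).toFunctor.obj ((Q.map f).toFunctor.obj X)) ≫ _
    rw [unit_comparison_assoc, ← naturality_inv_naturality, ← Functor.map_comp_assoc,
      unit_comparison, Functor.map_comp_assoc, reassoc_of% e]
    simp)

/-- The left adjoint of a strong transformation with stable universal arrows. -/
noncomputable def leftAdj : Q ⟶ P :=
  mkStrongTrans h.functor
    (fun f => NatIso.ofComponents (h.comparison f) fun φ => h.comparison_naturality f φ)
    (fun η X => h.comparison_map₂ η X) h.comparison_id h.comparison_comp

/-- The components of the counit. -/
noncomputable def counit (c : B) (Y : P.obj c) :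
    (h.functor c).obj ((F.app c).toFunctor.obj Y) ⟶ Y :=
  (h.isUniv c _).desc (𝟙 _)

@[simp]
lemma unit_counit (c : B) (Y : P.obj c) :
    h.unit c ((F.app c).toFunctor.obj Y) ≫ (F.app c).toFunctor.map (h.counit c Y) = 𝟙 _ :=
  (h.isUniv c _).fac _

omit h in
@[simp]
lemma unit_counit_assoc :
    type_of% (reassoc_of% @unit_counit) :=
  @(reassoc_of% @unit_counit)

lemma counit_naturality (c : B) {Y Y' : P.obj c} (φ : Y ⟶ Y') :
    (h.functor c).map ((F.app c).toFunctor.map φ) ≫ h.counit c Y' = h.counit c Y ≫ φ :=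
  (h.isUniv c _).hom_ext (by simp)

lemma map_unit_counit (c : B) (X : Q.obj c) :
    (h.functor c).map (h.unit c X) ≫ h.counit c ((h.functor c).obj X) = 𝟙 _ :=
  (h.isUniv c _).hom_ext (by simp)

/-- This is the compatibility with restriction that makes the counit a modification. -/
lemma comparison_counit {c c' : B} (f : c ⟶ c') (Y : P.obj c) :
    (h.functor c').map ((natIso F f Y).hom) ≫
        (h.comparison f ((F.app c).toFunctor.obj Y)).hom ≫
          (P.map f).toFunctor.map (h.counit c Y) = h.counit c' ((P.map f).toFunctor.obj Y) :=
  (h.isUniv c' _).hom_ext (by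
    simp only [Functor.map_comp, unit_map_assoc, unit_comparison_assoc, unit_counit,
      ← naturality_inv_naturality]
    rw [← Functor.map_comp_assoc, unit_counit, CategoryTheory.Functor.map_id,
      Category.id_comp, Iso.hom_inv_id])

/-- The adjunction between `leftAdj` and `F`. -/
noncomputable def adjunction : Bicategory.Adjunction h.leftAdj F where
  unit := ⟨{
    app c := (show 𝟭 (Q.obj c) ⟶ h.functor c ⋙ (F.app c).toFunctor from
      { app := h.unit c, naturality := fun _ _ φ => (h.unit_map c φ).symm }).toCatHom₂
    naturality {c c'} f := by
      ext X
      change h.unit c' ((Q.map f).toFunctor.obj X) ≫ 𝟙 _ ≫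
        (F.app c').toFunctor.map (h.comparison f X).hom ≫ 𝟙 _ ≫
          (natIso F f ((h.functor c).obj X)).hom ≫ 𝟙 _ =
        (𝟙 _ ≫ 𝟙 _) ≫ (Q.map f).toFunctor.map (h.unit c X)
      simp }⟩
  counit := ⟨{
    app c := (show (F.app c).toFunctor ⋙ h.functor c ⟶ 𝟭 (P.obj c) from
      { app := h.counit c, naturality := fun _ _ φ => h.counit_naturality c φ }).toCatHom₂
    naturality {c c'} f := by
      ext Y
      change h.counit c' ((P.map f).toFunctor.obj Y) ≫ 𝟙 _ ≫ 𝟙 _ =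
        (𝟙 _ ≫ (h.functor c').map ((natIso F f Y).hom) ≫ 𝟙 _ ≫
          (h.comparison f ((F.app c).toFunctor.obj Y)).hom ≫ 𝟙 _) ≫
          (P.map f).toFunctor.map (h.counit c Y)
      simp [h.comparison_counit] }⟩
  left_triangle := by
    ext c X
    simp [bicategoricalComp]
    exact (h.map_unit_counit c X).trans (Category.id_comp (𝟙 ((h.functor c).obj X))).symm
  right_triangle := by
    ext c Y
    simp [bicategoricalComp]
    exact (h.unit_counit c Y).trans (Category.id_comp (𝟙 ((F.app c).toFunctor.obj Y))).symm

lemma isRightAdjoint : Bicategory.IsRightAdjoint F := .mk h.adjunction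

end HasStableUniv

/-- The image of `κ : F Y ⟶ X` under `Q.map f`, as a morphism `F (f^* Y) ⟶ f^* X`. -/
abbrev cotransport (F : P ⟶ Q) {c c' : B} (f : c ⟶ c') {X : Q.obj c} {Y : P.obj c}
    (κ : (F.app c).toFunctor.obj Y ⟶ X) :
    (F.app c').toFunctor.obj ((P.map f).toFunctor.obj Y) ⟶ (Q.map f).toFunctor.obj X :=
  (natIso F f Y).hom ≫ (Q.map f).toFunctor.map κ

/-- Every object admits a universal arrow from `F` which is stable under pullback. -/
def HasStableCouniv (F : P ⟶ Q) : Prop :=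
  ∀ (c : B) (X : Q.obj c), ∃ (Y : P.obj c) (κ : (F.app c).toFunctor.obj Y ⟶ X),
    IsCouniv (F.app c).toFunctor κ ∧
      ∀ {c' : B} (f : c ⟶ c'), IsCouniv (F.app c').toFunctor (cotransport F f κ)

/-! ### The right adjoint assembled from stable couniversal arrows -/

namespace HasStableCouniv
variable {F : P ⟶ Q} (h : HasStableCouniv F)
include h

/-- The functors underlying the right adjoint. -/
noncomputable def functor (c : B) : Q.obj c ⥤ P.obj c where
  obj X := (h c X).choose
  map {X Y} φ := (h c Y).choose_spec.choose_spec.1.lift ((h c X).choose_spec.choose ≫ φ)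
  map_id X := (h c X).choose_spec.choose_spec.1.hom_ext (by simp)
  map_comp φ ψ := (h c _).choose_spec.choose_spec.1.hom_ext (by simp)

/-- The components of the counit. -/
noncomputable def counit (c : B) (X : Q.obj c) :
    (F.app c).toFunctor.obj ((h.functor c).obj X) ⟶ X :=
  (h c X).choose_spec.choose

lemma isCouniv (c : B) (X : Q.obj c) : IsCouniv (F.app c).toFunctor (h.counit c X) :=
  (h c X).choose_spec.choose_spec.1

lemma isCouniv_cotransport {c c' : B} (f : c ⟶ c') (X : Q.obj c) :
    IsCouniv (F.app c').toFunctor (cotransport F f (h.counit c X)) :=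
  (h c X).choose_spec.choose_spec.2 f

@[simp]
lemma map_counit (c : B) {X Y : Q.obj c} (φ : X ⟶ Y) :
    (F.app c).toFunctor.map ((h.functor c).map φ) ≫ h.counit c Y = h.counit c X ≫ φ :=
  (h.isCouniv c Y).fac _

omit h in
@[simp]
lemma map_counit_assoc :
    type_of% (reassoc_of% @map_counit) :=
  @(reassoc_of% @map_counit)

/-- The comparison isomorphism of the right adjoint. -/
noncomputable def comparison {c c' : B} (f : c ⟶ c') (X : Q.obj c) :
    (h.functor c').obj ((Q.map f).toFunctor.obj X) ≅
      (P.map f).toFunctor.obj ((h.functor c).obj X) :=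
  (h.isCouniv c' _).iso (h.isCouniv_cotransport f X)

@[simp]
lemma comparison_counit {c c' : B} (f : c ⟶ c') (X : Q.obj c) :
    (F.app c').toFunctor.map (h.comparison f X).hom ≫ (natIso F f _).hom ≫
        (Q.map f).toFunctor.map (h.counit c X) =
      h.counit c' ((Q.map f).toFunctor.obj X) :=
  (h.isCouniv_cotransport f X).fac _

omit h in
@[simp]
lemma comparison_counit_assoc :
    type_of% (reassoc_of% @comparison_counit) :=
  @(reassoc_of% @comparison_counit)

lemma comparison_naturality {c c' : B} (f : c ⟶ c') {X Y : Q.obj c} (φ : X ⟶ Y) :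
    (h.functor c').map ((Q.map f).toFunctor.map φ) ≫ (h.comparison f Y).hom =
      (h.comparison f X).hom ≫ (P.map f).toFunctor.map ((h.functor c).map φ) :=
  (h.isCouniv_cotransport f Y).hom_ext (by
    simp only [Functor.map_comp, Category.assoc, comparison_counit, map_counit,
      naturality_hom_naturality_assoc]
    rw [← Functor.map_comp, map_counit, Functor.map_comp, comparison_counit_assoc])

lemma comparison_map₂ {c c' : B} {f g : c ⟶ c'} (η : f ⟶ g) (X : Q.obj c) :
    (h.functor c').map ((Q.map₂ η).toNatTrans.app X) ≫ (h.comparison g X).hom =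
      (h.comparison f X).hom ≫ (P.map₂ η).toNatTrans.app ((h.functor c).obj X) :=
  (h.isCouniv_cotransport g X).hom_ext (by
    simp only [Functor.map_comp, Category.assoc, comparison_counit, map_counit,
      naturality_hom_map₂_assoc]
    rw [← NatTrans.naturality, comparison_counit_assoc])

lemma comparison_id (c : B) (X : Q.obj c) :
    (h.comparison (𝟙 c) X).hom ≫ (P.mapId c).hom.toNatTrans.app ((h.functor c).obj X) =
      (h.functor c).map ((Q.mapId c).hom.toNatTrans.app X) :=
  (h.isCouniv c _).hom_ext (by
    have e : (Q.map (𝟙 c)).toFunctor.map (h.counit c X) ≫ (Q.mapId c).hom.toNatTrans.app X =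
        (Q.mapId c).hom.toNatTrans.app _ ≫ h.counit c X :=
      (Q.mapId c).hom.toNatTrans.naturality (h.counit c X)
    have e' : (F.app c).toFunctor.map ((P.mapId c).hom.toNatTrans.app ((h.functor c).obj X)) =
        (natIso F (𝟙 c) _).hom ≫ (Q.mapId c).hom.toNatTrans.app _ := by
      simp [natIso_id_hom]
    rw [Functor.map_comp, e', Category.assoc, Category.assoc, map_counit]
    rw [← e, comparison_counit_assoc])

lemma comparison_comp {c c' c'' : B} (f : c ⟶ c') (g : c' ⟶ c'') (X : Q.obj c) :
    (h.comparison (f ≫ g) X).hom ≫ (P.mapComp f g).hom.toNatTrans.app ((h.functor c).obj X) =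
      (h.functor c'').map ((Q.mapComp f g).hom.toNatTrans.app X) ≫
        (h.comparison g ((Q.map f).toFunctor.obj X)).hom ≫
          (P.map g).toFunctor.map (h.comparison f X).hom := by
  have e₀ : (P.mapComp f g).hom.toNatTrans.app ((h.functor c).obj X) ≫
      (P.mapComp f g).inv.toNatTrans.app ((h.functor c).obj X) = 𝟙 _ := by simp
  -- Couniversality of the transported counit tests arrows into `(f ≫ g)^*` of the right adjoint,
  -- not into the iterated restriction. The constraint isomorphism is therefore moved to the other
  -- side first.
  rw [← cancel_mono ((P.mapComp f g).inv.toNatTrans.app ((h.functor c).obj X)), Category.assoc,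
    e₀, Category.comp_id]
  refine (h.isCouniv_cotransport (f ≫ g) X).hom_ext ?_
  have e : (Q.map g).toFunctor.map ((Q.map f).toFunctor.map (h.counit c X)) ≫
      (Q.mapComp f g).inv.toNatTrans.app X =
      (Q.mapComp f g).inv.toNatTrans.app _ ≫ (Q.map (f ≫ g)).toFunctor.map (h.counit c X) :=
    (Q.mapComp f g).inv.toNatTrans.naturality (h.counit c X)
  have e' : (F.app c'').toFunctor.map
        ((P.mapComp f g).inv.toNatTrans.app ((h.functor c).obj X)) ≫
      (F.app c'').toFunctor.map ((P.mapComp f g).hom.toNatTrans.app ((h.functor c).obj X)) =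
      𝟙 _ := by
    rw [← Functor.map_comp]; simp
  have e₂ : (F.app c'').toFunctor.map
        ((P.mapComp f g).inv.toNatTrans.app ((h.functor c).obj X)) ≫
        (natIso F (f ≫ g) ((h.functor c).obj X)).hom ≫
          (Q.map (f ≫ g)).toFunctor.map (h.counit c X) =
      (natIso F g _).hom ≫ (Q.map g).toFunctor.map (natIso F f _).hom ≫
        (Q.map g).toFunctor.map ((Q.map f).toFunctor.map (h.counit c X)) ≫
          (Q.mapComp f g).inv.toNatTrans.app X := by
    rw [natIso_comp_hom]
    rw [e]
    simp only [Category.assoc, reassoc_of% e']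
  have e₃ : (Q.mapComp f g).hom.toNatTrans.app X ≫ (Q.mapComp f g).inv.toNatTrans.app X = 𝟙 _ := by
    simp
  rw [comparison_counit]
  simp only [Functor.map_comp, Category.assoc, e₂]
  rw [naturality_hom_naturality_assoc]
  simp only [← (Q.map g).toFunctor.map_comp_assoc, comparison_counit]
  rw [comparison_counit_assoc]
  refine ((h.map_counit_assoc c'' (Y := (Q.map g).toFunctor.obj ((Q.map f).toFunctor.obj X))
    ((Q.mapComp f g).hom.toNatTrans.app X) _).trans ?_).symm
  rw [e₃, Category.comp_id]

/-- The right adjoint of a strong transformation with stable couniversal arrows. -/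
noncomputable def rightAdj : Q ⟶ P :=
  mkStrongTrans h.functor
    (fun f => NatIso.ofComponents (h.comparison f) fun φ => h.comparison_naturality f φ)
    (fun η X => h.comparison_map₂ η X) h.comparison_id h.comparison_comp

/-- The components of the unit. -/
noncomputable def unit (c : B) (Y : P.obj c) :
    Y ⟶ (h.functor c).obj ((F.app c).toFunctor.obj Y) :=
  (h.isCouniv c _).lift (𝟙 _)

@[simp]
lemma unit_counit (c : B) (Y : P.obj c) :
    (F.app c).toFunctor.map (h.unit c Y) ≫ h.counit c ((F.app c).toFunctor.obj Y) = 𝟙 _ :=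
  (h.isCouniv c _).fac _

omit h in
@[simp]
lemma unit_counit_assoc :
    type_of% (reassoc_of% @unit_counit) :=
  @(reassoc_of% @unit_counit)

lemma unit_naturality (c : B) {Y Y' : P.obj c} (φ : Y ⟶ Y') :
    φ ≫ h.unit c Y' = h.unit c Y ≫ (h.functor c).map ((F.app c).toFunctor.map φ) :=
  (h.isCouniv c _).hom_ext (by simp)

lemma unit_map_counit (c : B) (X : Q.obj c) :
    h.unit c ((h.functor c).obj X) ≫ (h.functor c).map (h.counit c X) = 𝟙 _ :=
  (h.isCouniv c _).hom_ext (by simp)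

/-- This is the compatibility with restriction that makes the unit a modification. -/
lemma unit_comparison {c c' : B} (f : c ⟶ c') (Y : P.obj c) :
    h.unit c' ((P.map f).toFunctor.obj Y) ≫ (h.functor c').map (natIso F f Y).hom ≫
        (h.comparison f ((F.app c).toFunctor.obj Y)).hom =
      (P.map f).toFunctor.map (h.unit c Y) :=
  (h.isCouniv_cotransport f _).hom_ext (by
    simp only [Functor.map_comp, Category.assoc, comparison_counit, map_counit,
      unit_counit_assoc, naturality_hom_naturality_assoc]
    rw [← Functor.map_comp, unit_counit, CategoryTheory.Functor.map_id, Category.comp_id])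

/-- The adjunction between `F` and `rightAdj`. -/
noncomputable def adjunction : Bicategory.Adjunction F h.rightAdj where
  unit := ⟨{
    app c := (show 𝟭 (P.obj c) ⟶ (F.app c).toFunctor ⋙ h.functor c from
      { app := h.unit c, naturality := fun _ _ φ => h.unit_naturality c φ }).toCatHom₂
    naturality {c c'} f := by
      ext Y
      change h.unit c' ((P.map f).toFunctor.obj Y) ≫ 𝟙 _ ≫
        (h.functor c').map (natIso F f Y).hom ≫ 𝟙 _ ≫
          (h.comparison f ((F.app c).toFunctor.obj Y)).hom ≫ 𝟙 _ =
        (𝟙 _ ≫ 𝟙 _) ≫ (P.map f).toFunctor.map (h.unit c Y)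
      simp [h.unit_comparison] }⟩
  counit := ⟨{
    app c := (show h.functor c ⋙ (F.app c).toFunctor ⟶ 𝟭 (Q.obj c) from
      { app := h.counit c, naturality := fun _ _ φ => h.map_counit c φ }).toCatHom₂
    naturality {c c'} f := by
      ext X
      change h.counit c' ((Q.map f).toFunctor.obj X) ≫ 𝟙 _ ≫ 𝟙 _ =
        (𝟙 _ ≫ (F.app c').toFunctor.map (h.comparison f X).hom ≫ 𝟙 _ ≫
          (natIso F f ((h.functor c).obj X)).hom ≫ 𝟙 _) ≫
          (Q.map f).toFunctor.map (h.counit c X)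
      simp }⟩
  left_triangle := by
    ext c Y
    simp [bicategoricalComp]
    exact (h.unit_counit c Y).trans (Category.id_comp (𝟙 ((F.app c).toFunctor.obj Y))).symm
  right_triangle := by
    ext c X
    simp [bicategoricalComp]
    exact (h.unit_map_counit c X).trans (Category.id_comp (𝟙 ((h.functor c).obj X))).symm

lemma isLeftAdjoint : Bicategory.IsLeftAdjoint F := .mk h.adjunction

end HasStableCouniv

/-! ### Componentwise equivalences and components of adjunctions -/

/-- For a fully faithful functor every isomorphism is a universal arrow, and transport sends
isomorphisms to isomorphisms, so stability costs nothing. -/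
lemma hasStableUniv_of_isEquivalence (F : P ⟶ Q)
    (hF : ∀ c, (F.app c).toFunctor.IsEquivalence) : HasStableUniv F := fun c X => by
  refine ⟨(F.app c).toFunctor.objPreimage X, ((F.app c).toFunctor.objObjPreimageIso X).inv,
    isUniv_of_isIso _ _, fun f => isUniv_of_isIso _ _⟩

lemma hasStableCouniv_of_isEquivalence (F : P ⟶ Q)
    (hF : ∀ c, (F.app c).toFunctor.IsEquivalence) : HasStableCouniv F := fun c X => by
  refine ⟨(F.app c).toFunctor.objPreimage X, ((F.app c).toFunctor.objObjPreimageIso X).hom,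
    isCouniv_of_isIso _ _, fun f => isCouniv_of_isIso _ _⟩

/-- The components of an adjunction of strong transformations are adjunctions of functors. -/
def adjunctionApp {F : P ⟶ Q} {G : Q ⟶ P} (adj : Bicategory.Adjunction F G) (c : B) :
    (F.app c).toFunctor ⊣ (G.app c).toFunctor where
  unit := (adj.unit.as.app c).toNatTrans
  counit := (adj.counit.as.app c).toNatTrans
  left_triangle_components Y := by
    have h := congrArg (fun t => (t.as.app c).toNatTrans.app Y) adj.left_triangle
    simp [bicategoricalComp, -Bicategory.Adjunction.left_triangle] at h
    exact h.trans (Category.id_comp (𝟙 ((F.app c).toFunctor.obj Y)))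
  right_triangle_components Y := by
    have h := congrArg (fun t => (t.as.app c).toNatTrans.app Y) adj.right_triangle
    simp [bicategoricalComp, -Bicategory.Adjunction.right_triangle] at h
    exact h.trans (Category.id_comp (𝟙 ((G.app c).toFunctor.obj Y)))
end
end DerivatorAux

/-! ## Calculus of restriction functors -/

namespace Prederivator
open DerivatorAux

variable (D : Prederivator.{w, v, u}) {A B C E : Cat.{w, w}}

/-- The isomorphism `(k ≫ l)^* X ≅ k^* l^* X`. -/
def compIso (k : A ⟶ B) (l : B ⟶ C) (X : D.obj (op C)) :
    (D.pull (k ≫ l)).obj X ≅ (D.pull k).obj ((D.pull l).obj X) :=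
  (Cat.Hom.toNatIso (D.mapComp l.op k.op)).app X

/-- The morphism `k^* X ⟶ l^* X` induced by a 2-cell `k ⟶ l`. -/
def cellMap {k l : A ⟶ B} (α : k ⟶ l) (X : D.obj (op B)) : (D.pull k).obj X ⟶ (D.pull l).obj X :=
  (D.map₂ (op2 α)).toNatTrans.app X

/-- The isomorphism `𝟙^* X ≅ X`. -/
def idIso (X : D.obj (op A)) : (D.pull (𝟙 A)).obj X ≅ X :=
  (Cat.Hom.toNatIso (D.mapId (op A))).app X

lemma compIso_hom_naturality (k : A ⟶ B) (l : B ⟶ C) {X Y : D.obj (op C)} (f : X ⟶ Y) :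
    (D.pull (k ≫ l)).map f ≫ (D.compIso k l Y).hom =
      (D.compIso k l X).hom ≫ (D.pull k).map ((D.pull l).map f) :=
  (D.mapComp l.op k.op).hom.toNatTrans.naturality f

lemma compIso_hom_naturality_assoc :
    type_of% (reassoc_of% @compIso_hom_naturality) :=
  @(reassoc_of% @compIso_hom_naturality)

lemma compIso_inv_naturality (k : A ⟶ B) (l : B ⟶ C) {X Y : D.obj (op C)} (f : X ⟶ Y) :
    (D.pull k).map ((D.pull l).map f) ≫ (D.compIso k l Y).inv =
      (D.compIso k l X).inv ≫ (D.pull (k ≫ l)).map f :=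
  (D.mapComp l.op k.op).inv.toNatTrans.naturality f

lemma compIso_inv_naturality_assoc :
    type_of% (reassoc_of% @compIso_inv_naturality) :=
  @(reassoc_of% @compIso_inv_naturality)

lemma idIso_hom_naturality {X Y : D.obj (op A)} (f : X ⟶ Y) :
    (D.pull (𝟙 A)).map f ≫ (D.idIso Y).hom = (D.idIso X).hom ≫ f :=
  (D.mapId (op A)).hom.toNatTrans.naturality f

lemma cellMap_naturality {k l : A ⟶ B} (α : k ⟶ l) {X Y : D.obj (op B)} (f : X ⟶ Y) :
    (D.pull k).map f ≫ D.cellMap α Y = D.cellMap α X ≫ (D.pull l).map f :=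
  (D.map₂ (op2 α)).toNatTrans.naturality f

lemma cellMap_naturality_assoc :
    type_of% (reassoc_of% @cellMap_naturality) :=
  @(reassoc_of% @cellMap_naturality)

@[simp]
lemma cellMap_id (k : A ⟶ B) (X : D.obj (op B)) : D.cellMap (𝟙 k) X = 𝟙 _ := by
  simp [cellMap]

lemma cellMap_comp {k l m : A ⟶ B} (α : k ⟶ l) (β : l ⟶ m) (X : D.obj (op B)) :
    D.cellMap (α ≫ β) X = D.cellMap α X ≫ D.cellMap β X := by
  simp [cellMap]

instance {k l : A ⟶ B} (α : k ⟶ l) [IsIso α] (X : D.obj (op B)) : IsIso (D.cellMap α X) :=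
  ⟨D.cellMap (inv α) X, by simp [← cellMap_comp], by simp [← cellMap_comp]⟩

/-- Composition of functors is strictly associative, so the associator of small categories is an
identity 2-cell. The associativity axiom of the pseudofunctor then becomes this cocycle identity,
from which the variants below follow by cancelling isomorphisms. -/
lemma compIso_assoc (k : A ⟶ B) (l : B ⟶ C) (m : C ⟶ E) (X : D.obj (op E)) :
    (D.compIso (k ≫ l) m X).hom ≫ (D.compIso k l ((D.pull m).obj X)).hom =
      (D.compIso k (l ≫ m) X).hom ≫ (D.pull k).map (D.compIso l m X).hom := by
  have h : 𝟙 _ = (D.compIso k (l ≫ m) X).hom ≫ (D.pull k).map (D.compIso l m X).hom ≫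
      𝟙 _ ≫ (D.compIso k l ((D.pull m).obj X)).inv ≫ (D.compIso (k ≫ l) m X).inv :=
    (congrArg (fun t => t.toNatTrans.app X) (D.map₂_id (k ≫ l ≫ m).op)).symm.trans
      (congrArg (fun t => t.toNatTrans.app X) (D.map₂_associator m.op l.op k.op))
  have h' := h =≫ ((D.compIso (k ≫ l) m X).hom ≫ (D.compIso k l ((D.pull m).obj X)).hom)
  simpa using h'

lemma compIso_assoc_assoc :
    type_of% (reassoc_of% @compIso_assoc) :=
  @(reassoc_of% @compIso_assoc)

lemma compIso_inv_comp_hom (k : A ⟶ B) (l : B ⟶ C) (m : C ⟶ E) (X : D.obj (op E)) :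
    (D.compIso (k ≫ l) m X).inv ≫ (D.compIso k (l ≫ m) X).hom =
      (D.compIso k l ((D.pull m).obj X)).hom ≫ (D.pull k).map (D.compIso l m X).inv := by
  rw [Iso.inv_comp_eq, compIso_assoc_assoc, ← Functor.map_comp, Iso.hom_inv_id,
    CategoryTheory.Functor.map_id, Category.comp_id]

lemma compIso_inv_comp_hom_assoc :
    type_of% (reassoc_of% @compIso_inv_comp_hom) :=
  @(reassoc_of% @compIso_inv_comp_hom)

lemma compIso_hom_eq (k : A ⟶ B) (l : B ⟶ C) (m : C ⟶ E) (X : D.obj (op E)) :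
    (D.compIso (k ≫ l) m X).hom =
      (D.compIso k (l ≫ m) X).hom ≫ (D.pull k).map (D.compIso l m X).hom ≫
        (D.compIso k l ((D.pull m).obj X)).inv := by
  rw [← Category.assoc, Iso.eq_comp_inv, compIso_assoc]

lemma compIso_hom_eq_assoc :
    type_of% (reassoc_of% @compIso_hom_eq) :=
  @(reassoc_of% @compIso_hom_eq)

lemma compIso_inv_comp_hom' (k : A ⟶ B) (l : B ⟶ C) (m : C ⟶ E) (X : D.obj (op E)) :
    (D.compIso k (l ≫ m) X).inv ≫ (D.compIso (k ≫ l) m X).hom =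
      (D.pull k).map (D.compIso l m X).hom ≫ (D.compIso k l ((D.pull m).obj X)).inv := by
  rw [compIso_hom_eq, Iso.inv_hom_id_assoc]

lemma compIso_inv_comp_hom'_assoc :
    type_of% (reassoc_of% @compIso_inv_comp_hom') :=
  @(reassoc_of% @compIso_inv_comp_hom')

lemma cellMap_whiskerRight {k k' : A ⟶ B} (α : k ⟶ k') (l : B ⟶ C) (X : D.obj (op C)) :
    D.cellMap (α ▷ l) X ≫ (D.compIso k' l X).hom =
      (D.compIso k l X).hom ≫ D.cellMap α ((D.pull l).obj X) := by
  have h : D.cellMap (α ▷ l) X = (D.compIso k l X).hom ≫ D.cellMap α ((D.pull l).obj X) ≫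
      (D.compIso k' l X).inv :=
    congrArg (fun t => t.toNatTrans.app X) (D.map₂_whisker_left l.op (op2 α))
  simp [h]

lemma cellMap_whiskerRight_assoc :
    type_of% (reassoc_of% @cellMap_whiskerRight) :=
  @(reassoc_of% @cellMap_whiskerRight)

lemma compIso_inv_cellMap {k k' : A ⟶ B} (α : k ⟶ k') (l : B ⟶ C) (X : D.obj (op C)) :
    (D.compIso k l X).inv ≫ D.cellMap (α ▷ l) X =
      D.cellMap α ((D.pull l).obj X) ≫ (D.compIso k' l X).inv := by
  rw [Iso.inv_comp_eq, ← cellMap_whiskerRight_assoc, Iso.hom_inv_id, Category.comp_id]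

lemma compIso_inv_cellMap_assoc :
    type_of% (reassoc_of% @compIso_inv_cellMap) :=
  @(reassoc_of% @compIso_inv_cellMap)

lemma cellMap_whiskerLeft (k : A ⟶ B) {l l' : B ⟶ C} (α : l ⟶ l') (X : D.obj (op C)) :
    D.cellMap (k ◁ α) X ≫ (D.compIso k l' X).hom =
      (D.compIso k l X).hom ≫ (D.pull k).map (D.cellMap α X) := by
  have h : D.cellMap (k ◁ α) X = (D.compIso k l X).hom ≫ (D.pull k).map (D.cellMap α X) ≫
      (D.compIso k l' X).inv :=
    congrArg (fun t => t.toNatTrans.app X) (D.map₂_whisker_right (op2 α) k.op)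
  simp [h]

lemma cellMap_whiskerLeft_assoc :
    type_of% (reassoc_of% @cellMap_whiskerLeft) :=
  @(reassoc_of% @cellMap_whiskerLeft)

/-- An adjunction in `Cat` induces an adjunction of restriction functors. -/
def pullAdjunction {l : A ⟶ B} {r : B ⟶ A} (adj : l.toFunctor ⊣ r.toFunctor) :
    D.pull r ⊣ D.pull l :=
  Adjunction.ofCat (D.mapAdjunction (f := r.op) (g := l.op)
    { unit := op2 adj.unit.toCatHom₂
      counit := op2 adj.counit.toCatHom₂
      left_triangle := by
        refine congrArg op2 (Cat.Hom₂.ext (NatTrans.ext (funext fun X => ?_)))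
        simp
        -- Reversing the 1-cells exchanges the two triangle identities.
        exact adj.right_triangle_components X
      right_triangle := by
        refine congrArg op2 (Cat.Hom₂.ext (NatTrans.ext (funext fun X => ?_)))
        simp
        exact adj.left_triangle_components X })

end Prederivator

/-! ## Pointwise Kan extensions -/

namespace Prederivator
open DerivatorAux

section
variable (D : Prederivator.{w, v, u}) {A B C E : Cat.{w, w}}

/-- The arrow `p^* X ⟶ m^* Y` obtained from `X ⟶ k^* Y` by pasting a 2-cell `p ≫ k ⟶ m`. -/
def paste {p : E ⟶ A} {k : A ⟶ B} {m : E ⟶ B} (φ : p ≫ k ⟶ m) {X : D.obj (op A)}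
    {Y : D.obj (op B)} (η : X ⟶ (D.pull k).obj Y) : (D.pull p).obj X ⟶ (D.pull m).obj Y :=
  (D.pull p).map η ≫ (D.compIso p k Y).inv ≫ D.cellMap φ Y

lemma paste_comp {p : E ⟶ A} {k : A ⟶ B} {m m' : E ⟶ B} (φ : p ≫ k ⟶ m) (ψ : m ⟶ m')
    {X : D.obj (op A)} {Y : D.obj (op B)} (η : X ⟶ (D.pull k).obj Y) :
    D.paste (φ ≫ ψ) η = D.paste φ η ≫ D.cellMap ψ Y := by
  simp [paste, cellMap_comp]

lemma paste_map {p : E ⟶ A} {k : A ⟶ B} {m : E ⟶ B} (φ : p ≫ k ⟶ m) {X : D.obj (op A)}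
    {Y Y' : D.obj (op B)} (η : X ⟶ (D.pull k).obj Y) (f : Y ⟶ Y') :
    D.paste φ (η ≫ (D.pull k).map f) = D.paste φ η ≫ (D.pull m).map f := by
  simp [paste, compIso_inv_naturality_assoc, cellMap_naturality]

lemma map_paste {J : Cat.{w, w}} (g : J ⟶ E) {p : E ⟶ A} {k : A ⟶ B} {m : E ⟶ B}
    (φ : p ≫ k ⟶ m) {X : D.obj (op A)} {Y : D.obj (op B)} (η : X ⟶ (D.pull k).obj Y) :
    (D.pull g).map (D.paste φ η) =
      (D.compIso g p X).inv ≫ D.paste (p := g ≫ p) (k := k) (m := g ≫ m) (g ◁ φ) η ≫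
        (D.compIso g m Y).hom := by
  rw [Iso.eq_inv_comp]
  simp only [paste, Functor.map_comp, Category.assoc, cellMap_whiskerLeft]
  rw [compIso_inv_comp_hom_assoc, compIso_hom_naturality_assoc]

lemma map_paste_assoc :
    type_of% (reassoc_of% @map_paste) :=
  @(reassoc_of% @map_paste)

/-- The base change of `X ⟶ k^* Y` along a square `p ≫ k ⟶ q ≫ l`. -/
def baseChange {p : E ⟶ A} {k : A ⟶ B} {q : E ⟶ C} {l : C ⟶ B} (α : p ≫ k ⟶ q ≫ l)
    {X : D.obj (op A)} {Y : D.obj (op B)} (η : X ⟶ (D.pull k).obj Y) :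
    (D.pull p).obj X ⟶ (D.pull q).obj ((D.pull l).obj Y) :=
  D.paste α η ≫ (D.compIso q l Y).hom

/-- Identifies base change with whiskering by the 2-cell whose mate occurs in (Der4). -/
lemma baseChange_eq {p : E ⟶ A} {k : A ⟶ B} {q : E ⟶ C} {l : C ⟶ B} (α : p ≫ k ⟶ q ≫ l)
    {X : D.obj (op A)} {Y : D.obj (op B)} (η : X ⟶ (D.pull k).obj Y) :
    D.baseChange α η = (D.pull p).map η ≫ (D.pullSquare α).app Y := by
  simp only [baseChange, paste, Category.assoc]
  rfl

lemma baseChange_map {p : E ⟶ A} {k : A ⟶ B} {q : E ⟶ C} {l : C ⟶ B} (α : p ≫ k ⟶ q ≫ l)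
    {X : D.obj (op A)} {Y Y' : D.obj (op B)} (η : X ⟶ (D.pull k).obj Y) (f : Y ⟶ Y') :
    D.baseChange α (η ≫ (D.pull k).map f) =
      D.baseChange α η ≫ (D.pull q).map ((D.pull l).map f) := by
  simp [baseChange, paste_map, compIso_hom_naturality]

/-- The pasting law: the constraint isomorphisms cancel by the cocycle identity and leave a single
pasting along the composite 2-cell. -/
lemma paste_baseChange {A' B' : Cat.{w, w}} {k : A ⟶ B} {k' : A' ⟶ B'} {t : A' ⟶ A} {h : B' ⟶ B}
    (n : t ≫ k ⟶ k' ≫ h) {p : E ⟶ A'} {m : E ⟶ B'} (φ : p ≫ k' ⟶ m) {X : D.obj (op A)}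
    {Y : D.obj (op B)} (η : X ⟶ (D.pull k).obj Y) :
    D.paste φ (D.baseChange n η) =
      (D.compIso p t X).inv ≫
        D.paste (p := p ≫ t) (k := k) (m := m ≫ h) (p ◁ n ≫ φ ▷ h) η ≫ (D.compIso m h Y).hom := by
  rw [Iso.eq_inv_comp]
  simp only [paste, baseChange, cellMap_comp, Functor.map_comp, Category.assoc]
  rw [cellMap_whiskerRight, compIso_hom_eq_assoc,
    cellMap_whiskerLeft_assoc, compIso_inv_comp_hom_assoc, compIso_hom_naturality_assoc]


lemma paste_whiskerRight {p p' : E ⟶ A} {k : A ⟶ B} {m : E ⟶ B} (σ : p ⟶ p') (φ : p' ≫ k ⟶ m)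
    {X : D.obj (op A)} {Y : D.obj (op B)} (η : X ⟶ (D.pull k).obj Y) :
    D.paste (σ ▷ k ≫ φ) η = D.cellMap σ X ≫ D.paste φ η := by
  rw [paste, cellMap_comp, compIso_inv_cellMap_assoc, cellMap_naturality_assoc, paste]

/-- If two pastings of squares of categories agree, as `H` asserts, then so do the two iterated base
changes, up to the cells `σ`, `τ`, `ι`. With slice cells for `α` and `β`, it expresses the slice of
a base change through a slice of the original arrow. -/
lemma baseChange_baseChange {A' B' S S' : Cat.{w, w}} {k : A ⟶ B} {k' : A' ⟶ B'} {t : A' ⟶ A}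
    {h : B' ⟶ B} {p : S ⟶ A} {q : S ⟶ C} {l : C ⟶ B} {p' : S' ⟶ A'} {q' : S' ⟶ C}
    {l' : C ⟶ B'} (β : p' ≫ k' ⟶ q' ≫ l') (n : t ≫ k ⟶ k' ≫ h) (α : p ≫ k ⟶ q ≫ l)
    (g : S' ⟶ S) (σ : p' ≫ t ⟶ g ≫ p) (τ : g ≫ q ⟶ q') (ι : l ⟶ l' ≫ h)
    (H : p' ◁ n ≫ β ▷ h = σ ▷ k ≫ g ◁ α ≫ τ ▷ l ≫ q' ◁ ι) {X : D.obj (op A)} {Y : D.obj (op B)}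
    (η : X ⟶ (D.pull k).obj Y) :
    D.baseChange β (D.baseChange n η) =
      ((D.compIso p' t X).inv ≫ D.cellMap σ X ≫ (D.compIso g p X).hom) ≫
        ((D.pull g).map (D.baseChange α η) ≫ (D.compIso g q _).inv) ≫
          D.cellMap τ _ ≫ (D.pull q').map (D.cellMap ι Y ≫ (D.compIso l' h Y).hom) := by
  have e : D.paste (p := p' ≫ t) (k := k) (m := (q' ≫ l') ≫ h) (p' ◁ n ≫ β ▷ h) η =
      D.cellMap σ X ≫ D.paste (p := g ≫ p) (k := k) (m := g ≫ q ≫ l) (g ◁ α) η ≫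
        D.cellMap (k := (g ≫ q) ≫ l) (l := q' ≫ l) (τ ▷ l) Y ≫
          D.cellMap (k := q' ≫ l) (l := q' ≫ l' ≫ h) (q' ◁ ι) Y :=
    (congrArg (fun z => D.paste (p := p' ≫ t) (k := k) (m := (q' ≫ l') ≫ h) z η) H).trans
      ((D.paste_whiskerRight _ _ _).trans (congrArg _ ((D.paste_comp _ _ _).trans
        (congrArg _ (D.cellMap_comp _ _ _)))))
  rw [baseChange, paste_baseChange, e, baseChange]
  simp only [Category.assoc, Functor.map_comp]
  congr 2
  rw [map_paste_assoc, Iso.hom_inv_id_assoc, compIso_assoc, cellMap_whiskerLeft_assoc,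
    cellMap_whiskerRight_assoc, compIso_hom_eq_assoc]

/-- The functor on slice categories induced by a square `t ≫ k ⟶ k' ≫ h`. -/
def sliceMap {A' B' : Cat.{w, w}} {k : A ⟶ B} {k' : A' ⟶ B'} {t : A' ⟶ A} {h : B' ⟶ B}
    (n : t ≫ k ⟶ k' ≫ h) (b : B') : slice k' b ⟶ slice k (h.toFunctor.obj b) :=
  Functor.toCatHom
    { obj x := CostructuredArrow.mk (Y := t.toFunctor.obj x.left)
        (show k.toFunctor.obj (t.toFunctor.obj x.left) ⟶ h.toFunctor.obj b from
          n.toNatTrans.app x.left ≫ h.toFunctor.map x.hom)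
      map {x y} f := CostructuredArrow.homMk (t.toFunctor.map f.left) (by
        have e := n.toNatTrans.naturality f.left
        have e' := CostructuredArrow.w f
        dsimp at e ⊢
        rw [reassoc_of% e, ← h.toFunctor.map_comp, e']) }

/-- The comparison of the two ways to classify the image of an object. -/
def objFunctorComp {B' : Cat.{w, w}} (h : B' ⟶ B) (b : B') :
    objFunctor (h.toFunctor.obj b) ≅ objFunctor b ≫ h :=
  Cat.Hom.isoMk (NatIso.ofComponents (fun _ => Iso.refl _) fun _ =>
    (show 𝟙 _ ≫ 𝟙 _ = 𝟙 _ ≫ h.toFunctor.map (𝟙 b) by simp))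

/-- The base change to the slice over `b` of an arrow `X ⟶ k^* Y`. -/
def atSlice (k : A ⟶ B) (b : B) {X : D.obj (op A)} {Y : D.obj (op B)} (η : X ⟶ (D.pull k).obj Y) :
    (D.pull (sliceProj k b)).obj X ⟶
      (D.pull (toPt (slice k b))).obj ((D.pull (objFunctor b)).obj Y) :=
  D.baseChange (sliceCell k b) η

/-- The isomorphism of restriction functors induced by an isomorphism `k ≅ l`. -/
def pullIso {k l : A ⟶ B} (e : k ≅ l) : D.pull k ≅ D.pull l :=
  Cat.Hom.toNatIso (D.map₂Iso e.op2)

/-- The isomorphism `(k ≫ l)^* ≅ k^* l^*` of functors. -/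
def pullComp (k : A ⟶ B) (l : B ⟶ C) : D.pull (k ≫ l) ≅ D.pull l ⋙ D.pull k :=
  Cat.Hom.toNatIso (D.mapComp l.op k.op)

instance (k l : A ⟶ pt.{w}) (α : k ⟶ l) : IsIso α :=
  ⟨⟨⟨{ app := fun _ => eqToHom (Subsingleton.elim (α := Discrete PUnit) _ _)
       naturality := fun _ _ _ => Subsingleton.elim (α := (_ : Discrete PUnit) ⟶ _) _ _ }⟩,
    Cat.Hom₂.ext (NatTrans.ext (funext fun _ =>
      Subsingleton.elim (α := (_ : Discrete PUnit) ⟶ _) _ _)),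
    Cat.Hom₂.ext (NatTrans.ext (funext fun _ =>
      Subsingleton.elim (α := (_ : Discrete PUnit) ⟶ _) _ _))⟩⟩

/-- On a diagram pulled back from the point the counit is induced by a 2-cell between functors to
`𝟙`, and every such 2-cell is invertible. -/
instance isIso_pullAdjunction_counit {l : B ⟶ A} {g : A ⟶ B} (adj : l.toFunctor ⊣ g.toFunctor)
    (W : D.obj (op pt.{w})) :
    IsIso ((D.pullAdjunction adj).counit.app ((D.pull (toPt A)).obj W)) := by
  let α : g ≫ l ⟶ 𝟙 A := adj.counit.toCatHom₂
  have : IsIso (D.cellMap α ((D.pull (toPt A)).obj W)) := by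
    have e := D.cellMap_whiskerRight α (toPt A) W
    rw [← Iso.inv_comp_eq] at e
    rw [← e]
    infer_instance
  change IsIso ((D.compIso g l ((D.pull (toPt A)).obj W)).inv ≫
    D.cellMap α ((D.pull (toPt A)).obj W) ≫ (D.idIso ((D.pull (toPt A)).obj W)).hom)
  infer_instance

/-- `g` is final if restriction along `g` is bijective on arrows to constant diagrams. -/
def IsFinalFunctor (g : A ⟶ B) : Prop :=
  ∀ (X : D.obj (op B)) (W : D.obj (op pt.{w})),
    Function.Bijective fun f : X ⟶ (D.pull (toPt B)).obj W => (D.pull g).map f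

variable {D}

/-- From `l ⊣ g` one gets `g^* ⊣ l^*`. Since `l^*` sends constant diagrams to constant diagrams,
arrows from `X` to a constant diagram on `B` correspond to arrows from `g^* X` to the constant
diagram on `A`. The counit is invertible there, so this correspondence is restriction along `g` up
to isomorphism. -/
lemma isFinalFunctor_of_adjunction {l : B ⟶ A} {g : A ⟶ B} (adj : l.toFunctor ⊣ g.toFunctor) :
    D.IsFinalFunctor g := fun X W => by
  let e : l ≫ toPt A ≅ toPt B := Cat.Hom.isoMk (NatIso.ofComponents fun _ => Iso.refl _)
  let c : (D.pull (toPt B)).obj W ≅ (D.pull l).obj ((D.pull (toPt A)).obj W) :=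
    (D.pullIso e).symm.app W ≪≫ D.compIso l (toPt A) W
  let a := D.pullAdjunction adj
  have : IsIso (a.counit.app ((D.pull (toPt A)).obj W)) := D.isIso_pullAdjunction_counit adj W
  refine bijective_of_comp _ ((D.pull g).map c.hom ≫
    a.counit.app ((D.pull (toPt A)).obj W)) ?_
  have h := (a.homEquiv X ((D.pull (toPt A)).obj W)).symm.bijective.comp
    (bijective_comp (F := fun f : X ⟶ (D.pull (toPt B)).obj W => f) Function.bijective_id c.hom)
  refine bijective_congr h fun f => ?_
  simp [Adjunction.homEquiv_symm_apply]

/-- Restriction along `g ≫ g'` is restriction along `g'` followed by restriction along `g`. The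
second is bijective on the arrows concerned, because `g'^*` of a constant diagram is constant. -/
lemma IsFinalFunctor.of_comp {g : A ⟶ B} {g' : B ⟶ C} (h : D.IsFinalFunctor g)
    (h' : D.IsFinalFunctor (g ≫ g')) :
    D.IsFinalFunctor g' := fun X W => by
  have h₁ := h ((D.pull g').obj X) W
  let c : (D.pull g').obj ((D.pull (toPt C)).obj W) ≅ (D.pull (toPt B)).obj W :=
    (D.compIso g' (toPt C) W).symm
  have h₂ : Function.Bijective fun f : (D.pull g').obj X ⟶ (D.pull g').obj ((D.pull (toPt C)).obj W)
      => (D.pull g).map f := by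
    refine bijective_of_comp _ ((D.pull g).map c.hom) ?_
    convert h₁.comp (bijective_comp (F := fun f : (D.pull g').obj X ⟶
      (D.pull g').obj ((D.pull (toPt C)).obj W) => f) Function.bijective_id c.hom) using 1
    ext f
    simp
  refine (Function.Bijective.of_comp_iff' h₂ _).1 ?_
  refine bijective_of_precomp _ (D.compIso g g' X).hom ?_
  convert bijective_comp (h' X W) (D.compIso g g' _).hom using 1
  ext f
  simp [compIso_hom_naturality]

/-- Colimits may be computed after restriction along a final functor. -/
lemma IsFinalFunctor.isUniv {g : A ⟶ B} (h : D.IsFinalFunctor g) {X : D.obj (op B)} {W : D.obj (op pt.{w})}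
    {η : X ⟶ (D.pull (toPt B)).obj W} (hη : IsUniv (D.pull (toPt B)) η) :
    IsUniv (D.pull (g ≫ toPt B)) ((D.pull g).map η ≫ (D.compIso g (toPt B) W).inv) := fun Z => by
  convert bijective_comp ((h X Z).comp (hη Z)) (D.compIso g (toPt B) Z).inv using 1
  ext f
  simp [compIso_inv_naturality]

/-- For the unit of `k_!`, the base change to the slice is the unit over the slice followed by the
mate of (Der4), which is invertible. Any other universal arrow differs from this unit by an
isomorphism. -/
lemma IsDerivator.isUniv_atSlice (hD : D.IsDerivator) {k : A ⟶ B} {X : D.obj (op A)}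
    {Y : D.obj (op B)} {η : X ⟶ (D.pull k).obj Y} (h : IsUniv (D.pull k) η) (b : B) :
    IsUniv (D.pull (toPt (slice k b))) (D.atSlice k b η) := by
  have := hD.hasLeftKan k
  have := hD.hasLeftKan (toPt (slice k b))
  let adj := Adjunction.ofIsRightAdjoint (D.pull k)
  let adj' := Adjunction.ofIsRightAdjoint (D.pull (toPt (slice k b)))
  have := hD.leftKan_pointwise k b _ adj _ adj'
  let m : (D.pull (toPt (slice k b))).leftAdjoint.obj ((D.pull (sliceProj k b)).obj X) ⟶
      (D.pull (objFunctor b)).obj ((D.pull k).leftAdjoint.obj X) :=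
    ((CategoryTheory.mateEquiv adj adj').symm (D.pullSquare (sliceCell k b))).app X
  have : IsIso m := inferInstanceAs (IsIso ((TwoSquare.natTrans
    ((CategoryTheory.mateEquiv adj adj').symm (D.pullSquare (sliceCell k b)))).app X))
  have e : (D.pull (sliceProj k b)).map (adj.unit.app X) ≫ (D.pullSquare (sliceCell k b)).app _ =
      adj'.unit.app _ ≫ (D.pull (toPt (slice k b))).map m :=
    unit_mateEquiv_symm adj adj' (D.pullSquare (sliceCell k b)) X
  have h₁ : IsUniv (D.pull (toPt (slice k b))) (D.atSlice k b (adj.unit.app X)) := by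
    rw [atSlice, baseChange_eq]
    exact e.symm ▸ (isUniv_unit adj' _).comp_map m
  have h₂ : η = adj.unit.app X ≫ (D.pull k).map ((isUniv_unit adj X).iso h).hom :=
    ((isUniv_unit adj X).fac _).symm
  rw [h₂, atSlice, baseChange_map]
  exact h₁.comp_map _

/-- Factor `η` through a universal arrow `η₀`. Over each `b` both base changes are universal from
the same object, so the factor is invertible at `b`; (Der2) then makes it invertible. -/
lemma IsDerivator.isUniv_of_atSlice (hD : D.IsDerivator) {k : A ⟶ B} {X : D.obj (op A)}
    {Y : D.obj (op B)} {η : X ⟶ (D.pull k).obj Y}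
    (h : ∀ b, IsUniv (D.pull (toPt (slice k b))) (D.atSlice k b η)) : IsUniv (D.pull k) η := by
  have := hD.hasLeftKan k
  obtain ⟨Y₀, η₀, h₀⟩ := exists_isUniv (D.pull k) X
  have e : η = η₀ ≫ (D.pull k).map (h₀.desc η) := (h₀.fac η).symm
  have : IsIso (h₀.desc η) := hD.conservative _ _ fun b => by
    refine (hD.isUniv_atSlice h₀ b).isIso_of_comp ?_
    have := h b
    rwa [e, atSlice, baseChange_map] at this
  rw [e]
  exact h₀.comp_map _

/-- Universality may be tested on the slices of `k'`. There the base-changed arrow is, up to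
isomorphism, the restriction along `sliceMap n b` of the arrow on the slice of `k` over the image of
`b`, and finality keeps it universal. -/
theorem IsDerivator.isUniv_baseChange (hD : D.IsDerivator) {A' B' : Cat.{w, w}} {k : A ⟶ B}
    {k' : A' ⟶ B'} {t : A' ⟶ A} {h : B' ⟶ B} (n : t ≫ k ⟶ k' ≫ h)
    (hn : ∀ b, D.IsFinalFunctor (sliceMap n b)) {X : D.obj (op A)} {Y : D.obj (op B)}
    {η : X ⟶ (D.pull k).obj Y} (hη : IsUniv (D.pull k) η) :
    IsUniv (D.pull k') (D.baseChange n η) :=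
  hD.isUniv_of_atSlice fun b => by
    let σ : sliceProj k' b ≫ t ≅ sliceMap n b ≫ sliceProj k (h.toFunctor.obj b) := Iso.refl _
    let τ : sliceMap n b ≫ toPt (slice k (h.toFunctor.obj b)) ≅ toPt (slice k' b) := Iso.refl _
    rw [atSlice, D.baseChange_baseChange (sliceCell k' b) n (sliceCell k (h.toFunctor.obj b))
      (sliceMap n b) σ.hom τ.hom (objFunctorComp h b).hom (by
        ext x
        change n.toNatTrans.app x.left ≫ h.toFunctor.map x.hom =
          k.toFunctor.map (𝟙 _) ≫ (n.toNatTrans.app x.left ≫ h.toFunctor.map x.hom) ≫ 𝟙 _ ≫ 𝟙 _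
        simp) η]
    have h₁ := (hn b).isUniv (hD.isUniv_atSlice hη (h.toFunctor.obj b))
    have h₂ := ((h₁.natIso (D.pullIso τ)).comp_map
      (D.cellMap (objFunctorComp h b).hom Y ≫ (D.compIso (objFunctor b) h Y).hom)).precomp
      ((D.compIso (sliceProj k' b) t X).inv ≫ D.cellMap σ.hom X ≫
        (D.compIso (sliceMap n b) (sliceProj k (h.toFunctor.obj b)) X).hom)
    simp only [Category.assoc] at h₂ ⊢
    exact h₂

end
end Prederivator

/-! ## Kan extension morphisms of prederivators -/

namespace Prederivator
open DerivatorAux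

section
variable {D : Prederivator.{w, v, u}} {A B C C' : Cat.{w, w}}

/-- The functor `k × C`. -/
abbrev timesHom (k : A ⟶ B) (C : Cat.{w, w}) : Cat.of (A × C) ⟶ Cat.of (B × C) :=
  (Functor.prod k.toFunctor (𝟭 C)).toCatHom

/-- The functor `A × f`. -/
abbrev homTimes (A : Cat.{w, w}) (f : C' ⟶ C) : Cat.of (A × C') ⟶ Cat.of (A × C) :=
  (Functor.prod (𝟭 A) f.toFunctor).toCatHom

/-- The isomorphism `(A × f) ≫ (k × C) ≅ (k × C') ≫ (B × f)`. -/
def timesSquare (k : A ⟶ B) (f : C' ⟶ C) :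
    homTimes A f ≫ timesHom k C ≅ timesHom k C' ≫ homTimes B f :=
  Cat.Hom.isoMk (show (Functor.prod (𝟭 A) f.toFunctor) ⋙ (Functor.prod k.toFunctor (𝟭 C)) ≅
      (Functor.prod k.toFunctor (𝟭 C')) ⋙ (Functor.prod (𝟭 B) f.toFunctor) from
    NatIso.ofComponents fun _ => Iso.refl _)

/-- Translates stability for the morphism `k^*` into base change along the commuting square of `A ×
f` and `k × C`. -/
lemma transport_restrict (k : A ⟶ B) (f : op C ⟶ op C') {X : D.obj (op (Cat.of (A × C)))}
    {Y : D.obj (op (Cat.of (B × C)))} (η : X ⟶ (D.pull (timesHom k C)).obj Y) :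
    transport (c := op C) (D.restrict k) f η = D.baseChange (timesSquare k f.unop).hom η := by
  have e : (natIso (c := op C) (D.restrict k) f Y).inv =
      ((D.compIso (homTimes A f.unop) (timesHom k C) Y).inv ≫
        D.cellMap (timesSquare k f.unop).hom Y) ≫
          (D.compIso (timesHom k C') (homTimes B f.unop) Y).hom := rfl
  simp only [baseChange, paste, transport, e, Category.assoc]
  rfl

/-- The inclusion `(k/b) ⥤ (k × C/(b, c))`. -/
def sliceIncl (k : A ⟶ B) (b : B) (c : C) : slice k b ⟶ slice (timesHom k C) (b, c) where
  toFunctor :=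
    { obj x := CostructuredArrow.mk (S := (timesHom k C).toFunctor) (T := (b, c))
        (Y := (x.left, c)) (x.hom, 𝟙 c)
      map {x y} φ := CostructuredArrow.homMk (φ.left, 𝟙 c)
        (Prod.ext (CostructuredArrow.w φ) (Category.id_comp (𝟙 c)))
      map_id _ := CostructuredArrow.hom_ext _ _ rfl
      map_comp _ _ := CostructuredArrow.hom_ext _ _ (Prod.ext rfl (Category.comp_id (𝟙 c)).symm) }

/-- The projection `(k × C/(b, c)) ⥤ (k/b)`. -/
def sliceRetract (k : A ⟶ B) (b : B) (c : C) : slice (timesHom k C) (b, c) ⟶ slice k b where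
  toFunctor :=
    { obj x := CostructuredArrow.mk (S := k.toFunctor) (T := b) (Y := x.left.1) x.hom.1
      map φ := CostructuredArrow.homMk φ.left.1 (congrArg Prod.fst (CostructuredArrow.w φ))
      map_id _ := CostructuredArrow.hom_ext _ _ rfl
      map_comp _ _ := CostructuredArrow.hom_ext _ _ rfl }

/-- The projection `(k × C/(b, c)) ⥤ (k/b)` is left adjoint to the inclusion. -/
def sliceAdjunction (k : A ⟶ B) (b : B) (c : C) :
    (sliceRetract k b c).toFunctor ⊣ (sliceIncl k b c).toFunctor where
  unit :=
    { app x := CostructuredArrow.homMk (S := (timesHom k C).toFunctor) (T := (b, c)) (f := x)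
        (f' := (sliceIncl k b c).toFunctor.obj ((sliceRetract k b c).toFunctor.obj x))
        (𝟙 x.left.1, x.hom.2)
        (w := Prod.ext ((congrArg (· ≫ x.hom.1) (k.toFunctor.map_id x.left.1)).trans
          (Category.id_comp _)) (Category.comp_id _))
      naturality _ _ φ := CostructuredArrow.hom_ext _ _
        (Prod.ext ((Category.comp_id _).trans (Category.id_comp _).symm)
          ((congrArg Prod.snd (CostructuredArrow.w φ)).trans (Category.comp_id _).symm)) }
  counit :=
    { app x := CostructuredArrow.homMk (S := k.toFunctor) (T := b) (f' := x)
        (f := (sliceRetract k b c).toFunctor.obj ((sliceIncl k b c).toFunctor.obj x)) (𝟙 x.left)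
        (w := (congrArg (· ≫ x.hom) (k.toFunctor.map_id x.left)).trans (Category.id_comp _))
      naturality _ _ _ := CostructuredArrow.hom_ext _ _
        ((Category.comp_id _).trans (Category.id_comp _).symm) }
  left_triangle_components x := CostructuredArrow.hom_ext _ _ (Category.comp_id (𝟙 x.left.1))
  right_triangle_components x := CostructuredArrow.hom_ext _ _
    (Prod.ext (Category.comp_id (𝟙 x.left)) (Category.comp_id (𝟙 c)))

/-- The inclusions `(k/b) ⥤ (k × C/(b, c))` are compatible with change of `C`. -/
def sliceInclIso (k : A ⟶ B) (f : C' ⟶ C) (b : B) (c : C') :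
    sliceIncl k b (f.toFunctor.obj c) ≅ sliceIncl k b c ≫ sliceMap (timesSquare k f).hom (b, c) :=
  Cat.Hom.isoMk (F := (sliceIncl k b (f.toFunctor.obj c)).toFunctor)
    (G := (sliceIncl k b c ≫ sliceMap (timesSquare k f).hom (b, c)).toFunctor)
    (NatIso.ofComponents (fun x => CostructuredArrow.isoMk (Iso.refl _) (by
      refine Prod.ext ?_ ?_
      · change k.toFunctor.map (𝟙 x.left) ≫ 𝟙 _ ≫ x.hom = x.hom
        simp
      · change 𝟙 _ ≫ 𝟙 _ ≫ f.toFunctor.map (𝟙 c) = 𝟙 _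
        simp))
      fun {x y} φ => CostructuredArrow.hom_ext _ _ (by
        refine Prod.ext ?_ ?_
        · change φ.left ≫ 𝟙 _ = 𝟙 _ ≫ φ.left
          simp
        · change 𝟙 _ ≫ 𝟙 _ = 𝟙 _ ≫ f.toFunctor.map (𝟙 c)
          simp))

/-- This is what makes `k_!` a morphism of prederivators. The functor on slices becomes, after
composition with the inclusion of `k/b`, isomorphic to another such inclusion. Both inclusions are
right adjoints, hence final, so the functor on slices is final by cancellation. -/
theorem IsDerivator.hasStableUniv_restrict (hD : D.IsDerivator) (k : A ⟶ B) :
    HasStableUniv (D.restrict k) := fun C X => by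
  have := hD.hasLeftKan (timesHom k C.unop)
  obtain ⟨Y, η, h⟩ := exists_isUniv (D.pull (timesHom k C.unop)) X
  refine ⟨Y, η, h, fun {C'} f => ?_⟩
  have e := transport_restrict k f η
  refine e ▸ hD.isUniv_baseChange _ (fun b => ?_) h
  refine (isFinalFunctor_of_adjunction (sliceAdjunction k b.1 b.2)).of_comp ?_
  exact isFinalFunctor_of_adjunction ((sliceAdjunction k b.1 (f.unop.toFunctor.obj b.2)).ofNatIsoRight
    (Cat.Hom.toNatIso (sliceInclIso k f.unop b.1 b.2)))

end
end Prederivator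

/-! ## Pointwise right Kan extensions -/

namespace Prederivator
open DerivatorAux

section
variable (D : Prederivator.{w, v, u}) {A B C E : Cat.{w, w}}

lemma compIso_inv_assoc (k : A ⟶ B) (l : B ⟶ C) (m : C ⟶ E) (X : D.obj (op E)) :
    (D.compIso k l ((D.pull m).obj X)).inv ≫ (D.compIso (k ≫ l) m X).inv =
      (D.pull k).map (D.compIso l m X).inv ≫ (D.compIso k (l ≫ m) X).inv := by
  rw [Iso.inv_comp_eq, ← compIso_inv_comp_hom_assoc, Iso.hom_inv_id, Category.comp_id]

lemma compIso_inv_eq (k : A ⟶ B) (l : B ⟶ C) (m : C ⟶ E) (X : D.obj (op E)) :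
    (D.compIso (k ≫ l) m X).inv = (D.compIso k l ((D.pull m).obj X)).hom ≫
      (D.pull k).map (D.compIso l m X).inv ≫ (D.compIso k (l ≫ m) X).inv := by
  rw [← compIso_inv_assoc, Iso.hom_inv_id_assoc]

lemma map_cellMap_compIso_inv (k : A ⟶ B) {l l' : B ⟶ C} (α : l ⟶ l') (X : D.obj (op C)) :
    (D.compIso k l X).inv ≫ D.cellMap (k ◁ α) X =
      (D.pull k).map (D.cellMap α X) ≫ (D.compIso k l' X).inv := by
  rw [Iso.inv_comp_eq, ← cellMap_whiskerLeft_assoc, Iso.hom_inv_id, Category.comp_id]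

/-- The arrow `m^* Y ⟶ p^* X` obtained from `k^* Y ⟶ X` by pasting a 2-cell `m ⟶ p ≫ k`. -/
def copaste {p : E ⟶ A} {k : A ⟶ B} {m : E ⟶ B} (φ : m ⟶ p ≫ k) {X : D.obj (op A)}
    {Y : D.obj (op B)} (κ : (D.pull k).obj Y ⟶ X) : (D.pull m).obj Y ⟶ (D.pull p).obj X :=
  D.cellMap φ Y ≫ (D.compIso p k Y).hom ≫ (D.pull p).map κ

lemma comp_copaste {p : E ⟶ A} {k : A ⟶ B} {m m' : E ⟶ B} (ψ : m' ⟶ m) (φ : m ⟶ p ≫ k)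
    {X : D.obj (op A)} {Y : D.obj (op B)} (κ : (D.pull k).obj Y ⟶ X) :
    D.copaste (ψ ≫ φ) κ = D.cellMap ψ Y ≫ D.copaste φ κ := by
  simp [copaste, cellMap_comp]

lemma copaste_map {p : E ⟶ A} {k : A ⟶ B} {m : E ⟶ B} (φ : m ⟶ p ≫ k) {X : D.obj (op A)}
    {Y Y' : D.obj (op B)} (κ : (D.pull k).obj Y ⟶ X) (f : Y' ⟶ Y) :
    D.copaste φ ((D.pull k).map f ≫ κ) = (D.pull m).map f ≫ D.copaste φ κ := by
  simp only [copaste, Functor.map_comp]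
  rw [cellMap_naturality_assoc, compIso_hom_naturality_assoc]

lemma map_copaste {J : Cat.{w, w}} (g : J ⟶ E) {p : E ⟶ A} {k : A ⟶ B} {m : E ⟶ B}
    (φ : m ⟶ p ≫ k) {X : D.obj (op A)} {Y : D.obj (op B)} (κ : (D.pull k).obj Y ⟶ X) :
    (D.pull g).map (D.copaste φ κ) =
      (D.compIso g m Y).inv ≫ D.copaste (p := g ≫ p) (k := k) (m := g ≫ m) (g ◁ φ) κ ≫
        (D.compIso g p X).hom := by
  rw [Iso.eq_inv_comp]
  simp only [copaste, Functor.map_comp, Category.assoc]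
  rw [← cellMap_whiskerLeft_assoc, compIso_hom_naturality, compIso_assoc_assoc]

/-- The base change of `k^* Y ⟶ X` along a square `q ≫ l ⟶ p ≫ k`. -/
def cobaseChange {p : E ⟶ A} {k : A ⟶ B} {q : E ⟶ C} {l : C ⟶ B} (α : q ≫ l ⟶ p ≫ k)
    {X : D.obj (op A)} {Y : D.obj (op B)} (κ : (D.pull k).obj Y ⟶ X) :
    (D.pull q).obj ((D.pull l).obj Y) ⟶ (D.pull p).obj X :=
  (D.compIso q l Y).inv ≫ D.copaste α κ

lemma cobaseChange_eq {p : E ⟶ A} {k : A ⟶ B} {q : E ⟶ C} {l : C ⟶ B} (α : q ≫ l ⟶ p ≫ k)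
    {X : D.obj (op A)} {Y : D.obj (op B)} (κ : (D.pull k).obj Y ⟶ X) :
    D.cobaseChange α κ = (D.pullSquare α).app Y ≫ (D.pull p).map κ := by
  have e : (D.pullSquare α).app Y =
      ((D.compIso q l Y).inv ≫ D.cellMap α Y) ≫ (D.compIso p k Y).hom :=
    (Category.assoc (D.compIso q l Y).inv (D.cellMap α Y) (D.compIso p k Y).hom).symm
  rw [e]
  simp only [cobaseChange, copaste, Category.assoc]

lemma cobaseChange_map {p : E ⟶ A} {k : A ⟶ B} {q : E ⟶ C} {l : C ⟶ B} (α : q ≫ l ⟶ p ≫ k)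
    {X : D.obj (op A)} {Y Y' : D.obj (op B)} (κ : (D.pull k).obj Y ⟶ X) (f : Y' ⟶ Y) :
    D.cobaseChange α ((D.pull k).map f ≫ κ) =
      (D.pull q).map ((D.pull l).map f) ≫ D.cobaseChange α κ := by
  simp only [cobaseChange, copaste_map]
  rw [compIso_inv_naturality_assoc]

lemma copaste_cobaseChange {A' B' : Cat.{w, w}} {k : A ⟶ B} {k' : A' ⟶ B'} {t : A' ⟶ A}
    {h : B' ⟶ B} (n : k' ≫ h ⟶ t ≫ k) {p : E ⟶ A'} {m : E ⟶ B'} (φ : m ⟶ p ≫ k')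
    {X : D.obj (op A)} {Y : D.obj (op B)} (κ : (D.pull k).obj Y ⟶ X) :
    D.copaste φ (D.cobaseChange n κ) =
      (D.compIso m h Y).inv ≫
        D.copaste (p := p ≫ t) (k := k) (m := m ≫ h) (φ ▷ h ≫ p ◁ n) κ ≫
          (D.compIso p t X).hom := by
  rw [Iso.eq_inv_comp]
  simp only [copaste, cobaseChange, cellMap_comp, Functor.map_comp, Category.assoc]
  rw [← cellMap_whiskerRight_assoc, compIso_hom_naturality]
  rw [compIso_assoc_assoc, compIso_assoc_assoc, ← (D.pull p).map_comp_assoc, Iso.hom_inv_id,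
    CategoryTheory.Functor.map_id, Category.id_comp, ← cellMap_whiskerLeft_assoc]

lemma copaste_whiskerRight {p p' : E ⟶ A} {k : A ⟶ B} {m : E ⟶ B} (φ : m ⟶ p' ≫ k) (σ : p' ⟶ p)
    {X : D.obj (op A)} {Y : D.obj (op B)} (κ : (D.pull k).obj Y ⟶ X) :
    D.copaste (φ ≫ σ ▷ k) κ = D.copaste φ κ ≫ D.cellMap σ X := by
  simp only [copaste, cellMap_comp, Category.assoc]
  rw [cellMap_whiskerRight_assoc, cellMap_naturality]

/-- The dual pasting comparison, which rewrites the coslice of a base change as the restriction of a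
coslice of the original arrow. -/
lemma cobaseChange_cobaseChange {A' B' S S' : Cat.{w, w}} {k : A ⟶ B} {k' : A' ⟶ B'} {t : A' ⟶ A}
    {h : B' ⟶ B} {p : S ⟶ A} {q : S ⟶ C} {l : C ⟶ B} {p' : S' ⟶ A'} {q' : S' ⟶ C}
    {l' : C ⟶ B'} (β : q' ≫ l' ⟶ p' ≫ k') (n : k' ≫ h ⟶ t ≫ k) (α : q ≫ l ⟶ p ≫ k)
    (g : S' ⟶ S) (σ : g ≫ p ⟶ p' ≫ t) (τ : q' ⟶ g ≫ q) (ι : l' ≫ h ⟶ l)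
    (H : β ▷ h ≫ p' ◁ n = q' ◁ ι ≫ τ ▷ l ≫ g ◁ α ≫ σ ▷ k) {X : D.obj (op A)} {Y : D.obj (op B)}
    (κ : (D.pull k).obj Y ⟶ X) :
    D.cobaseChange β (D.cobaseChange n κ) =
      (D.pull q').map ((D.compIso l' h Y).inv ≫ D.cellMap ι Y) ≫ D.cellMap τ _ ≫
        ((D.compIso g q _).hom ≫ (D.pull g).map (D.cobaseChange α κ)) ≫
          (D.compIso g p X).inv ≫ D.cellMap σ X ≫ (D.compIso p' t X).hom := by
  have e : D.copaste (p := p' ≫ t) (k := k) (m := (q' ≫ l') ≫ h) (β ▷ h ≫ p' ◁ n) κ =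
      D.cellMap (k := q' ≫ l' ≫ h) (l := q' ≫ l) (q' ◁ ι) Y ≫
        D.cellMap (k := q' ≫ l) (l := (g ≫ q) ≫ l) (τ ▷ l) Y ≫
          D.copaste (p := g ≫ p) (k := k) (m := g ≫ q ≫ l) (g ◁ α) κ ≫ D.cellMap σ X :=
    (congrArg (fun z => D.copaste (p := p' ≫ t) (k := k) (m := (q' ≫ l') ≫ h) z κ) H).trans
      ((D.comp_copaste _ _ _).trans (congrArg _ ((D.comp_copaste _ _ _).trans
        (congrArg _ (D.copaste_whiskerRight _ _ _)))))
  rw [cobaseChange, copaste_cobaseChange, e, cobaseChange]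
  simp only [Category.assoc, Functor.map_comp]
  rw [map_copaste]
  simp only [Category.assoc]
  rw [reassoc_of% D.compIso_inv_assoc q' l' h Y, reassoc_of% D.map_cellMap_compIso_inv q' ι Y,
    compIso_inv_cellMap_assoc, reassoc_of% D.compIso_inv_eq g q l Y,
    Iso.hom_inv_id_assoc]

/-- The functor on coslice categories induced by a square `k' ≫ h ⟶ t ≫ k`. -/
def cosliceMap {A' B' : Cat.{w, w}} {k : A ⟶ B} {k' : A' ⟶ B'} {t : A' ⟶ A} {h : B' ⟶ B}
    (n : k' ≫ h ⟶ t ≫ k) (b : B') : coslice k' b ⟶ coslice k (h.toFunctor.obj b) :=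
  Functor.toCatHom
    { obj x := StructuredArrow.mk (Y := t.toFunctor.obj x.right)
        (show h.toFunctor.obj b ⟶ k.toFunctor.obj (t.toFunctor.obj x.right) from
          h.toFunctor.map x.hom ≫ n.toNatTrans.app x.right)
      map {x y} f := StructuredArrow.homMk (t.toFunctor.map f.right) (by
        have e := n.toNatTrans.naturality f.right
        have e' := StructuredArrow.w f
        dsimp at e ⊢
        rw [Category.assoc, ← e, ← h.toFunctor.map_comp_assoc, e']) }

/-- The base change to the coslice over `b` of an arrow `k^* Y ⟶ X`. -/
def atCoslice (k : A ⟶ B) (b : B) {X : D.obj (op A)} {Y : D.obj (op B)}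
    (κ : (D.pull k).obj Y ⟶ X) :
    (D.pull (toPt (coslice k b))).obj ((D.pull (objFunctor b)).obj Y) ⟶
      (D.pull (cosliceProj k b)).obj X :=
  D.cobaseChange (cosliceCell k b) κ

instance isIso_pullAdjunction_unit {g : A ⟶ B} {r : B ⟶ A} (adj : g.toFunctor ⊣ r.toFunctor)
    (W : D.obj (op pt.{w})) :
    IsIso ((D.pullAdjunction adj).unit.app ((D.pull (toPt A)).obj W)) := by
  let α : 𝟙 A ⟶ g ≫ r := adj.unit.toCatHom₂
  have : IsIso (D.cellMap α ((D.pull (toPt A)).obj W)) := by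
    have e := D.cellMap_whiskerRight α (toPt A) W
    rw [← Iso.inv_comp_eq] at e
    rw [← e]
    infer_instance
  change IsIso ((D.idIso ((D.pull (toPt A)).obj W)).inv ≫
    D.cellMap α ((D.pull (toPt A)).obj W) ≫ (D.compIso g r ((D.pull (toPt A)).obj W)).hom)
  infer_instance

/-- `g` is initial if restriction along `g` is bijective on arrows from constant diagrams. -/
def IsInitialFunctor (g : A ⟶ B) : Prop :=
  ∀ (X : D.obj (op B)) (W : D.obj (op pt.{w})),
    Function.Bijective fun f : (D.pull (toPt B)).obj W ⟶ X => (D.pull g).map f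

variable {D}

/-- From `g ⊣ r` one gets `r^* ⊣ g^*`, with `r^*` preserving constant diagrams and the unit
invertible on them. So left adjoints are initial. -/
lemma isInitialFunctor_of_adjunction {r : B ⟶ A} {g : A ⟶ B} (adj : g.toFunctor ⊣ r.toFunctor) :
    D.IsInitialFunctor g := fun X W => by
  let e : r ≫ toPt A ≅ toPt B := Cat.Hom.isoMk (NatIso.ofComponents fun _ => Iso.refl _)
  let c : (D.pull r).obj ((D.pull (toPt A)).obj W) ≅ (D.pull (toPt B)).obj W :=
    (D.compIso r (toPt A) W).symm ≪≫ (D.pullIso e).app W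
  let a := D.pullAdjunction adj
  have : IsIso (a.unit.app ((D.pull (toPt A)).obj W)) := D.isIso_pullAdjunction_unit adj W
  refine bijective_of_precomp _ (a.unit.app ((D.pull (toPt A)).obj W) ≫ (D.pull g).map c.hom) ?_
  have h := (a.homEquiv ((D.pull (toPt A)).obj W) X).bijective.comp
    (bijective_precomp (F := fun f : (D.pull (toPt B)).obj W ⟶ X => f) Function.bijective_id c.hom)
  refine bijective_congr h fun f => ?_
  simp [Adjunction.homEquiv_apply]

lemma IsInitialFunctor.of_comp {g : A ⟶ B} {g' : B ⟶ C} (h : D.IsInitialFunctor g)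
    (h' : D.IsInitialFunctor (g ≫ g')) :
    D.IsInitialFunctor g' := fun X W => by
  have h₁ := h ((D.pull g').obj X) W
  let c : (D.pull (toPt B)).obj W ≅ (D.pull g').obj ((D.pull (toPt C)).obj W) :=
    D.compIso g' (toPt C) W
  have h₂ : Function.Bijective fun f : (D.pull g').obj ((D.pull (toPt C)).obj W) ⟶ (D.pull g').obj X
      => (D.pull g).map f := by
    refine bijective_of_precomp _ ((D.pull g).map c.hom) ?_
    refine bijective_congr (h₁.comp (bijective_precomp (F := fun f :
      (D.pull g').obj ((D.pull (toPt C)).obj W) ⟶ (D.pull g').obj X => f)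
        Function.bijective_id c.hom)) fun f => ?_
    simp
  refine (Function.Bijective.of_comp_iff' h₂ _).1 ?_
  refine bijective_of_comp _ (D.compIso g g' X).inv ?_
  refine bijective_congr (bijective_precomp (h' X W) (D.compIso g g' _).inv) fun f => ?_
  simp [compIso_inv_naturality]

lemma IsInitialFunctor.isCouniv {g : A ⟶ B} (h : D.IsInitialFunctor g) {X : D.obj (op B)} {W : D.obj (op pt.{w})}
    {κ : (D.pull (toPt B)).obj W ⟶ X} (hκ : IsCouniv (D.pull (toPt B)) κ) :
    IsCouniv (D.pull (g ≫ toPt B)) ((D.compIso g (toPt B) W).hom ≫ (D.pull g).map κ) := fun Z => by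
  refine bijective_congr (bijective_precomp ((h X Z).comp (hκ Z)) (D.compIso g (toPt B) Z).hom)
    fun f => ?_
  simp [compIso_hom_naturality_assoc]

/-- For the counit of `k_*`, the base change is the mate of (Der4) followed by the counit over the
coslice. -/
lemma IsDerivator.isCouniv_atCoslice (hD : D.IsDerivator) {k : A ⟶ B} {X : D.obj (op A)}
    {Y : D.obj (op B)} {κ : (D.pull k).obj Y ⟶ X} (h : IsCouniv (D.pull k) κ) (b : B) :
    IsCouniv (D.pull (toPt (coslice k b))) (D.atCoslice k b κ) := by
  have := hD.hasRightKan k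
  have := hD.hasRightKan (toPt (coslice k b))
  let adj := Adjunction.ofIsLeftAdjoint (D.pull k)
  let adj' := Adjunction.ofIsLeftAdjoint (D.pull (toPt (coslice k b)))
  have := hD.rightKan_pointwise k b _ adj _ adj'
  let m : (D.pull (objFunctor b)).obj ((D.pull k).rightAdjoint.obj X) ⟶
      (D.pull (toPt (coslice k b))).rightAdjoint.obj ((D.pull (cosliceProj k b)).obj X) :=
    (CategoryTheory.mateEquiv adj adj' (D.pullSquare (cosliceCell k b))).app X
  have : IsIso m := inferInstanceAs (IsIso ((TwoSquare.natTrans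
    (CategoryTheory.mateEquiv adj adj' (D.pullSquare (cosliceCell k b)))).app X))
  have e : (D.pull (toPt (coslice k b))).map m ≫ adj'.counit.app _ =
      (D.pullSquare (cosliceCell k b)).app _ ≫
        (D.pull (cosliceProj k b)).map (adj.counit.app X) :=
    mateEquiv_counit adj adj' (D.pullSquare (cosliceCell k b)) X
  have h₁ : IsCouniv (D.pull (toPt (coslice k b))) (D.atCoslice k b (adj.counit.app X)) := by
    rw [atCoslice, cobaseChange_eq]
    exact e ▸ (isCouniv_counit adj' _).comp_map m
  have h₂ : κ = (D.pull k).map (h.iso (isCouniv_counit adj X)).hom ≫ adj.counit.app X :=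
    ((isCouniv_counit adj X).fac _).symm
  rw [h₂, atCoslice, cobaseChange_map]
  exact h₁.comp_map _

/-- The comparison with a genuine couniversal arrow is invertible at every object of `B`, hence
invertible by (Der2). -/
lemma IsDerivator.isCouniv_of_atCoslice (hD : D.IsDerivator) {k : A ⟶ B} {X : D.obj (op A)}
    {Y : D.obj (op B)} {κ : (D.pull k).obj Y ⟶ X}
    (h : ∀ b, IsCouniv (D.pull (toPt (coslice k b))) (D.atCoslice k b κ)) :
    IsCouniv (D.pull k) κ := by
  have := hD.hasRightKan k
  obtain ⟨Y₀, κ₀, h₀⟩ := exists_isCouniv (D.pull k) X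
  have e : κ = (D.pull k).map (h₀.lift κ) ≫ κ₀ := (h₀.fac κ).symm
  have : IsIso (h₀.lift κ) := hD.conservative _ _ fun b => by
    refine (hD.isCouniv_atCoslice h₀ b).isIso_of_comp ?_
    have := h b
    rwa [e, atCoslice, cobaseChange_map] at this
  rw [e]
  exact h₀.comp_map _

theorem IsDerivator.isCouniv_cobaseChange (hD : D.IsDerivator) {A' B' : Cat.{w, w}} {k : A ⟶ B}
    {k' : A' ⟶ B'} {t : A' ⟶ A} {h : B' ⟶ B} (n : k' ≫ h ⟶ t ≫ k)
    (hn : ∀ b, D.IsInitialFunctor (cosliceMap n b)) {X : D.obj (op A)} {Y : D.obj (op B)}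
    {κ : (D.pull k).obj Y ⟶ X} (hκ : IsCouniv (D.pull k) κ) :
    IsCouniv (D.pull k') (D.cobaseChange n κ) :=
  hD.isCouniv_of_atCoslice fun b => by
    let σ : cosliceMap n b ≫ cosliceProj k (h.toFunctor.obj b) ≅ cosliceProj k' b ≫ t := Iso.refl _
    let τ : toPt (coslice k' b) ≅ cosliceMap n b ≫ toPt (coslice k (h.toFunctor.obj b)) :=
      Iso.refl _
    rw [atCoslice, D.cobaseChange_cobaseChange (cosliceCell k' b) n
      (cosliceCell k (h.toFunctor.obj b)) (cosliceMap n b) σ.hom τ.hom (objFunctorComp h b).inv (by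
        ext x
        change h.toFunctor.map x.hom ≫ n.toNatTrans.app x.right =
          𝟙 _ ≫ 𝟙 _ ≫ (h.toFunctor.map x.hom ≫ n.toNatTrans.app x.right) ≫ k.toFunctor.map (𝟙 _)
        simp) κ]
    have h₁ := (hn b).isCouniv (hD.isCouniv_atCoslice hκ (h.toFunctor.obj b))
    have h₂ := ((h₁.natIso (D.pullIso τ).symm).comp_map
      ((D.compIso (objFunctor b) h Y).inv ≫ D.cellMap (objFunctorComp h b).inv Y)).postcomp
      ((D.compIso (cosliceMap n b) (cosliceProj k (h.toFunctor.obj b)) X).inv ≫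
        D.cellMap σ.hom X ≫ (D.compIso (cosliceProj k' b) t X).hom)
    simp only [Category.assoc] at h₂ ⊢
    exact h₂

end
end Prederivator

/-! ### Right Kan extension morphisms of prederivators -/

namespace Prederivator
open DerivatorAux

section
variable {D : Prederivator.{w, v, u}} {A B C C' : Cat.{w, w}}

/-- The square is traversed in the direction opposite to `transport_restrict`, which is why the
inverse 2-cell appears. -/
lemma cotransport_restrict (k : A ⟶ B) (f : op C ⟶ op C') {X : D.obj (op (Cat.of (A × C)))}
    {Y : D.obj (op (Cat.of (B × C)))} (κ : (D.pull (timesHom k C)).obj Y ⟶ X) :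
    cotransport (c := op C) (D.restrict k) f κ = D.cobaseChange (timesSquare k f.unop).inv κ := by
  have e : (natIso (c := op C) (D.restrict k) f Y).hom =
      (D.compIso (timesHom k C') (homTimes B f.unop) Y).inv ≫
        D.cellMap (timesSquare k f.unop).inv Y ≫
          (D.compIso (homTimes A f.unop) (timesHom k C) Y).hom := rfl
  refine (congrArg (fun z => z ≫ (D.pull (homTimes A f.unop)).map κ) e).trans ?_
  exact (Category.assoc _ _ _).trans (congrArg _ (Category.assoc _ _ _))

/-- The inclusion `(b/k) ⥤ ((b, c)/k × C)`. -/
def cosliceIncl (k : A ⟶ B) (b : B) (c : C) : coslice k b ⟶ coslice (timesHom k C) (b, c) where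
  toFunctor :=
    { obj x := StructuredArrow.mk (T := (timesHom k C).toFunctor) (S := (b, c))
        (Y := (x.right, c)) (x.hom, 𝟙 c)
      map {x y} φ := StructuredArrow.homMk (φ.right, 𝟙 c)
        (Prod.ext (StructuredArrow.w φ) (Category.id_comp (𝟙 c)))
      map_id _ := StructuredArrow.hom_ext _ _ rfl
      map_comp _ _ := StructuredArrow.hom_ext _ _ (Prod.ext rfl (Category.comp_id (𝟙 c)).symm) }

/-- The projection `((b, c)/k × C) ⥤ (b/k)`. -/
def cosliceRetract (k : A ⟶ B) (b : B) (c : C) :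
    coslice (timesHom k C) (b, c) ⟶ coslice k b where
  toFunctor :=
    { obj x := StructuredArrow.mk (T := k.toFunctor) (S := b) (Y := x.right.1) x.hom.1
      map φ := StructuredArrow.homMk φ.right.1 (congrArg Prod.fst (StructuredArrow.w φ))
      map_id _ := StructuredArrow.hom_ext _ _ rfl
      map_comp _ _ := StructuredArrow.hom_ext _ _ rfl }

/-- The projection `((b, c)/k × C) ⥤ (b/k)` is right adjoint to the inclusion. -/
def cosliceAdjunction (k : A ⟶ B) (b : B) (c : C) :
    (cosliceIncl k b c).toFunctor ⊣ (cosliceRetract k b c).toFunctor where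
  counit :=
    { app x := StructuredArrow.homMk (T := (timesHom k C).toFunctor) (S := (b, c)) (f' := x)
        (f := (cosliceIncl k b c).toFunctor.obj ((cosliceRetract k b c).toFunctor.obj x))
        (𝟙 x.right.1, x.hom.2)
        (w := Prod.ext ((congrArg (x.hom.1 ≫ ·) (k.toFunctor.map_id x.right.1)).trans
          (Category.comp_id _)) (Category.id_comp _))
      naturality _ _ φ := StructuredArrow.hom_ext _ _
        (Prod.ext ((Category.comp_id _).trans (Category.id_comp _).symm)
          ((Category.id_comp _).trans (congrArg Prod.snd (StructuredArrow.w φ)).symm)) }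
  unit :=
    { app x := StructuredArrow.homMk (T := k.toFunctor) (S := b) (f := x)
        (f' := (cosliceRetract k b c).toFunctor.obj ((cosliceIncl k b c).toFunctor.obj x))
        (𝟙 x.right)
        (w := (congrArg (x.hom ≫ ·) (k.toFunctor.map_id x.right)).trans (Category.comp_id _))
      naturality _ _ _ := StructuredArrow.hom_ext _ _
        ((Category.comp_id _).trans (Category.id_comp _).symm) }
  right_triangle_components x := StructuredArrow.hom_ext _ _ (Category.comp_id (𝟙 x.right.1))
  left_triangle_components x := StructuredArrow.hom_ext _ _
    (Prod.ext (Category.comp_id (𝟙 x.right)) (Category.comp_id (𝟙 c)))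

/-- The inclusions `(b/k) ⥤ ((b, c)/k × C)` are compatible with change of `C`. -/
def cosliceInclIso (k : A ⟶ B) (f : C' ⟶ C) (b : B) (c : C') :
    cosliceIncl k b (f.toFunctor.obj c) ≅
      cosliceIncl k b c ≫ cosliceMap (timesSquare k f).inv (b, c) :=
  Cat.Hom.isoMk (F := (cosliceIncl k b (f.toFunctor.obj c)).toFunctor)
    (G := (cosliceIncl k b c ≫ cosliceMap (timesSquare k f).inv (b, c)).toFunctor)
    (NatIso.ofComponents (fun x => StructuredArrow.isoMk (Iso.refl _) (by
      refine Prod.ext ?_ ?_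
      · change x.hom ≫ k.toFunctor.map (𝟙 x.right) = x.hom ≫ 𝟙 _
        simp
      · change 𝟙 _ ≫ 𝟙 _ = f.toFunctor.map (𝟙 c) ≫ 𝟙 _
        simp))
      fun {x y} φ => StructuredArrow.hom_ext _ _ (by
        refine Prod.ext ?_ ?_
        · change φ.right ≫ 𝟙 _ = 𝟙 _ ≫ φ.right
          simp
        · change 𝟙 _ ≫ 𝟙 _ = 𝟙 _ ≫ f.toFunctor.map (𝟙 c)
          simp))

/-- The inclusion of `b/k` is now a left adjoint, hence initial, and the functor on coslices is
initial by cancellation. -/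
theorem IsDerivator.hasStableCouniv_restrict (hD : D.IsDerivator) (k : A ⟶ B) :
    HasStableCouniv (D.restrict k) := fun C X => by
  have := hD.hasRightKan (timesHom k C.unop)
  obtain ⟨Y, κ, h⟩ := exists_isCouniv (D.pull (timesHom k C.unop)) X
  refine ⟨Y, κ, h, fun {C'} f => ?_⟩
  have e := cotransport_restrict k f κ
  refine e ▸ hD.isCouniv_cobaseChange _ (fun b => ?_) h
  refine (isInitialFunctor_of_adjunction (cosliceAdjunction k b.1 b.2)).of_comp ?_
  exact isInitialFunctor_of_adjunction ((cosliceAdjunction k b.1 (f.unop.toFunctor.obj b.2)).ofNatIsoLeft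
    (Cat.Hom.toNatIso (cosliceInclIso k f.unop b.1 b.2)))

end
end Prederivator

/-! ## Initial, terminal and zero diagrams -/

namespace Prederivator
open DerivatorAux Limits

section
variable (D : Prederivator.{w, v, u}) {A B : Cat.{w, w}}

/-- The isomorphism `j^* j'^* X ≅ X` induced by an isomorphism `j ≫ j' ≅ 𝟙`. -/
def retractIso {j : A ⟶ B} {j' : B ⟶ A} (e : j ≫ j' ≅ 𝟙 A) (X : D.obj (op A)) :
    (D.pull j).obj ((D.pull j').obj X) ≅ X :=
  (D.compIso j j' X).symm ≪≫ (D.pullIso e).app X ≪≫ D.idIso X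

lemma retractIso_hom_naturality {j : A ⟶ B} {j' : B ⟶ A} (e : j ≫ j' ≅ 𝟙 A)
    {X Y : D.obj (op A)} (f : X ⟶ Y) :
    (D.pull j).map ((D.pull j').map f) ≫ (D.retractIso e Y).hom = (D.retractIso e X).hom ≫ f := by
  have h := (D.pullIso e).hom.naturality f
  simp only [retractIso, Iso.trans_hom, Iso.symm_hom, Iso.app_hom, Category.assoc]
  rw [compIso_inv_naturality_assoc, reassoc_of% h, idIso_hom_naturality]

end

section
variable {D : Prederivator.{w, v, u}} (hD : D.IsDerivator) {A B E : Cat.{w, w}}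
include hD

/-- (Der1) for the empty family: the value of `D` on an empty coproduct is equivalent to an empty
product, the terminal category. -/
theorem IsDerivator.nonempty_unique_hom [IsEmpty E] :
    Nonempty (D.obj (op E)) ∧ ∀ X Y : D.obj (op E), Nonempty (Unique (X ⟶ Y)) := by
  let S : Cat.{w, w} := Cat.of (Σ i : PEmpty.{w + 1}, ((PEmpty.elim i : Cat.{w, w}) : Type w))
  have hS := hD.coprod PEmpty fun i => i.elim
  let G := Functor.pi' fun i : PEmpty.{w + 1} => D.pull (B := S)
    (Sigma.incl (C := fun i : PEmpty.{w + 1} => ((PEmpty.elim i : Cat.{w, w}) : Type w)) i).toCatHom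
  have hG : G.IsEquivalence := hS
  -- The empty coproduct `S` is not literally `E`, so the conclusion is carried over along the
  -- unique functors between the two.
  let j : E ⟶ S := Functor.toCatHom
    { obj x := isEmptyElim x, map {x} := isEmptyElim x,
      map_id x := isEmptyElim x, map_comp {x} := isEmptyElim x }
  let j' : S ⟶ E := Functor.toCatHom
    { obj x := x.1.elim, map {x} := x.1.elim, map_id x := x.1.elim, map_comp {x} := x.1.elim }
  let e : j ≫ j' ≅ 𝟙 E := Cat.Hom.isoMk
    (NatIso.ofComponents (fun x => isEmptyElim (α := E) x) fun {x} => isEmptyElim (α := E) x)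
  refine ⟨⟨(D.pull j).obj (G.objPreimage fun i => i.elim)⟩, fun X Y =>
    ⟨⟨⟨(D.retractIso e X).inv ≫ (D.pull j).map (G.preimage fun i => i.elim) ≫
      (D.retractIso e Y).hom⟩, fun f => ?_⟩⟩⟩
  -- Up to the retract isomorphisms `f` is `j^* j'^* f`, and `j'^* f` is an arrow of `D(S)`, where
  -- `G` leaves only one.
  refine (Iso.eq_inv_comp _).2 ?_
  rw [← retractIso_hom_naturality]
  congr 2
  exact G.map_injective (funext fun i => i.elim)

theorem IsDerivator.hom_subsingleton [IsEmpty E] (X Y : D.obj (op E)) : Subsingleton (X ⟶ Y) :=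
  (hD.nonempty_unique_hom.2 X Y).elim fun _ => inferInstance

theorem IsDerivator.bijective_of_isEmpty [IsEmpty E] {S : Type*} [Nonempty S] [Subsingleton S]
    {X Y : D.obj (op E)} (F : S → (X ⟶ Y)) : Function.Bijective F :=
  have := hD.hom_subsingleton X Y
  ⟨fun _ _ _ => Subsingleton.elim _ _, fun _ => ⟨Classical.arbitrary S, Subsingleton.elim _ _⟩⟩

/-- Arrows `Y ⟶ Z` correspond to arrows `X ⟶ k^* Z` between diagrams on an empty category, and there
is exactly one of those. -/
theorem IsDerivator.nonempty_isInitial_of_isUniv [IsEmpty E] {k : E ⟶ A} {X : D.obj (op E)}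
    {Y : D.obj (op A)} {η : X ⟶ (D.pull k).obj Y} (h : IsUniv (D.pull k) η) :
    Nonempty (IsInitial Y) :=
  ⟨IsInitial.ofUniqueHom (fun _ => h.desc (hD.nonempty_unique_hom.2 _ _).some.default)
    fun _ _ => h.hom_ext ((hD.hom_subsingleton _ _).elim _ _)⟩

theorem IsDerivator.nonempty_isTerminal_of_isCouniv [IsEmpty E] {k : E ⟶ A} {X : D.obj (op E)}
    {Y : D.obj (op A)} {κ : (D.pull k).obj Y ⟶ X} (h : IsCouniv (D.pull k) κ) :
    Nonempty (IsTerminal Y) :=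
  ⟨IsTerminal.ofUniqueHom (fun _ => h.lift (hD.nonempty_unique_hom.2 _ _).some.default)
    fun _ _ => h.hom_ext ((hD.hom_subsingleton _ _).elim _ _)⟩

/-- The value at `b` is a colimit over the slice, here an empty colimit. -/
theorem IsDerivator.nonempty_isInitial_of_isEmpty_slice {k : A ⟶ B} {X : D.obj (op A)}
    {Y : D.obj (op B)} {η : X ⟶ (D.pull k).obj Y} (hη : IsUniv (D.pull k) η) (b : B)
    [IsEmpty (slice k b)] : Nonempty (IsInitial ((D.pull (objFunctor b)).obj Y)) :=
  hD.nonempty_isInitial_of_isUniv (hD.isUniv_atSlice hη b)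

theorem IsDerivator.nonempty_isTerminal_of_isEmpty_coslice {k : A ⟶ B} {X : D.obj (op A)}
    {Y : D.obj (op B)} {κ : (D.pull k).obj Y ⟶ X} (hκ : IsCouniv (D.pull k) κ) (b : B)
    [IsEmpty (coslice k b)] : Nonempty (IsTerminal ((D.pull (objFunctor b)).obj Y)) :=
  hD.nonempty_isTerminal_of_isCouniv (hD.isCouniv_atCoslice hκ b)

theorem IsDerivator.nonempty_isInitial_pull (k : A ⟶ B) {X : D.obj (op B)} (h : IsInitial X) :
    Nonempty (IsInitial ((D.pull k).obj X)) := by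
  have := hD.hasRightKan k
  exact ⟨h.isInitialObj (D.pull k)⟩

theorem IsDerivator.nonempty_isTerminal_pull (k : A ⟶ B) {X : D.obj (op B)} (h : IsTerminal X) :
    Nonempty (IsTerminal ((D.pull k).obj X)) := by
  have := hD.hasLeftKan k
  exact ⟨h.isTerminalObj (D.pull k)⟩

theorem IsDerivator.exists_isInitial (A : Cat.{w, w}) :
    ∃ X : D.obj (op A), Nonempty (IsInitial X) := by
  let k : emptyCat ⟶ A := (Functor.empty A).toCatHom
  have : IsEmpty emptyCat.{w} := inferInstanceAs (IsEmpty (Discrete PEmpty))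
  obtain ⟨X⟩ := (hD.nonempty_unique_hom (E := emptyCat)).1
  have := hD.hasLeftKan k
  obtain ⟨Y, η, h⟩ := exists_isUniv (D.pull k) X
  exact ⟨Y, hD.nonempty_isInitial_of_isUniv h⟩

theorem IsDerivator.exists_isTerminal (A : Cat.{w, w}) :
    ∃ X : D.obj (op A), Nonempty (IsTerminal X) := by
  let k : emptyCat ⟶ A := (Functor.empty A).toCatHom
  have : IsEmpty emptyCat.{w} := inferInstanceAs (IsEmpty (Discrete PEmpty))
  obtain ⟨X⟩ := (hD.nonempty_unique_hom (E := emptyCat)).1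
  have := hD.hasRightKan k
  obtain ⟨Y, η, h⟩ := exists_isCouniv (D.pull k) X
  exact ⟨Y, hD.nonempty_isTerminal_of_isCouniv h⟩

omit hD in
/-- A derivator is pointed if some object of `D(𝟙)` is initial and terminal. -/
theorem isPointed_of_isInitial_of_isTerminal {Z : D.obj (op pt.{w})}
    (h : Nonempty (IsInitial Z)) (h' : Nonempty (IsTerminal Z)) : D.IsPointed :=
  ⟨Z, fun Y => ⟨⟨⟨h.some.to Y⟩, fun _ => h.some.hom_ext _ _⟩⟩,
    fun Y => ⟨⟨⟨h'.some.from Y⟩, fun _ => h'.some.hom_ext _ _⟩⟩⟩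

/-- If a left Kan extension functor along `k` is a right adjoint and some slice of `k` is empty,
then the derivator is pointed. -/
theorem IsDerivator.isPointed_of_isRightAdjoint {k : A ⟶ B} {F : D.obj (op A) ⥤ D.obj (op B)}
    (adj : F ⊣ D.pull k) [F.IsRightAdjoint] (b : B) [IsEmpty (slice k b)] : D.IsPointed := by
  -- The value of `F T` at `b` is initial, as a Kan extension over an empty slice. It is also
  -- terminal, because `F` and restriction to `b` are both right adjoints.
  obtain ⟨T, ⟨hT⟩⟩ := hD.exists_isTerminal A
  exact isPointed_of_isInitial_of_isTerminal
    (hD.nonempty_isInitial_of_isEmpty_slice (isUniv_unit adj T) b)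
    (hD.nonempty_isTerminal_pull (objFunctor b) (hT.isTerminalObj F))

/-- If a right Kan extension functor along `k` is a left adjoint and some coslice of `k` is empty,
then the derivator is pointed. -/
theorem IsDerivator.isPointed_of_isLeftAdjoint {k : A ⟶ B} {F : D.obj (op A) ⥤ D.obj (op B)}
    (adj : D.pull k ⊣ F) [F.IsLeftAdjoint] (b : B) [IsEmpty (coslice k b)] : D.IsPointed := by
  -- Here `F` and restriction to `b` preserve the initial object, while the empty coslice makes the
  -- value terminal.
  obtain ⟨T, ⟨hT⟩⟩ := hD.exists_isInitial A
  exact isPointed_of_isInitial_of_isTerminal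
    (hD.nonempty_isInitial_pull (objFunctor b) (hT.isInitialObj F))
    (hD.nonempty_isTerminal_of_isEmpty_coslice (isCouniv_counit adj T) b)

/-- The arrow from an initial diagram to `X` is at each object an arrow between initial objects,
since restriction preserves initial objects. (Der2) makes it invertible. -/
theorem IsDerivator.nonempty_isInitial_of_forall {X : D.obj (op A)}
    (h : ∀ a : A, Nonempty (IsInitial ((D.pull (objFunctor a)).obj X))) :
    Nonempty (IsInitial X) := by
  obtain ⟨Y, ⟨hY⟩⟩ := hD.exists_isInitial A
  have : IsIso (hY.to X) := hD.conservative _ _ fun a => by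
    obtain ⟨i⟩ := hD.nonempty_isInitial_pull (objFunctor a) hY
    obtain ⟨j⟩ := h a
    exact ⟨j.to _, i.hom_ext _ _, j.hom_ext _ _⟩
  exact ⟨hY.ofIso (asIso (hY.to X))⟩

theorem IsDerivator.nonempty_isTerminal_of_forall {X : D.obj (op A)}
    (h : ∀ a : A, Nonempty (IsTerminal ((D.pull (objFunctor a)).obj X))) :
    Nonempty (IsTerminal X) := by
  obtain ⟨Y, ⟨hY⟩⟩ := hD.exists_isTerminal A
  have : IsIso (hY.from X) := hD.conservative _ _ fun a => by
    obtain ⟨i⟩ := hD.nonempty_isTerminal_pull (objFunctor a) hY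
    obtain ⟨j⟩ := h a
    exact ⟨j.from _, j.hom_ext _ _, i.hom_ext _ _⟩
  exact ⟨hY.ofIso (asIso (hY.from X)).symm⟩

end

section
variable {D : Prederivator.{w, v, u}} {A B C C' : Cat.{w, w}}

lemma isZero_of_isInitial (hP : D.IsPointed) {X : D.obj (op pt.{w})} (h : Nonempty (IsInitial X)) :
    IsZero X := by
  obtain ⟨Z, hZ⟩ := hP
  exact hZ.of_iso (h.some.uniqueUpToIso hZ.isInitial)

lemma isZero_of_isTerminal (hP : D.IsPointed) {X : D.obj (op pt.{w})}
    (h : Nonempty (IsTerminal X)) : IsZero X := by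
  obtain ⟨Z, hZ⟩ := hP
  exact hZ.of_iso (h.some.uniqueUpToIso hZ.isTerminal)

/-- A diagram vanishes off `k` if its values at the objects off the image of `k` are zero. -/
def VanishesOff (k : A ⟶ B) (W : D.obj (op B)) : Prop :=
  ∀ b ∉ Set.range k.toFunctor.obj, IsZero ((D.pull (objFunctor b)).obj W)

lemma isZero_pull_objFunctor_comp (h : A ⟶ B) (a : A) {W : D.obj (op B)} :
    IsZero ((D.pull (objFunctor a)).obj ((D.pull h).obj W)) ↔
      IsZero ((D.pull (objFunctor (h.toFunctor.obj a))).obj W) :=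
  Iso.isZero_iff ((D.compIso (objFunctor a) h W).symm ≪≫ (D.pullIso (objFunctorComp h a)).symm.app W)

end
end Prederivator

/-! ## Kan extensions along fully faithful functors -/

namespace DerivatorAux
universe v₁ v₂ u₁ u₂

lemma IsUniv.isIso {C : Type u₁} [Category.{v₁} C] {E : Type u₂} [Category.{v₂} E] {G : E ⥤ C}
    [G.IsEquivalence] {X : C} {Y : E} {η : X ⟶ G.obj Y} (h : IsUniv G η) : IsIso η := by
  have h' : IsUniv G (G.objObjPreimageIso X).inv := isUniv_of_isIso _ _
  rw [← h'.fac η]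
  have : IsIso (h'.desc η) := inferInstanceAs (IsIso (h'.iso h).hom)
  infer_instance

lemma IsCouniv.isIso {C : Type u₁} [Category.{v₁} C] {E : Type u₂} [Category.{v₂} E] {G : E ⥤ C}
    [G.IsEquivalence] {X : C} {Y : E} {κ : G.obj Y ⟶ X} (h : IsCouniv G κ) : IsIso κ := by
  have h' : IsCouniv G (G.objObjPreimageIso X).hom := isCouniv_of_isIso _ _
  rw [← h'.fac κ]
  have : IsIso (h'.lift κ) := inferInstanceAs (IsIso (h.iso h').hom)
  infer_instance

end DerivatorAux

namespace Prederivator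
open DerivatorAux Limits

section
variable {D : Prederivator.{w, v, u}} (hD : D.IsDerivator) {A B E : Cat.{w, w}}

lemma isFinalFunctor_of_isEquivalence (g : A ⟶ B) [g.toFunctor.IsEquivalence] :
    D.IsFinalFunctor g :=
  isFinalFunctor_of_adjunction (l := g.toFunctor.inv.toCatHom)
    g.toFunctor.asEquivalence.symm.toAdjunction

lemma isInitialFunctor_of_isEquivalence (g : A ⟶ B) [g.toFunctor.IsEquivalence] :
    D.IsInitialFunctor g :=
  isInitialFunctor_of_adjunction (r := g.toFunctor.inv.toCatHom)
    g.toFunctor.asEquivalence.toAdjunction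

instance : (D.pull (𝟙 A)).IsEquivalence :=
  have : (𝟙 (D.obj (op A)) : D.obj (op A) ⟶ D.obj (op A)).toFunctor.IsEquivalence :=
    inferInstanceAs (𝟭 (D.obj (op A))).IsEquivalence
  Functor.isEquivalence_of_iso (Cat.Hom.toNatIso (D.mapId (op A))).symm

include hD

/-- Base change along the square from `𝟙 A` to `k`. Full faithfulness makes each functor from the
slice of `A` over `a` to the slice of `k` over `k a` an equivalence, so the result is universal for
`𝟙^*`. This is an equivalence, so the result is invertible, and hence so is `η`. -/
theorem IsDerivator.isIso_of_isUniv {k : A ⟶ B} [k.toFunctor.Full] [k.toFunctor.Faithful]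
    {X : D.obj (op A)} {Y : D.obj (op B)} {η : X ⟶ (D.pull k).obj Y} (h : IsUniv (D.pull k) η) :
    IsIso η := by
  let n : 𝟙 A ≫ k ⟶ 𝟙 A ≫ k := 𝟙 _
  have hn (a : A) : (sliceMap n a).toFunctor.IsEquivalence :=
    { faithful := ⟨fun {x y f g} e => CostructuredArrow.hom_ext _ _ (congrArg (·.left) e)⟩
      full := ⟨fun {x y} f => ⟨CostructuredArrow.homMk f.left (k.toFunctor.map_injective (by
        have e := CostructuredArrow.w f
        change k.toFunctor.map f.left ≫ 𝟙 _ ≫ k.toFunctor.map y.hom =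
          𝟙 _ ≫ k.toFunctor.map x.hom at e
        rw [Category.id_comp, Category.id_comp] at e
        exact (k.toFunctor.map_comp _ _).trans e)), CostructuredArrow.hom_ext _ _ rfl⟩⟩
      essSurj := ⟨fun z => ⟨CostructuredArrow.mk (S := (𝟙 A : A ⟶ A).toFunctor) (Y := z.left)
        (k.toFunctor.preimage z.hom), ⟨CostructuredArrow.isoMk (Iso.refl _) (by
          change k.toFunctor.map (𝟙 _) ≫ z.hom =
            𝟙 _ ≫ k.toFunctor.map (k.toFunctor.preimage z.hom)
          simp)⟩⟩⟩ }
  have h' := hD.isUniv_baseChange n (fun a => by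
    have := hn a
    exact isFinalFunctor_of_isEquivalence _) h
  have := h'.isIso
  rw [baseChange, paste] at this
  have h₂ : IsIso ((D.pull (𝟙 A)).map η) := by
    simpa using this
  exact isIso_of_reflects_iso η (D.pull (𝟙 A))

theorem IsDerivator.isIso_of_isCouniv {k : A ⟶ B} [k.toFunctor.Full] [k.toFunctor.Faithful]
    {X : D.obj (op A)} {Y : D.obj (op B)} {κ : (D.pull k).obj Y ⟶ X}
    (h : IsCouniv (D.pull k) κ) : IsIso κ := by
  let n : 𝟙 A ≫ k ⟶ 𝟙 A ≫ k := 𝟙 _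
  have hn (a : A) : (cosliceMap n a).toFunctor.IsEquivalence :=
    { faithful := ⟨fun {x y f g} e => StructuredArrow.hom_ext _ _ (congrArg (·.right) e)⟩
      full := ⟨fun {x y} f => ⟨StructuredArrow.homMk f.right (k.toFunctor.map_injective (by
        have e := StructuredArrow.w f
        change (k.toFunctor.map x.hom ≫ 𝟙 _) ≫ k.toFunctor.map f.right =
          k.toFunctor.map y.hom ≫ 𝟙 _ at e
        rw [Category.comp_id, Category.comp_id] at e
        exact (k.toFunctor.map_comp _ _).trans e)), StructuredArrow.hom_ext _ _ rfl⟩⟩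
      essSurj := ⟨fun z => ⟨StructuredArrow.mk (T := (𝟙 A : A ⟶ A).toFunctor) (Y := z.right)
        (k.toFunctor.preimage z.hom), ⟨StructuredArrow.isoMk (Iso.refl _) (by
          change (k.toFunctor.map (k.toFunctor.preimage z.hom) ≫ 𝟙 _) ≫ k.toFunctor.map (𝟙 _) =
            z.hom
          simp)⟩⟩⟩ }
  have h' := hD.isCouniv_cobaseChange n (fun a => by
    have := hn a
    exact isInitialFunctor_of_isEquivalence _) h
  have := h'.isIso
  rw [cobaseChange, copaste] at this
  have h₂ : IsIso ((D.pull (𝟙 A)).map κ) := by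
    simpa using this
  exact isIso_of_reflects_iso κ (D.pull (𝟙 A))

/-- By (Der2) it suffices to look at objects of `B`: on the image the hypothesis applies, and off it
any arrow between zero objects is invertible. -/
theorem IsDerivator.isIso_of_vanishesOff {k : A ⟶ B} {X Y : D.obj (op B)}
    (hX : VanishesOff k X) (hY : VanishesOff k Y) (f : X ⟶ Y) [IsIso ((D.pull k).map f)] :
    IsIso f := hD.conservative _ _ fun b => by
  by_cases hb : b ∈ Set.range k.toFunctor.obj
  · obtain ⟨a, rfl⟩ := hb
    refine (NatIso.isIso_map_iff (D.pullIso (objFunctorComp k a) ≪≫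
      D.pullComp (objFunctor a) k) f).2 ?_
    exact inferInstanceAs (IsIso ((D.pull (objFunctor a)).map ((D.pull k).map f)))
  · exact ⟨(hY b hb).to_ _, (hX b hb).eq_of_src _ _, (hY b hb).eq_of_src _ _⟩

theorem IsDerivator.vanishesOff_of_isUniv (hP : D.IsPointed) {k : A ⟶ B}
    (hk : ∀ b ∉ Set.range k.toFunctor.obj, IsEmpty (slice k b)) {X : D.obj (op A)}
    {Y : D.obj (op B)} {η : X ⟶ (D.pull k).obj Y} (h : IsUniv (D.pull k) η) : VanishesOff k Y :=
  fun b hb => by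
    have := hk b hb
    exact isZero_of_isInitial hP (hD.nonempty_isInitial_of_isEmpty_slice h b)

theorem IsDerivator.vanishesOff_of_isCouniv (hP : D.IsPointed) {k : A ⟶ B}
    (hk : ∀ b ∉ Set.range k.toFunctor.obj, IsEmpty (coslice k b)) {X : D.obj (op A)}
    {Y : D.obj (op B)} {κ : (D.pull k).obj Y ⟶ X} (h : IsCouniv (D.pull k) κ) :
    VanishesOff k Y :=
  fun b hb => by
    have := hk b hb
    exact isZero_of_isTerminal hP (hD.nonempty_isTerminal_of_isEmpty_coslice h b)

/-- This says that `W` is the left Kan extension of its own restriction. The comparison from that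
Kan extension to `W` is invertible on the image of `k` by full faithfulness, and off the image both
sides vanish. -/
theorem IsDerivator.isUniv_id_of_vanishesOff (hP : D.IsPointed) {k : A ⟶ B} [k.toFunctor.Full]
    [k.toFunctor.Faithful] (hk : ∀ b ∉ Set.range k.toFunctor.obj, IsEmpty (slice k b))
    {W : D.obj (op B)} (hW : VanishesOff k W) : IsUniv (D.pull k) (𝟙 ((D.pull k).obj W)) := by
  have := hD.hasLeftKan k
  obtain ⟨Y, η, h⟩ := exists_isUniv (D.pull k) ((D.pull k).obj W)
  have := hD.isIso_of_isUniv h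
  have e := h.fac (𝟙 ((D.pull k).obj W))
  have : IsIso ((D.pull k).map (h.desc (𝟙 ((D.pull k).obj W)))) := by
    rw [← IsIso.eq_inv_comp, Category.comp_id] at e
    rw [e]; infer_instance
  have := hD.isIso_of_vanishesOff (hD.vanishesOff_of_isUniv hP hk h) hW
    (h.desc (𝟙 ((D.pull k).obj W)))
  exact e ▸ h.comp_map (h.desc (𝟙 ((D.pull k).obj W)))

theorem IsDerivator.isCouniv_id_of_vanishesOff (hP : D.IsPointed) {k : A ⟶ B} [k.toFunctor.Full]
    [k.toFunctor.Faithful] (hk : ∀ b ∉ Set.range k.toFunctor.obj, IsEmpty (coslice k b))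
    {W : D.obj (op B)} (hW : VanishesOff k W) : IsCouniv (D.pull k) (𝟙 ((D.pull k).obj W)) := by
  have := hD.hasRightKan k
  obtain ⟨Y, κ, h⟩ := exists_isCouniv (D.pull k) ((D.pull k).obj W)
  have := hD.isIso_of_isCouniv h
  have e := h.fac (𝟙 ((D.pull k).obj W))
  have : IsIso ((D.pull k).map (h.lift (𝟙 ((D.pull k).obj W)))) := by
    rw [← IsIso.eq_comp_inv, Category.id_comp] at e
    rw [e]; infer_instance
  have := hD.isIso_of_vanishesOff hW (hD.vanishesOff_of_isCouniv hP hk h)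
    (h.lift (𝟙 ((D.pull k).obj W)))
  exact e ▸ h.comp_map (h.lift (𝟙 ((D.pull k).obj W)))

end
end Prederivator

/-! ## Reflections onto vanishing diagrams -/

namespace Prederivator
open DerivatorAux Limits

section
variable {A B E : Cat.{w, w}}

/-- The full subcategory of `B × [1]` on the objects `(b, j)` where `j ≠ i` or `b` is off the image
of `k`. -/
abbrev zeroExt (k : A ⟶ B) (i : arrowCat.{w}) : Cat.{w, w} :=
  Cat.of (ObjectProperty.FullSubcategory
    fun x : B × arrowCat.{w} => x.2 = i → x.1 ∉ Set.range k.toFunctor.obj)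

/-- The inclusion `b ↦ (b, j)`. -/
def zeroExtIncl (k : A ⟶ B) {i j : arrowCat.{w}} (h : j ≠ i) : B ⟶ zeroExt k i where
  toFunctor := ObjectProperty.lift _ (CategoryTheory.Prod.sectL B j) fun _ e => (h e).elim

/-- The projection `(b, j) ↦ b`. -/
def zeroExtProj (k : A ⟶ B) (i : arrowCat.{w}) : zeroExt k i ⟶ B where
  toFunctor := ObjectProperty.ι _ ⋙ CategoryTheory.Prod.fst B arrowCat.{w}

/-- The inclusion is a section of the projection. -/
def zeroExtRetract (k : A ⟶ B) {i j : arrowCat.{w}} (h : j ≠ i) :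
    zeroExtIncl k h ≫ zeroExtProj k i ≅ 𝟙 B :=
  Cat.Hom.isoMk (F := (zeroExtIncl k h ≫ zeroExtProj k i).toFunctor) (G := (𝟙 B : B ⟶ B).toFunctor)
    (NatIso.ofComponents (fun _ => Iso.refl _) fun f =>
      (Category.comp_id f).trans (Category.id_comp f).symm)

lemma down_le_of_hom {x y : arrowCat.{w}} (f : x ⟶ y) : x.down ≤ y.down := f.down.down

/-- The morphism of `[1]` given by an inequality. -/
abbrev arrowHom {x y : arrowCat.{w}} (h : x.down ≤ y.down) : x ⟶ y := ⟨⟨h⟩⟩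

instance (x y : arrowCat.{w}) : Subsingleton (x ⟶ y) :=
  inferInstanceAs (Subsingleton (ULift (PLift _)))

lemma faithful_zeroExtIncl (k : A ⟶ B) {i j : arrowCat.{w}} (h : j ≠ i) :
    (zeroExtIncl k h).toFunctor.Faithful where
  map_injective e := congrArg (fun f => f.hom.1) e

lemma full_zeroExtIncl (k : A ⟶ B) {i j : arrowCat.{w}} (h : j ≠ i) :
    (zeroExtIncl k h).toFunctor.Full where
  map_surjective f := ⟨f.hom.1, ObjectProperty.hom_ext _ (Prod.ext rfl (Subsingleton.elim _ _))⟩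

lemma eq_of_notMem_range_zeroExtIncl (k : A ⟶ B) {i j : arrowCat.{w}} (h : j ≠ i)
    {x : zeroExt k i} (hx : x ∉ Set.range (zeroExtIncl k h).toFunctor.obj) : x.obj.2 = i := by
  by_contra hi
  refine hx ⟨x.obj.1, ?_⟩
  have e : j = x.obj.2 := ULift.ext _ _ (by
    have h₁ : j.down ≠ i.down := fun e => h (ULift.ext _ _ e)
    have h₂ : x.obj.2.down ≠ i.down := fun e => hi (ULift.ext _ _ e)
    omega)
  subst e
  rfl

end

section
variable {D : Prederivator.{w, v, u}} {A B E : Cat.{w, w}}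

/-- A terminal object is a right adjoint to the functor to the point. -/
lemma isFinalFunctor_of_unique (t : E) (h : ∀ x : E, Unique (x ⟶ t)) :
    D.IsFinalFunctor (objFunctor t) :=
  isFinalFunctor_of_adjunction (l := toPt E) (Adjunction.mkOfHomEquiv
    { homEquiv x _ :=
        { toFun _ := (h x).default
          invFun _ := Discrete.eqToHom (Subsingleton.elim _ _)
          left_inv _ := Subsingleton.elim (α := (_ : Discrete PUnit) ⟶ _) _ _
          right_inv _ := ((h x).uniq _).symm }
      homEquiv_naturality_left_symm _ _ := Subsingleton.elim (α := (_ : Discrete PUnit) ⟶ _) _ _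
      homEquiv_naturality_right {x _ _} _ _ := (h x).uniq _ |>.symm })

lemma isInitialFunctor_of_unique (t : E) (h : ∀ x : E, Unique (t ⟶ x)) :
    D.IsInitialFunctor (objFunctor t) :=
  isInitialFunctor_of_adjunction (r := toPt E) (Adjunction.mkOfHomEquiv
    { homEquiv _ x :=
        { toFun _ := Discrete.eqToHom (Subsingleton.elim _ _)
          invFun _ := (h x).default
          right_inv _ := Subsingleton.elim (α := (_ : Discrete PUnit) ⟶ _) _ _
          left_inv _ := ((h x).uniq _).symm }
      homEquiv_naturality_left_symm {_ _ x} _ _ := (h x).uniq _ |>.symm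
      homEquiv_naturality_right _ _ := Subsingleton.elim (α := (_ : Discrete PUnit) ⟶ _) _ _ })

/-- The slice has the terminal object `t`, so the value of `Y` at `b` is a colimit computed by `X`
at `t.left`, which is zero. -/
theorem IsDerivator.nonempty_isInitial_of_slice (hD : D.IsDerivator) {k : A ⟶ B} {X : D.obj (op A)}
    {Y : D.obj (op B)} {η : X ⟶ (D.pull k).obj Y} (hη : IsUniv (D.pull k) η) (b : B)
    (t : slice k b) (ht : ∀ x : slice k b, Unique (x ⟶ t))
    (h₀ : IsZero ((D.pull (objFunctor t.left)).obj X)) :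
    Nonempty (IsInitial ((D.pull (objFunctor b)).obj Y)) := by
  have h := (isFinalFunctor_of_unique t ht).isUniv (hD.isUniv_atSlice hη b)
  have h₁ : IsZero ((D.pull (objFunctor t)).obj ((D.pull (sliceProj k b)).obj X)) :=
    (isZero_pull_objFunctor_comp (sliceProj k b) t).2 h₀
  exact ⟨IsInitial.ofUniqueHom (fun Z => h.desc (h₁.to_ _)) fun _ _ => h.hom_ext (h₁.eq_of_src _ _)⟩

theorem IsDerivator.nonempty_isTerminal_of_coslice (hD : D.IsDerivator) {k : A ⟶ B}
    {X : D.obj (op A)} {Y : D.obj (op B)} {κ : (D.pull k).obj Y ⟶ X} (hκ : IsCouniv (D.pull k) κ)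
    (b : B) (t : coslice k b) (ht : ∀ x : coslice k b, Unique (t ⟶ x))
    (h₀ : IsZero ((D.pull (objFunctor t.right)).obj X)) :
    Nonempty (IsTerminal ((D.pull (objFunctor b)).obj Y)) := by
  have h := (isInitialFunctor_of_unique t ht).isCouniv (hD.isCouniv_atCoslice hκ b)
  have h₁ : IsZero ((D.pull (objFunctor t)).obj ((D.pull (cosliceProj k b)).obj X)) :=
    (isZero_pull_objFunctor_comp (cosliceProj k b) t).2 h₀
  exact ⟨IsTerminal.ofUniqueHom (fun Z => h.lift (h₁.from_ _))
    fun _ _ => h.hom_ext (h₁.eq_of_tgt _ _)⟩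

/-- Every diagram has a reflection onto the diagrams vanishing off `k`. -/
theorem IsDerivator.exists_reflection (hD : D.IsDerivator) (hP : D.IsPointed) (k : A ⟶ B)
    (X : D.obj (op B)) : ∃ (X' : D.obj (op B)) (r : X ⟶ X'), VanishesOff k X' ∧
      ∀ W, VanishesOff k W → Function.Bijective fun g : X' ⟶ W => r ≫ g := by
  have h01 : (⟨0⟩ : arrowCat.{w}) ≠ ⟨1⟩ := fun e => by simpa using congrArg ULift.down e
  -- Level 0 is all of `B`, level 1 only the objects off the image of `k`. The right Kan extension
  -- `M` along `s` is `X` on level 0 and zero on level 1. The left Kan extension along the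
  -- projection `p` then returns to `B`.
  let s := zeroExtIncl k h01
  let p := zeroExtProj k ⟨1⟩
  have : s.toFunctor.Full := full_zeroExtIncl k h01
  have : s.toFunctor.Faithful := faithful_zeroExtIncl k h01
  have := hD.hasRightKan s
  have := hD.hasLeftKan p
  have hs : ∀ x ∉ Set.range s.toFunctor.obj, IsEmpty (coslice s x) := fun x hx => ⟨fun y => by
    have e := eq_of_notMem_range_zeroExtIncl k h01 hx
    have f : x.obj.2 ⟶ ⟨0⟩ := y.hom.hom.2
    rw [e] at f
    exact absurd (down_le_of_hom f) (by decide)⟩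
  obtain ⟨M, κ, hκ⟩ := exists_isCouniv (D.pull s) X
  obtain ⟨X', η, hη⟩ := exists_isUniv (D.pull p) M
  have : IsIso κ := hD.isIso_of_isCouniv hκ
  have hM := hD.vanishesOff_of_isCouniv hP hs hκ
  let e := D.retractIso (zeroExtRetract k h01)
  refine ⟨X', inv κ ≫ (D.pull s).map η ≫ (e X').hom, fun v hv => ?_, fun W hW => ?_⟩
  -- For `v` off the image, `(v, 1)` with the identity of `v` is terminal in the slice of `p` over
  -- `v`, and `M` vanishes there. Any `(b, j)` over `v` maps to it since `j ≤ 1`.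
  · let t : zeroExt k ⟨1⟩ := ⟨(v, ⟨1⟩), fun _ => hv⟩
    refine isZero_of_isInitial hP (hD.nonempty_isInitial_of_slice hη v
      (CostructuredArrow.mk (S := p.toFunctor) (T := v) (Y := t) (𝟙 v)) (fun x => ?_)
      (hM _ fun ⟨b, hb⟩ => h01 (congrArg (fun y => y.obj.2) hb)))
    exact
      { default := CostructuredArrow.homMk (ObjectProperty.homMk
          (show x.left.obj ⟶ t.obj from (x.hom, arrowHom (Fin.le_last _)))) (Category.comp_id x.hom)
        uniq f := CostructuredArrow.hom_ext _ _ (ObjectProperty.hom_ext _ (Prod.ext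
          ((Category.comp_id _).symm.trans (CostructuredArrow.w f)) (Subsingleton.elim _ _))) }
  -- Objects of level 1 lie over objects off the image, so `p^* W` vanishes on them and is the right
  -- Kan extension of its restriction along `s`. Arrows `X' ⟶ W` are then arrows `M ⟶ p^* W`, arrows
  -- `s^* M ⟶ s^* p^* W`, and finally arrows `X ⟶ W`.
  · have hN : VanishesOff s ((D.pull p).obj W) := fun x hx => by
      refine (isZero_pull_objFunctor_comp p x).2 (hW _ ?_)
      exact x.property (eq_of_notMem_range_zeroExtIncl k h01 hx)
    have h := hD.isCouniv_id_of_vanishesOff hP hs hN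
    refine bijective_congr (bijective_precomp (bijective_comp ((h M).comp (hη W)) (e W).hom) (inv κ))
      fun g => ?_
    simp [e, retractIso_hom_naturality]

/-- Every diagram has a coreflection onto the diagrams vanishing off `k`. -/
theorem IsDerivator.exists_coreflection (hD : D.IsDerivator) (hP : D.IsPointed) (k : A ⟶ B)
    (X : D.obj (op B)) : ∃ (X' : D.obj (op B)) (r : X' ⟶ X), VanishesOff k X' ∧
      ∀ W, VanishesOff k W → Function.Bijective fun g : W ⟶ X' => g ≫ r := by
  have h01 : (⟨1⟩ : arrowCat.{w}) ≠ ⟨0⟩ := fun e => by simpa using congrArg ULift.down e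
  -- The levels are exchanged: `B` sits at level 1, level 0 carries only the objects off the image,
  -- and left and right Kan extensions swap roles.
  let s := zeroExtIncl k h01
  let p := zeroExtProj k ⟨0⟩
  have : s.toFunctor.Full := full_zeroExtIncl k h01
  have : s.toFunctor.Faithful := faithful_zeroExtIncl k h01
  have := hD.hasLeftKan s
  have := hD.hasRightKan p
  have hs : ∀ x ∉ Set.range s.toFunctor.obj, IsEmpty (slice s x) := fun x hx => ⟨fun y => by
    have e := eq_of_notMem_range_zeroExtIncl k h01 hx
    have f : ⟨1⟩ ⟶ x.obj.2 := y.hom.hom.2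
    rw [e] at f
    exact absurd (down_le_of_hom f) (by decide)⟩
  obtain ⟨M, η, hη⟩ := exists_isUniv (D.pull s) X
  obtain ⟨X', κ, hκ⟩ := exists_isCouniv (D.pull p) M
  have : IsIso η := hD.isIso_of_isUniv hη
  have hM := hD.vanishesOff_of_isUniv hP hs hη
  let e := D.retractIso (zeroExtRetract k h01)
  refine ⟨X', ((e X').inv ≫ (D.pull s).map κ) ≫ inv η, fun v hv => ?_, fun W hW => ?_⟩
  -- Now `(v, 0)` with the identity of `v` is initial in the coslice of `p` under `v`, because `0 ≤
  -- j`.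
  · let t : zeroExt k ⟨0⟩ := ⟨(v, ⟨0⟩), fun _ => hv⟩
    refine isZero_of_isTerminal hP (hD.nonempty_isTerminal_of_coslice hκ v
      (StructuredArrow.mk (T := p.toFunctor) (S := v) (Y := t) (𝟙 v)) (fun x => ?_)
      (hM _ fun ⟨b, hb⟩ => h01 (congrArg (fun y => y.obj.2) hb)))
    exact
      { default := StructuredArrow.homMk (ObjectProperty.homMk
          (show t.obj ⟶ x.right.obj from (x.hom, arrowHom (Fin.zero_le _)))) (Category.id_comp x.hom)
        uniq f := StructuredArrow.hom_ext _ _ (ObjectProperty.hom_ext _ (Prod.ext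
          ((Category.id_comp _).symm.trans (StructuredArrow.w f)) (Subsingleton.elim _ _))) }
  · have hN : VanishesOff s ((D.pull p).obj W) := fun x hx => by
      refine (isZero_pull_objFunctor_comp p x).2 (hW _ ?_)
      exact x.property (eq_of_notMem_range_zeroExtIncl k h01 hx)
    have h := hD.isUniv_id_of_vanishesOff hP hs hN
    refine bijective_congr (bijective_comp (bijective_precomp ((h M).comp (hκ W)) (e W).inv) (inv η))
      fun g => ?_
    have h' : (e W).inv ≫ (D.pull s).map ((D.pull p).map g) = g ≫ (e X').inv := by
      rw [Iso.inv_comp_eq, ← Category.assoc, Iso.eq_comp_inv]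
      exact D.retractIso_hom_naturality (zeroExtRetract k h01) g
    simp [reassoc_of% h']

end
end Prederivator

/-! ## Adjoints of extension by zero -/

namespace DerivatorAux
universe v₁ v₂ u₁ u₂
section
variable {C : Type u₁} [Category.{v₁} C] {E : Type u₂} [Category.{v₂} E]

/-- Turns a reflection onto the essential image of a fully faithful functor into a universal arrow
to that functor. -/
lemma isUniv_comp_iso (L : E ⥤ C) [L.Full] [L.Faithful] {X X' : C} {Y : E} (r : X ⟶ X')
    (e : X' ≅ L.obj Y) (h : ∀ Z, Function.Bijective fun g : X' ⟶ L.obj Z => r ≫ g) :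
    IsUniv L (r ≫ e.hom) := fun Z => by
  refine bijective_congr ((h Z).comp (bijective_precomp
    ⟨L.map_injective, L.map_surjective (X := Y) (Y := Z)⟩ e.hom)) fun g => ?_
  simp

lemma isCouniv_iso_comp (L : E ⥤ C) [L.Full] [L.Faithful] {X X' : C} {Y : E} (r : X' ⟶ X)
    (e : L.obj Y ≅ X') (h : ∀ Z, Function.Bijective fun g : L.obj Z ⟶ X' => g ≫ r) :
    IsCouniv L (e.hom ≫ r) := fun Z => by
  refine bijective_congr ((h Z).comp (bijective_comp
    ⟨L.map_injective, L.map_surjective (X := Z) (Y := Y)⟩ e.hom)) fun g => ?_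
  simp

/-- `κ` transposes arrows `G X' ⟶ W` to arrows `X' ⟶ M`. It thus lets restriction preserve a
reflection once the right Kan extension of a test object is again a test object. -/
lemma IsCouniv.bijective_precomp_map {G : E ⥤ C} {W : C} {M : E} {κ : G.obj M ⟶ W}
    (hκ : IsCouniv G κ) {X X' : E} (r : X ⟶ X')
    (h : Function.Bijective fun m : X' ⟶ M => r ≫ m) :
    Function.Bijective fun g : G.obj X' ⟶ W => G.map r ≫ g := by
  refine (Function.Bijective.of_comp_iff _ (hκ X')).1 ?_
  refine bijective_congr ((hκ X).comp h) fun m => ?_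
  simp

lemma IsUniv.bijective_comp_map {G : E ⥤ C} {W : C} {M : E} {η : W ⟶ G.obj M}
    (hη : IsUniv G η) {X X' : E} (r : X' ⟶ X)
    (h : Function.Bijective fun m : M ⟶ X' => m ≫ r) :
    Function.Bijective fun g : W ⟶ G.obj X' => g ≫ G.map r := by
  refine (Function.Bijective.of_comp_iff _ (hη X')).1 ?_
  refine bijective_congr ((hη X).comp h) fun m => ?_
  simp

end
end DerivatorAux

namespace Prederivator
open DerivatorAux Limits

section
variable {D : Prederivator.{w, v, u}} {A B C C' : Cat.{w, w}}

lemma notMem_range_timesHom_iff (k : A ⟶ B) (x : Cat.of (B × C)) :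
    x ∉ Set.range (timesHom k C).toFunctor.obj ↔ x.1 ∉ Set.range k.toFunctor.obj := by
  refine not_congr ⟨fun ⟨y, hy⟩ => ⟨y.1, congrArg Prod.fst hy⟩, fun ⟨a, ha⟩ => ⟨(a, x.2), ?_⟩⟩
  exact Prod.ext ha rfl

lemma isZero_pull_timesHom (b : B) (x : Cat.of (pt.{w} × C)) {W : D.obj (op (Cat.of (B × C)))} :
    IsZero ((D.pull (objFunctor x)).obj ((D.pull (timesHom (objFunctor b) C)).obj W)) ↔
      IsZero ((D.pull (objFunctor (A := Cat.of (B × C)) (b, x.2))).obj W) :=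
  isZero_pull_objFunctor_comp (timesHom (objFunctor b) C) x

/-- For `b` off the image, arrows `S ⟶ b^* M` correspond to arrows `b_! S ⟶ M`, then to arrows from
the restriction of `b_! S` along `f` to `W`. By stability of `b_!` these are arrows from the
restriction of `S` to `b^* W`, which is terminal. So `b^* M` is terminal, and its values are zero by
pointedness. -/
theorem IsDerivator.vanishesOff_of_isCouniv_homTimes (hD : D.IsDerivator) (hP : D.IsPointed)
    (k : A ⟶ B) (f : C' ⟶ C) {W : D.obj (op (Cat.of (B × C')))}
    (hW : VanishesOff (timesHom k C') W) {M : D.obj (op (Cat.of (B × C)))}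
    {κ : (D.pull (homTimes B f)).obj M ⟶ W} (hκ : IsCouniv (D.pull (homTimes B f)) κ) :
    VanishesOff (timesHom k C) M := fun ⟨b, c⟩ hb => by
  have hb' := (notMem_range_timesHom_iff k _).1 hb
  obtain ⟨hN⟩ : Nonempty (IsTerminal ((D.pull (timesHom (objFunctor b) C')).obj W)) :=
    hD.nonempty_isTerminal_of_forall fun x => ⟨IsZero.isTerminal <|
      (isZero_pull_timesHom b x).2 (hW _ ((notMem_range_timesHom_iff k _).2 hb'))⟩
  have hM : IsTerminal ((D.pull (timesHom (objFunctor b) C)).obj M) :=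
    IsTerminal.ofUniqueHom
      (fun S => by
        have h := hD.hasStableUniv_restrict (objFunctor b) (op C) S
        exact h.choose_spec.choose ≫ (D.pull (timesHom (objFunctor b) C)).map
          (hκ.lift ((h.choose_spec.choose_spec.2 (c' := op C') f.op).desc (hN.from _))))
      (fun S m => by
        have h := hD.hasStableUniv_restrict (objFunctor b) (op C) S
        rw [← h.choose_spec.choose_spec.1.fac m]
        congr 2
        refine hκ.hom_ext ((h.choose_spec.choose_spec.2 (c' := op C') f.op).hom_ext ?_)
        exact hN.hom_ext _ _)
  obtain ⟨h⟩ := hD.nonempty_isTerminal_pull (objFunctor (A := Cat.of (pt.{w} × C)) (⟨⟨⟩⟩, c)) hM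
  exact (isZero_pull_timesHom b _).1 (isZero_of_isTerminal hP ⟨h⟩)

/-- Dual chain of correspondences, with the stability of `b_*` showing that `b^* M` is initial. -/
theorem IsDerivator.vanishesOff_of_isUniv_homTimes (hD : D.IsDerivator) (hP : D.IsPointed)
    (k : A ⟶ B) (f : C' ⟶ C) {W : D.obj (op (Cat.of (B × C')))}
    (hW : VanishesOff (timesHom k C') W) {M : D.obj (op (Cat.of (B × C)))}
    {η : W ⟶ (D.pull (homTimes B f)).obj M} (hη : IsUniv (D.pull (homTimes B f)) η) :
    VanishesOff (timesHom k C) M := fun ⟨b, c⟩ hb => by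
  have hb' := (notMem_range_timesHom_iff k _).1 hb
  obtain ⟨hN⟩ : Nonempty (IsInitial ((D.pull (timesHom (objFunctor b) C')).obj W)) :=
    hD.nonempty_isInitial_of_forall fun x => ⟨IsZero.isInitial <|
      (isZero_pull_timesHom b x).2 (hW _ ((notMem_range_timesHom_iff k _).2 hb'))⟩
  have hM : IsInitial ((D.pull (timesHom (objFunctor b) C)).obj M) :=
    IsInitial.ofUniqueHom
      (fun S => by
        have h := hD.hasStableCouniv_restrict (objFunctor b) (op C) S
        exact (D.pull (timesHom (objFunctor b) C)).map
          (hη.desc ((h.choose_spec.choose_spec.2 (c' := op C') f.op).lift (hN.to _))) ≫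
            h.choose_spec.choose)
      (fun S m => by
        have h := hD.hasStableCouniv_restrict (objFunctor b) (op C) S
        rw [← h.choose_spec.choose_spec.1.fac m]
        congr 2
        refine hη.hom_ext ((h.choose_spec.choose_spec.2 (c' := op C') f.op).hom_ext ?_)
        exact hN.hom_ext _ _)
  obtain ⟨h⟩ := hD.nonempty_isInitial_pull (objFunctor (A := Cat.of (pt.{w} × C)) (⟨⟨⟩⟩, c)) hM
  exact (isZero_pull_timesHom b _).1 (isZero_of_isInitial hP ⟨h⟩)

lemma full_timesHom (k : A ⟶ B) (C : Cat.{w, w}) [k.toFunctor.Full] :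
    (timesHom k C).toFunctor.Full where
  map_surjective f := ⟨(k.toFunctor.preimage f.1, f.2),
    Prod.ext (k.toFunctor.map_preimage f.1) rfl⟩

lemma faithful_timesHom (k : A ⟶ B) (C : Cat.{w, w}) [k.toFunctor.Faithful] :
    (timesHom k C).toFunctor.Faithful where
  map_injective e := Prod.ext (k.toFunctor.map_injective (congrArg (fun f => f.1) e))
    (congrArg (fun f => f.2) e :)

lemma isEmpty_slice_timesHom {k : A ⟶ B} (hk : IsCosieveFunctor k) (x : Cat.of (B × C))
    (hx : x ∉ Set.range (timesHom k C).toFunctor.obj) : IsEmpty (slice (timesHom k C) x) :=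
  ⟨fun y => (notMem_range_timesHom_iff k x).1 hx (hk.mem_range y.left.1 x.1 y.hom.1)⟩

lemma isEmpty_coslice_timesHom {k : A ⟶ B} (hk : IsSieveFunctor k) (x : Cat.of (B × C))
    (hx : x ∉ Set.range (timesHom k C).toFunctor.obj) : IsEmpty (coslice (timesHom k C) x) :=
  ⟨fun y => (notMem_range_timesHom_iff k x).1 hx (hk.mem_range y.right.1 x.1 y.hom.1)⟩

/-- The unit of `k_!` is invertible, so `F` is componentwise fully faithful, and its values vanish
off `k × C`. Conversely every diagram vanishing there is a value of `F` up to isomorphism. So the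
reflection onto vanishing diagrams is a universal arrow to `F`. -/
theorem IsDerivator.hasStableUniv_of_isCosieveFunctor (hD : D.IsDerivator) (hP : D.IsPointed)
    {k : A ⟶ B} (hk : IsCosieveFunctor k) {F : D.shift A ⟶ D.shift B}
    (adj : Bicategory.Adjunction F (D.restrict k)) : HasStableUniv F := fun C X => by
  have := hk.full
  have := hk.faithful
  let a (C : Cat.{w, w}ᵒᵖ) : (F.app C).toFunctor ⊣ D.pull (timesHom k C.unop) :=
    adjunctionApp adj C
  have hfull (C : Cat.{w, w}) := full_timesHom k C
  have hfaith (C : Cat.{w, w}) := faithful_timesHom k C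
  have hunit (C : Cat.{w, w}ᵒᵖ) : IsIso (a C).unit :=
    have (Y : _) : IsIso ((a C).unit.app Y) := hD.isIso_of_isUniv (isUniv_unit (a C) Y)
    NatIso.isIso_of_isIso_app _
  have hF (C : Cat.{w, w}ᵒᵖ) : (F.app C).toFunctor.Full :=
    (a C).fullyFaithfulLOfIsIsoUnit.full
  have hF' (C : Cat.{w, w}ᵒᵖ) : (F.app C).toFunctor.Faithful :=
    (a C).fullyFaithfulLOfIsIsoUnit.faithful
  have hv (C : Cat.{w, w}ᵒᵖ) (Z : _) : VanishesOff (timesHom k C.unop) ((F.app C).toFunctor.obj Z) :=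
    hD.vanishesOff_of_isUniv hP (isEmpty_slice_timesHom hk) (isUniv_unit (a C) Z)
  obtain ⟨X', r, hX', hr⟩ := hD.exists_reflection hP (timesHom k C.unop) X
  have h := hD.isUniv_id_of_vanishesOff hP (isEmpty_slice_timesHom hk) hX'
  -- Both the identity and the unit of `F` are universal from the restriction of `X'`, so `X'` is
  -- `F` of that restriction.
  let e := h.iso (isUniv_unit (a C) _)
  refine ⟨_, r ≫ e.hom, isUniv_comp_iso _ _ _ fun Z => hr _ (hv _ _), fun {C'} f => ?_⟩
  have h₁ := isUniv_comp_iso (F.app C').toFunctor ((D.pull (homTimes B f.unop)).map r)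
    ((D.pull (homTimes B f.unop)).mapIso e ≪≫ (natIso F f _).symm) fun Z => by
      -- Stability: an arrow from the restricted reflection to a vanishing diagram transposes to an
      -- arrow from `X'` to its right Kan extension along `B × f`, which vanishes too.
      have := hD.hasRightKan (homTimes B f.unop)
      obtain ⟨M, κ, hκ⟩ := exists_isCouniv (D.pull (homTimes B f.unop))
        ((F.app C').toFunctor.obj Z)
      exact hκ.bijective_precomp_map r
        (hr M (hD.vanishesOff_of_isCouniv_homTimes hP k f.unop (hv _ Z) hκ))
  have h₂ : transport F f (r ≫ e.hom) = (D.pull (homTimes B f.unop)).map r ≫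
      ((D.pull (homTimes B f.unop)).mapIso e ≪≫ (natIso F f _).symm).hom :=
    (congrArg (fun z => z ≫ (natIso F f _).inv) (Functor.map_comp _ r e.hom)).trans
      (Category.assoc _ _ _)
  exact h₂ ▸ h₁

/-- For a sieve the counit of `k_*` is invertible and the coslices off the image are empty, so `k_*`
is extension by zero and coreflections give couniversal arrows. They are stable because the left Kan
extension along `B × f` preserves vanishing diagrams. -/
theorem IsDerivator.hasStableCouniv_of_isSieveFunctor (hD : D.IsDerivator) (hP : D.IsPointed)
    {k : A ⟶ B} (hk : IsSieveFunctor k) {F : D.shift A ⟶ D.shift B}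
    (adj : Bicategory.Adjunction (D.restrict k) F) : HasStableCouniv F := fun C X => by
  have := hk.full
  have := hk.faithful
  let a (C : Cat.{w, w}ᵒᵖ) : D.pull (timesHom k C.unop) ⊣ (F.app C).toFunctor :=
    adjunctionApp adj C
  have hfull (C : Cat.{w, w}) := full_timesHom k C
  have hfaith (C : Cat.{w, w}) := faithful_timesHom k C
  have hunit (C : Cat.{w, w}ᵒᵖ) : IsIso (a C).counit :=
    have (Y : _) : IsIso ((a C).counit.app Y) := hD.isIso_of_isCouniv (isCouniv_counit (a C) Y)
    NatIso.isIso_of_isIso_app _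
  have hF (C : Cat.{w, w}ᵒᵖ) : (F.app C).toFunctor.Full :=
    (a C).fullyFaithfulROfIsIsoCounit.full
  have hF' (C : Cat.{w, w}ᵒᵖ) : (F.app C).toFunctor.Faithful :=
    (a C).fullyFaithfulROfIsIsoCounit.faithful
  have hv (C : Cat.{w, w}ᵒᵖ) (Z : _) : VanishesOff (timesHom k C.unop) ((F.app C).toFunctor.obj Z) :=
    hD.vanishesOff_of_isCouniv hP (isEmpty_coslice_timesHom hk) (isCouniv_counit (a C) Z)
  obtain ⟨X', r, hX', hr⟩ := hD.exists_coreflection hP (timesHom k C.unop) X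
  have h := hD.isCouniv_id_of_vanishesOff hP (isEmpty_coslice_timesHom hk) hX'
  let e := (isCouniv_counit (a C) _).iso h
  refine ⟨_, e.hom ≫ r, isCouniv_iso_comp _ _ _ fun Z => hr _ (hv _ _), fun {C'} f => ?_⟩
  have h₁ := isCouniv_iso_comp (F.app C').toFunctor ((D.pull (homTimes B f.unop)).map r)
    (natIso F f _ ≪≫ (D.pull (homTimes B f.unop)).mapIso e) fun Z => by
      have := hD.hasLeftKan (homTimes B f.unop)
      obtain ⟨M, η, hη⟩ := exists_isUniv (D.pull (homTimes B f.unop))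
        ((F.app C').toFunctor.obj Z)
      exact hη.bijective_comp_map r
        (hr M (hD.vanishesOff_of_isUniv_homTimes hP k f.unop (hv _ Z) hη))
  have h₂ : cotransport F f (e.hom ≫ r) =
      (natIso F f _ ≪≫ (D.pull (homTimes B f.unop)).mapIso e).hom ≫
        (D.pull (homTimes B f.unop)).map r :=
    (congrArg (fun z => (natIso F f _).hom ≫ z) (Functor.map_comp _ e.hom r)).trans
      (Category.assoc _ _ _).symm
  exact h₂ ▸ h₁

end
end Prederivator

/-! ## Evaluation at an object -/

namespace DerivatorAux
universe w₁ v₁ u₁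
section
variable {B : Type u₁} [Bicategory.{w₁, v₁} B] {a b : B}

/-- Replacing the right adjoint by an isomorphic 1-morphism. -/
def adjunctionOfIsoRight {f : a ⟶ b} {g g' : b ⟶ a} (adj : Bicategory.Adjunction f g) (e : g ≅ g') :
    Bicategory.Adjunction f g' where
  unit := adj.unit ≫ f ◁ e.hom
  counit := e.inv ▷ f ≫ adj.counit
  left_triangle := by
    calc
      _ = adj.unit ▷ f ⊗≫ f ◁ (e.hom ≫ e.inv) ▷ f ⊗≫ f ◁ adj.counit := by
        dsimp only [leftZigzag]; bicategory
      _ = leftZigzag adj.unit adj.counit := by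
        rw [e.hom_inv_id]; dsimp only [leftZigzag]; bicategory
      _ = _ := adj.left_triangle
  right_triangle := by
    calc
      _ = g' ◁ adj.unit ⊗≫ ((g' ≫ f) ◁ e.hom ≫ (e.inv ▷ f) ▷ g') ⊗≫ adj.counit ▷ g' := by
        dsimp only [rightZigzag]; bicategory
      _ = 𝟙 _ ⊗≫ (g' ◁ adj.unit ≫ e.inv ▷ (f ≫ g)) ⊗≫
          ((g ≫ f) ◁ e.hom ≫ adj.counit ▷ g') ⊗≫ 𝟙 _ := by
        rw [whisker_exchange]; bicategory
      _ = 𝟙 _ ⊗≫ e.inv ▷ 𝟙 a ⊗≫ rightZigzag adj.unit adj.counit ⊗≫ 𝟙 b ◁ e.hom ⊗≫ 𝟙 _ := by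
        rw [whisker_exchange, whisker_exchange]; dsimp only [rightZigzag]; bicategory
      _ = (ρ_ _).hom ≫ (e.inv ≫ e.hom) ≫ (λ_ _).inv := by
        rw [adj.right_triangle]; bicategory
      _ = _ := by simp

/-- Replacing the left adjoint by an isomorphic 1-morphism. -/
def adjunctionOfIsoLeft {f f' : a ⟶ b} {g : b ⟶ a} (adj : Bicategory.Adjunction f g) (e : f ≅ f') :
    Bicategory.Adjunction f' g where
  unit := adj.unit ≫ e.hom ▷ g
  counit := g ◁ e.inv ≫ adj.counit
  right_triangle := by
    calc
      _ = g ◁ adj.unit ⊗≫ g ◁ (e.hom ≫ e.inv) ▷ g ⊗≫ adj.counit ▷ g := by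
        dsimp only [rightZigzag]; bicategory
      _ = rightZigzag adj.unit adj.counit := by
        rw [e.hom_inv_id]; dsimp only [rightZigzag]; bicategory
      _ = _ := adj.right_triangle
  left_triangle := by
    calc
      _ = adj.unit ▷ f' ⊗≫ (e.hom ▷ (g ≫ f') ≫ f' ◁ (g ◁ e.inv)) ⊗≫ f' ◁ adj.counit := by
        dsimp only [leftZigzag]; bicategory
      _ = 𝟙 _ ⊗≫ (adj.unit ▷ f' ≫ (f ≫ g) ◁ e.inv) ⊗≫
          (e.hom ▷ (g ≫ f) ≫ f' ◁ adj.counit) ⊗≫ 𝟙 _ := by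
        rw [← whisker_exchange]; bicategory
      _ = 𝟙 _ ⊗≫ 𝟙 a ◁ e.inv ⊗≫ leftZigzag adj.unit adj.counit ⊗≫ e.hom ▷ 𝟙 b ⊗≫ 𝟙 _ := by
        rw [← whisker_exchange, ← whisker_exchange]; dsimp only [leftZigzag]; bicategory
      _ = (λ_ _).hom ≫ (e.inv ≫ e.hom) ≫ (ρ_ _).inv := by
        rw [adj.left_triangle]; bicategory
      _ = _ := by simp
end
end DerivatorAux

namespace Prederivator
open DerivatorAux Limits

section
variable (D : Prederivator.{w, v, u}) {A B C C' : Cat.{w, w}}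

/-- The functor `c ↦ (a, c)`. -/
abbrev sectHom (a : A) (C : Cat.{w, w}) : C ⟶ Cat.of (A × C) :=
  (CategoryTheory.Prod.sectR a C).toCatHom

/-- The isomorphism `(a, -) ≫ (A × f) ≅ f ≫ (a, -)`. -/
def sectSquare (a : A) (f : C' ⟶ C) : sectHom a C' ≫ homTimes A f ≅ f ≫ sectHom a C :=
  Cat.Hom.isoMk
    (show CategoryTheory.Prod.sectR a C' ⋙ (𝟭 A).prod f.toFunctor ≅
        f.toFunctor ⋙ CategoryTheory.Prod.sectR a C from
      NatIso.ofComponents (fun _ => Iso.refl _) fun {x y} g => Prod.ext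
        (show 𝟙 a ≫ 𝟙 a = 𝟙 a ≫ 𝟙 a from rfl)
        (show f.toFunctor.map g ≫ 𝟙 _ = 𝟙 _ ≫ f.toFunctor.map g by simp))

/-- The isomorphism `(*, -) ≫ (a × C) ≅ (a, -)`. -/
def sectComp (a : A) (C : Cat.{w, w}) :
    sectHom (A := pt.{w}) ⟨⟨⟩⟩ C ≫ timesHom (objFunctor a) C ≅ sectHom a C :=
  Cat.Hom.isoMk (F := (sectHom (A := pt.{w}) ⟨⟨⟩⟩ C ≫ timesHom (objFunctor a) C).toFunctor)
    (G := (sectHom a C).toFunctor) (NatIso.ofComponents (fun _ => Iso.refl _) fun _ =>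
      (Category.comp_id _).trans (Category.id_comp _).symm)

/-- Carries the identity `e` between pasted 2-cells of functors over to the restriction
isomorphisms. It supplies the naturality of the components of `restrictCompEvalAt`. -/
lemma compIso_square {S S' P P' Q Q' : Cat.{w, w}} {s : S' ⟶ P'} {t : P' ⟶ Q'} {φ : Q' ⟶ Q}
    {r : S' ⟶ Q'} {f : S' ⟶ S} {r₀ : S ⟶ Q} {ψ : P' ⟶ P} {t₀ : P ⟶ Q} {s₀ : S ⟶ P}
    (α : s ≫ t ⟶ r) (β : r ≫ φ ⟶ f ≫ r₀) (γ : t ≫ φ ⟶ ψ ≫ t₀) (δ : s ≫ ψ ⟶ f ≫ s₀)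
    (ι : s₀ ≫ t₀ ⟶ r₀) (e : α ▷ φ ≫ β = s ◁ γ ≫ δ ▷ t₀ ≫ f ◁ ι) (X : D.obj (op Q)) :
    ((D.compIso s t ((D.pull φ).obj X)).inv ≫ D.cellMap α ((D.pull φ).obj X)) ≫
        (D.compIso r φ X).inv ≫ D.cellMap β X ≫ (D.compIso f r₀ X).hom =
      ((D.pull s).map ((D.compIso t φ X).inv ≫ D.cellMap γ X ≫ (D.compIso ψ t₀ X).hom) ≫
        (D.compIso s ψ ((D.pull t₀).obj X)).inv ≫ D.cellMap δ ((D.pull t₀).obj X) ≫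
            (D.compIso f s₀ ((D.pull t₀).obj X)).hom) ≫
          (D.pull f).map ((D.compIso s₀ t₀ X).inv ≫ D.cellMap ι X) := by
  have e' : D.cellMap (k := (s ≫ t) ≫ φ) (l := r ≫ φ) (α ▷ φ) X ≫ D.cellMap β X =
      D.cellMap (k := s ≫ t ≫ φ) (l := s ≫ ψ ≫ t₀) (s ◁ γ) X ≫
        D.cellMap (k := (s ≫ ψ) ≫ t₀) (l := (f ≫ s₀) ≫ t₀) (δ ▷ t₀) X ≫
          D.cellMap (k := f ≫ s₀ ≫ t₀) (l := f ≫ r₀) (f ◁ ι) X :=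
    (D.cellMap_comp (k := (s ≫ t) ≫ φ) _ _ X).symm.trans
      ((congrArg (fun z => D.cellMap (k := (s ≫ t) ≫ φ) z X) e).trans
        ((D.cellMap_comp _ _ X).trans (congrArg _ (D.cellMap_comp _ _ X))))
  simp only [Functor.map_comp, Category.assoc]
  rw [← compIso_inv_cellMap_assoc, reassoc_of% D.compIso_inv_assoc s t φ X, reassoc_of% e',
    ← compIso_inv_comp_hom'_assoc, ← cellMap_whiskerRight_assoc, compIso_assoc_assoc,
    ← reassoc_of% D.map_cellMap_compIso_inv s γ X]
  rw [← (D.pull f).map_comp_assoc, Iso.hom_inv_id, CategoryTheory.Functor.map_id, Category.id_comp,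
    ← cellMap_whiskerLeft]

lemma comp_eq_id_comp_id_comp_id {C : Type*} [Category* C] {X Y Z : C} (f : X ⟶ Y) (g : Y ⟶ Z) :
    f ≫ g = 𝟙 X ≫ f ≫ 𝟙 Y ≫ g ≫ 𝟙 Z := by simp

/-- Restricting to the object `a` and evaluating at the point is evaluating at `a`. -/
def restrictCompEvalAt (a : A) :
    D.restrict (objFunctor a) ≫ D.evalAt (A := pt.{w}) ⟨⟨⟩⟩ ≅ D.evalAt a :=
  Pseudofunctor.StrongTrans.isoMk
    (fun C => (D.mapComp (timesHom (objFunctor a) C.unop).op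
      (sectHom (A := pt.{w}) ⟨⟨⟩⟩ C.unop).op).symm ≪≫ D.map₂Iso (sectComp a C.unop).op2)
    (fun {C C'} f => by
      ext X
      have h := D.compIso_square (sectComp a C'.unop).hom (sectSquare a f.unop).hom
        (timesSquare (objFunctor a) f.unop).inv (sectSquare (A := pt.{w}) ⟨⟨⟩⟩ f.unop).hom
        (sectComp a C.unop).hom (by
          ext x
          refine Prod.ext ?_ ?_
          · change 𝟙 a ≫ 𝟙 a = 𝟙 a ≫ 𝟙 a ≫ 𝟙 a
            simp
          · change f.unop.toFunctor.map (𝟙 x) ≫ 𝟙 (f.unop.toFunctor.obj x) =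
              𝟙 (f.unop.toFunctor.obj x) ≫ 𝟙 (f.unop.toFunctor.obj x) ≫
                𝟙 (f.unop.toFunctor.obj x)
            simp) X
      refine h.trans ?_
      refine congrArg (fun z => z ≫ _) ?_
      exact comp_eq_id_comp_id_comp_id _ _)

end
end Prederivator

/-! ## Kan extensions along objects and along the empty functor -/

namespace Prederivator
open DerivatorAux Limits

section
variable {D : Prederivator.{w, v, u}} {A B C : Cat.{w, w}}

lemma isEquivalence_pull {j : A ⟶ B} {j' : B ⟶ A} (e : j ≫ j' ≅ 𝟙 A) (e' : j' ≫ j ≅ 𝟙 B) :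
    (D.pull j).IsEquivalence :=
  (CategoryTheory.Equivalence.mk (D.pull j) (D.pull j')
    (NatIso.ofComponents (fun X => (D.retractIso e' X).symm) fun f =>
      (Iso.eq_inv_comp _).2 (by
        change (D.retractIso e' _).hom ≫ f ≫ (D.retractIso e' _).inv = _
        rw [← reassoc_of% D.retractIso_hom_naturality e' f, Iso.hom_inv_id]
        exact Category.comp_id _))
    (NatIso.ofComponents (fun X => D.retractIso e X) fun f =>
      D.retractIso_hom_naturality e f)).isEquivalence_functor

lemma isEquivalence_evalAt_pt (C : Cat.{w, w}ᵒᵖ) :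
    ((D.evalAt (A := pt.{w}) ⟨⟨⟩⟩).app C).toFunctor.IsEquivalence :=
  isEquivalence_pull (j := sectHom (A := pt.{w}) ⟨⟨⟩⟩ C.unop)
    (j' := (CategoryTheory.Prod.snd pt.{w} C.unop).toCatHom)
    (Cat.Hom.isoMk (NatIso.ofComponents (fun _ => Iso.refl _) fun f =>
      (Category.comp_id f).trans (Category.id_comp f).symm))
    (Cat.Hom.isoMk (NatIso.ofComponents (fun _ => Iso.refl _) fun f =>
      Prod.ext (Subsingleton.elim (α := (_ : Discrete PUnit) ⟶ _) _ _)
        ((Category.comp_id f.2).trans (Category.id_comp f.2).symm)))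

/-- A left Kan extension morphism along `𝟙 ⥤ A` gives one for the evaluation. -/
theorem exists_isLeftKan_evalAt {a : A} {F : D.shift pt.{w} ⟶ D.shift A}
    (hF : IsLeftKan F (D.restrict (objFunctor a))) (hF' : Bicategory.IsRightAdjoint F) :
    ∃ G : D ⟶ D.shift A, IsLeftKan G (D.evalAt a) ∧ Bicategory.IsRightAdjoint G := by
  let E := D.evalAt (A := pt.{w}) ⟨⟨⟩⟩
  let h : HasStableUniv E := hasStableUniv_of_isEquivalence E isEquivalence_evalAt_pt
  -- The left adjoint of the equivalence between `D` shifted by the point and `D` is itself a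
  -- componentwise equivalence, so it has a further left adjoint to compose with that of `F`.
  have hL : HasStableUniv h.leftAdj := hasStableUniv_of_isEquivalence _ fun C =>
    have : (E.app C).toFunctor.IsEquivalence := isEquivalence_evalAt_pt C
    (adjunctionApp h.adjunction C).isEquivalence_left_of_isEquivalence_right
  exact ⟨h.leftAdj ≫ F, ⟨adjunctionOfIsoRight (h.adjunction.comp hF.some) (D.restrictCompEvalAt a)⟩,
    .mk ((Bicategory.Adjunction.ofIsRightAdjoint F).comp hL.adjunction)⟩

/-- A right Kan extension morphism along `𝟙 ⥤ A` gives one for the evaluation. -/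
theorem exists_isRightKan_evalAt {a : A} {F : D.shift pt.{w} ⟶ D.shift A}
    (hF : IsRightKan F (D.restrict (objFunctor a))) (hF' : Bicategory.IsLeftAdjoint F) :
    ∃ G : D ⟶ D.shift A, IsRightKan G (D.evalAt a) ∧ Bicategory.IsLeftAdjoint G := by
  let E := D.evalAt (A := pt.{w}) ⟨⟨⟩⟩
  let h : HasStableCouniv E := hasStableCouniv_of_isEquivalence E isEquivalence_evalAt_pt
  -- Again an adjoint of a componentwise equivalence is one, which provides the further right
  -- adjoint.
  have hR : HasStableCouniv h.rightAdj := hasStableCouniv_of_isEquivalence _ fun C =>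
    have : (E.app C).toFunctor.IsEquivalence := isEquivalence_evalAt_pt C
    (adjunctionApp h.adjunction C).isEquivalence_right_of_isEquivalence_left
  exact ⟨h.rightAdj ≫ F, ⟨adjunctionOfIsoLeft (hF.some.comp h.adjunction) (D.restrictCompEvalAt a)⟩,
    .mk (hR.adjunction.comp (Bicategory.Adjunction.ofIsLeftAdjoint F))⟩

lemma isCosieveFunctor_objFunctor_one :
    IsCosieveFunctor (objFunctor (A := arrowCat.{w}) ⟨1⟩) where
  full := ⟨fun _ => ⟨Discrete.eqToHom (Subsingleton.elim _ _), Subsingleton.elim _ _⟩⟩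
  faithful := ⟨fun _ => Subsingleton.elim (α := (_ : Discrete PUnit) ⟶ _) _ _⟩
  injective _ _ _ := Subsingleton.elim (α := Discrete PUnit) _ _
  mem_range _ _ f := ⟨⟨⟨⟩⟩, ULift.ext _ _ (le_antisymm (down_le_of_hom f) (Fin.le_last _))⟩

lemma isSieveFunctor_objFunctor_zero :
    IsSieveFunctor (objFunctor (A := arrowCat.{w}) ⟨0⟩) where
  full := ⟨fun _ => ⟨Discrete.eqToHom (Subsingleton.elim _ _), Subsingleton.elim _ _⟩⟩
  faithful := ⟨fun _ => Subsingleton.elim (α := (_ : Discrete PUnit) ⟶ _) _ _⟩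
  injective _ _ _ := Subsingleton.elim (α := Discrete PUnit) _ _
  mem_range _ _ f := ⟨⟨⟨⟩⟩, ULift.ext _ _ (le_antisymm (Fin.zero_le _) (down_le_of_hom f))⟩

lemma isRightAdjoint_app {P Q : Prederivator.{w, v, u}} {F : P ⟶ Q}
    (hF : Bicategory.IsRightAdjoint F) (C : Cat.{w, w}ᵒᵖ) : (F.app C).toFunctor.IsRightAdjoint :=
  (adjunctionApp (Bicategory.Adjunction.ofIsRightAdjoint F) C).isRightAdjoint

lemma isLeftAdjoint_app {P Q : Prederivator.{w, v, u}} {F : P ⟶ Q}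
    (hF : Bicategory.IsLeftAdjoint F) (C : Cat.{w, w}ᵒᵖ) : (F.app C).toFunctor.IsLeftAdjoint :=
  (adjunctionApp (Bicategory.Adjunction.ofIsLeftAdjoint F) C).isLeftAdjoint

/-! ### Pointedness and the Kan extensions along `1`, `0` and the empty functor -/

variable (hD : D.IsDerivator)
include hD

theorem IsDerivator.isPointed_of_isLeftKan_evalAt {F : D ⟶ D.shift arrowCat.{w}}
    (h : IsLeftKan F (D.evalAt (A := arrowCat.{w}) ⟨1⟩)) (hF : Bicategory.IsRightAdjoint F) :
    D.IsPointed := by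
  let G : D.obj (op pt.{w}) ⥤ D.obj (op (Cat.of (arrowCat.{w} × pt.{w}))) := (F.app (op pt)).toFunctor
  have : G.IsRightAdjoint := isRightAdjoint_app hF (op pt)
  -- There is no arrow from `1` to `0` in `[1]`, so `1_!` is an empty colimit at `0`.
  have : IsEmpty (slice (sectHom (A := arrowCat.{w}) ⟨1⟩ pt.{w}) (⟨0⟩, ⟨⟨⟩⟩)) :=
    ⟨fun x => absurd (show (1 : Fin 2) ≤ 0 from down_le_of_hom x.hom.1) (by decide)⟩
  exact hD.isPointed_of_isRightAdjoint (k := sectHom (A := arrowCat.{w}) ⟨1⟩ pt.{w})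
    (F := G) (adjunctionApp h.some (op pt)) (⟨0⟩, ⟨⟨⟩⟩)

theorem IsDerivator.isPointed_of_isRightKan_evalAt {F : D ⟶ D.shift arrowCat.{w}}
    (h : IsRightKan F (D.evalAt (A := arrowCat.{w}) ⟨0⟩)) (hF : Bicategory.IsLeftAdjoint F) :
    D.IsPointed := by
  let G : D.obj (op pt.{w}) ⥤ D.obj (op (Cat.of (arrowCat.{w} × pt.{w}))) := (F.app (op pt)).toFunctor
  have : G.IsLeftAdjoint := isLeftAdjoint_app hF (op pt)
  -- For the same reason `0_*` is an empty limit at `1`.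
  have : IsEmpty (coslice (sectHom (A := arrowCat.{w}) ⟨0⟩ pt.{w}) (⟨1⟩, ⟨⟨⟩⟩)) :=
    ⟨fun x => absurd (show (1 : Fin 2) ≤ 0 from down_le_of_hom x.hom.1) (by decide)⟩
  exact hD.isPointed_of_isLeftAdjoint (k := sectHom (A := arrowCat.{w}) ⟨0⟩ pt.{w})
    (F := G) (adjunctionApp h.some (op pt)) (⟨1⟩, ⟨⟨⟩⟩)

omit hD in
/-- The projection from the product with the empty category. -/
abbrev emptyProj (C : Cat.{w, w}) : Cat.of (emptyCat.{w} × C) ⟶ C :=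
  (CategoryTheory.Prod.snd emptyCat.{w} C).toCatHom

omit hD in
lemma isEmpty_emptyCat_prod (C : Cat.{w, w}) : IsEmpty (Cat.of (emptyCat.{w} × C)) :=
  ⟨fun x => x.1.as.elim⟩

theorem IsDerivator.isPointed_of_isLeftKan_const {F : D.shift emptyCat.{w} ⟶ D}
    (h : IsLeftKan F (D.const emptyCat.{w})) (hF : Bicategory.IsRightAdjoint F) :
    D.IsPointed := by
  let G : D.obj (op (Cat.of (emptyCat.{w} × pt.{w}))) ⥤ D.obj (op pt.{w}) := (F.app (op pt)).toFunctor
  have : G.IsRightAdjoint := isRightAdjoint_app hF (op pt)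
  have : IsEmpty (slice (emptyProj pt.{w}) ⟨⟨⟩⟩) := ⟨fun x => x.left.1.as.elim⟩
  exact hD.isPointed_of_isRightAdjoint (k := emptyProj pt.{w})
    (F := G) (adjunctionApp h.some (op pt)) ⟨⟨⟩⟩

theorem IsDerivator.isPointed_of_isRightKan_const {F : D.shift emptyCat.{w} ⟶ D}
    (h : IsRightKan F (D.const emptyCat.{w})) (hF : Bicategory.IsLeftAdjoint F) :
    D.IsPointed := by
  let G : D.obj (op (Cat.of (emptyCat.{w} × pt.{w}))) ⥤ D.obj (op pt.{w}) := (F.app (op pt)).toFunctor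
  have : G.IsLeftAdjoint := isLeftAdjoint_app hF (op pt)
  have : IsEmpty (coslice (emptyProj pt.{w}) ⟨⟨⟩⟩) := ⟨fun x => x.right.1.as.elim⟩
  exact hD.isPointed_of_isLeftAdjoint (k := emptyProj pt.{w})
    (F := G) (adjunctionApp h.some (op pt)) ⟨⟨⟩⟩

/-- If `Y` is initial, every arrow from `X` to the restriction of `Y` is universal, since all the
hom-sets compared are singletons. Stability holds because restriction preserves initial objects. -/
theorem IsDerivator.hasStableUniv_const_empty : HasStableUniv (D.const emptyCat.{w}) :=
  fun C X => by
    have (C : Cat.{w, w}) := isEmpty_emptyCat_prod C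
    obtain ⟨Y, ⟨hY⟩⟩ := hD.exists_isInitial C.unop
    have key {C : Cat.{w, w}} {X : D.obj (op (Cat.of (emptyCat.{w} × C)))} {Y : D.obj (op C)}
        (hY : IsInitial Y) (η : X ⟶ (D.pull (emptyProj C)).obj Y) :
        IsUniv (D.pull (emptyProj C)) η := fun Z =>
      have : Nonempty (Y ⟶ Z) := ⟨hY.to Z⟩
      have : Subsingleton (Y ⟶ Z) := ⟨hY.hom_ext⟩
      hD.bijective_of_isEmpty _
    refine ⟨Y, ((hD.nonempty_unique_hom (E := Cat.of (emptyCat.{w} × C.unop))).2 _ _).some.default,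
      key hY _, fun {C'} f => ?_⟩
    obtain ⟨hY'⟩ := hD.nonempty_isInitial_pull f.unop hY
    exact key hY' _

theorem IsDerivator.hasStableCouniv_const_empty : HasStableCouniv (D.const emptyCat.{w}) :=
  fun C X => by
    have (C : Cat.{w, w}) := isEmpty_emptyCat_prod C
    obtain ⟨Y, ⟨hY⟩⟩ := hD.exists_isTerminal C.unop
    have key {C : Cat.{w, w}} {X : D.obj (op (Cat.of (emptyCat.{w} × C)))} {Y : D.obj (op C)}
        (hY : IsTerminal Y) (κ : (D.pull (emptyProj C)).obj Y ⟶ X) :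
        IsCouniv (D.pull (emptyProj C)) κ := fun Z =>
      have : Nonempty (Z ⟶ Y) := ⟨hY.from Z⟩
      have : Subsingleton (Z ⟶ Y) := ⟨hY.hom_ext⟩
      hD.bijective_of_isEmpty _
    refine ⟨Y, ((hD.nonempty_unique_hom (E := Cat.of (emptyCat.{w} × C.unop))).2 _ _).some.default,
      key hY _, fun {C'} f => ?_⟩
    obtain ⟨hY'⟩ := hD.nonempty_isTerminal_pull f.unop hY
    exact key hY' _

/-- Pointedness spreads from `D(𝟙)` to every `D(A)`: the values of an initial diagram are initial,
hence zero, hence terminal, and terminality is detected at objects. -/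
theorem IsDerivator.isZero_of_isInitial (hP : D.IsPointed) {X : D.obj (op A)} (h : IsInitial X) :
    IsZero X := by
  obtain ⟨h'⟩ := hD.nonempty_isTerminal_of_forall (X := X) fun a =>
    ⟨(Prederivator.isZero_of_isInitial hP (hD.nonempty_isInitial_pull (objFunctor a) h)).isTerminal⟩
  exact ⟨fun Y => ⟨⟨⟨h.to Y⟩, fun _ => h.hom_ext _ _⟩⟩, fun Y => ⟨⟨⟨h'.from Y⟩,
    fun _ => h'.hom_ext _ _⟩⟩⟩

theorem IsDerivator.isZero_of_isTerminal (hP : D.IsPointed) {X : D.obj (op A)}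
    (h : IsTerminal X) : IsZero X := by
  obtain ⟨h'⟩ := hD.nonempty_isInitial_of_forall (X := X) fun a =>
    ⟨(Prederivator.isZero_of_isTerminal hP
      (hD.nonempty_isTerminal_pull (objFunctor a) h)).isInitial⟩
  exact ⟨fun Y => ⟨⟨⟨h'.to Y⟩, fun _ => h'.hom_ext _ _⟩⟩, fun Y => ⟨⟨⟨h.from Y⟩,
    fun _ => h.hom_ext _ _⟩⟩⟩

theorem IsDerivator.isZero_app_of_isLeftKan_const (hP : D.IsPointed) {F : D.shift emptyCat.{w} ⟶ D}
    (h : IsLeftKan F (D.const emptyCat.{w})) (C : Cat.{w, w}ᵒᵖ) (Z : (D.shift emptyCat.{w}).obj C) :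
    IsZero ((F.app C).toFunctor.obj Z) := by
  have := isEmpty_emptyCat_prod C.unop
  obtain ⟨i⟩ := hD.nonempty_isInitial_of_isUniv (k := emptyProj C.unop)
    (isUniv_unit (adjunctionApp h.some C) Z)
  exact hD.isZero_of_isInitial hP i

theorem IsDerivator.isZero_app_of_isRightKan_const (hP : D.IsPointed)
    {F : D.shift emptyCat.{w} ⟶ D} (h : IsRightKan F (D.const emptyCat.{w})) (C : Cat.{w, w}ᵒᵖ)
    (Z : (D.shift emptyCat.{w}).obj C) : IsZero ((F.app C).toFunctor.obj Z) := by
  have := isEmpty_emptyCat_prod C.unop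
  obtain ⟨i⟩ := hD.nonempty_isTerminal_of_isCouniv (k := emptyProj C.unop)
    (isCouniv_counit (adjunctionApp h.some C) Z)
  exact hD.isZero_of_isTerminal hP i

/-- Hom-sets in `D(∅ × C)` and hom-sets into a zero object are singletons, so every arrow to `F` is
universal and stability is automatic. -/
theorem IsDerivator.hasStableUniv_of_isZero {F : D.shift emptyCat.{w} ⟶ D}
    (hF : ∀ C Z, IsZero ((F.app C).toFunctor.obj Z)) : HasStableUniv F := fun C X => by
  have (C : Cat.{w, w}) := isEmpty_emptyCat_prod C
  have key {C : Cat.{w, w}ᵒᵖ} {X : D.obj C} {Y : (D.shift emptyCat.{w}).obj C}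
      (η : X ⟶ (F.app C).toFunctor.obj Y) : IsUniv (F.app C).toFunctor η := fun Z =>
    have := (hD.nonempty_unique_hom (E := Cat.of (emptyCat.{w} × C.unop))).2 Y Z
    ⟨fun _ _ _ => this.some.instSubsingleton.elim _ _,
      fun _ => ⟨this.some.default, (hF C Z).eq_of_tgt _ _⟩⟩
  obtain ⟨Y⟩ := (hD.nonempty_unique_hom (E := Cat.of (emptyCat.{w} × C.unop))).1
  exact ⟨Y, (hF C Y).from_ X, key _, fun f => key _⟩

theorem IsDerivator.hasStableCouniv_of_isZero {F : D.shift emptyCat.{w} ⟶ D}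
    (hF : ∀ C Z, IsZero ((F.app C).toFunctor.obj Z)) : HasStableCouniv F := fun C X => by
  have (C : Cat.{w, w}) := isEmpty_emptyCat_prod C
  have key {C : Cat.{w, w}ᵒᵖ} {X : D.obj C} {Y : (D.shift emptyCat.{w}).obj C}
      (κ : (F.app C).toFunctor.obj Y ⟶ X) : IsCouniv (F.app C).toFunctor κ := fun Z =>
    have := (hD.nonempty_unique_hom (E := Cat.of (emptyCat.{w} × C.unop))).2 Z Y
    ⟨fun _ _ _ => this.some.instSubsingleton.elim _ _,
      fun _ => ⟨this.some.default, (hF C Z).eq_of_src _ _⟩⟩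
  obtain ⟨Y⟩ := (hD.nonempty_unique_hom (E := Cat.of (emptyCat.{w} × C.unop))).1
  exact ⟨Y, (hF C Y).to_ X, key _, fun f => key _⟩

end
end Prederivator

/-! ### The equivalence of the seven conditions -/

theorem mainTheorem8 (D : Prederivator.{w, v, u}) (hD : D.IsDerivator) :
    List.TFAE [
      D.IsPointed,
      ∃ F : D.shift Prederivator.emptyCat.{w} ⟶ D,
        Prederivator.IsLeftKan F (D.const Prederivator.emptyCat.{w}) ∧
          Bicategory.IsRightAdjoint F,
      ∃ F : D ⟶ D.shift Prederivator.arrowCat.{w},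
        Prederivator.IsLeftKan F (D.evalAt (A := Prederivator.arrowCat.{w}) ⟨1⟩) ∧
          Bicategory.IsRightAdjoint F,
      ∀ (A B : Cat.{w, w}) (k : A ⟶ B), IsCosieveFunctor k →
        ∃ F : D.shift A ⟶ D.shift B,
          Prederivator.IsLeftKan F (D.restrict k) ∧ Bicategory.IsRightAdjoint F,
      ∃ F : D.shift Prederivator.emptyCat.{w} ⟶ D,
        Prederivator.IsRightKan F (D.const Prederivator.emptyCat.{w}) ∧
          Bicategory.IsLeftAdjoint F,
      ∃ F : D ⟶ D.shift Prederivator.arrowCat.{w},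
        Prederivator.IsRightKan F (D.evalAt (A := Prederivator.arrowCat.{w}) ⟨0⟩) ∧
          Bicategory.IsLeftAdjoint F,
      ∀ (A B : Cat.{w, w}) (k : A ⟶ B), IsSieveFunctor k →
        ∃ F : D.shift A ⟶ D.shift B,
          Prederivator.IsRightKan F (D.restrict k) ∧ Bicategory.IsLeftAdjoint F] := by
  tfae_have 1 → 2 := fun hP =>
    have h : Prederivator.IsLeftKan _ (D.const Prederivator.emptyCat.{w}) :=
      ⟨hD.hasStableUniv_const_empty.adjunction⟩
    ⟨_, h, (hD.hasStableUniv_of_isZero (hD.isZero_app_of_isLeftKan_const hP h)).isRightAdjoint⟩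
  tfae_have 2 → 1 := fun ⟨_, h, hF⟩ => hD.isPointed_of_isLeftKan_const h hF
  tfae_have 1 → 4 := fun hP _ _ k hk =>
    ⟨_, ⟨(hD.hasStableUniv_restrict k).adjunction⟩, (hD.hasStableUniv_of_isCosieveFunctor hP hk
      (hD.hasStableUniv_restrict k).adjunction).isRightAdjoint⟩
  tfae_have 4 → 3 := fun h =>
    have ⟨_, hF, hF'⟩ := h _ _ _ Prederivator.isCosieveFunctor_objFunctor_one
    Prederivator.exists_isLeftKan_evalAt hF hF'
  tfae_have 3 → 1 := fun ⟨_, h, hF⟩ => hD.isPointed_of_isLeftKan_evalAt h hF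
  tfae_have 1 → 5 := fun hP =>
    have h : Prederivator.IsRightKan _ (D.const Prederivator.emptyCat.{w}) :=
      ⟨hD.hasStableCouniv_const_empty.adjunction⟩
    ⟨_, h, (hD.hasStableCouniv_of_isZero (hD.isZero_app_of_isRightKan_const hP h)).isLeftAdjoint⟩
  tfae_have 5 → 1 := fun ⟨_, h, hF⟩ => hD.isPointed_of_isRightKan_const h hF
  tfae_have 1 → 7 := fun hP _ _ k hk =>
    ⟨_, ⟨(hD.hasStableCouniv_restrict k).adjunction⟩, (hD.hasStableCouniv_of_isSieveFunctor hP hk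
      (hD.hasStableCouniv_restrict k).adjunction).isLeftAdjoint⟩
  tfae_have 7 → 6 := fun h =>
    have ⟨_, hF, hF'⟩ := h _ _ _ Prederivator.isSieveFunctor_objFunctor_zero
    Prederivator.exists_isRightKan_evalAt hF hF'
  tfae_have 6 → 1 := fun ⟨_, h, hF⟩ => hD.isPointed_of_isRightKan_evalAt h hF
  tfae_finish
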